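/- Let $\mathfrak{sl}_2=\mathfrak{sl}_2(\mathbb C)$ act on its standard representation $V=\mathbb C^2$ with basis $x,y$ (so $e\,y=x$, $f\,x=y$, $h\,x=x$, $h\,y=-y$). For an element $z$ of the center of $U(\mathfrak{sl}_2)$, let $H_z$ be the quotient of the semidirect product $U(\mathfrak{sl}_2)\ltimes T(V)$ (the algebra generated by $U(\mathfrak{sl}_2)$ and $T(V)$ with relations $av-va=a\cdot v$ for $a\in\mathfrak{sl}_2$, $v\in V$) by the relation $xy-yx=z$. 1. If $z\neq 0$, then every $\mathbb C$-linear derivation of $H_z$ is inner, i.e. $HH^1(H_z,H_z)=0$. 2. The algebra $H=H_0$ is canonically isomorphic to the enveloping algebra $U(\mathfrak{sl}_2\ltimes V)$, where $V$ is an abelian ideal. There is a derivation $E$ of $H$ (the Euler derivation) with $E(a)=0$ for $a\in\mathfrak{sl}_2$, $E(x)=x$, $E(y)=y$; it commutes with the adjoint action of $\mathfrak{sl}_2$ on $H$. The first Hochschild cohomology $HH^1(H,H)$ (derivations modulo inner derivations) is a free module of rank $1$ over the center of $H$, and the class of $E$ is a basis of it. -/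

import Mathlib

open LieAlgebra.SpecialLinear

noncomputable section

/-! ### Hochschild cohomology in degree one -/

/-- The quotient `Z / B` of submodules `B ≤ Z` of a module. -/
abbrev SubmoduleQuotient {R M : Type*} [Ring R] [AddCommGroup M] [Module R M]
    (Z B : Submodule R M) : Type _ :=
  Z ⧸ B.submoduleOf Z

/-- The quotient map `Z → Z / B`. -/
abbrev SubmoduleQuotient.mk {R M : Type*} [Ring R] [AddCommGroup M] [Module R M]
    (Z B : Submodule R M) : Z →ₗ[R] SubmoduleQuotient Z B :=
  (B.submoduleOf Z).mkQ

section Hochschild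

variable (k A : Type*) [CommRing k] [Ring A] [Algebra k A]

/-- The Hochschild differential `C⁰(A, A) = A → C¹(A, A) = Hom_k(A, A)`,
`(d⁰ a)(b) = b a - a b`. It is linear over the center of `A`. -/
def hochschildD0 : A →ₗ[Subalgebra.center k A] (A →ₗ[k] A) where
  toFun a := LinearMap.mulRight k a - LinearMap.mulLeft k a
  map_add' a b := by
    ext c
    simp [mul_add, add_mul]
    abel
  map_smul' c a := by
    ext b
    have hc : b * (c : A) = (c : A) * b := Subalgebra.mem_center_iff.mp c.2 b
    simp only [LinearMap.sub_apply, LinearMap.mulRight_apply, LinearMap.mulLeft_apply,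
      LinearMap.smul_apply, RingHom.id_apply, Subalgebra.smul_def, smul_eq_mul]
    rw [← mul_assoc, hc, mul_sub, mul_assoc, mul_assoc]

/-- The Hochschild differential `C¹(A, A) = Hom_k(A, A) → C²(A, A) = Hom_k(A ⊗ A, A)`
(2-cochains written as bilinear maps),
`(d¹ f)(a, b) = a f(b) - f(a b) + f(a) b`. It is linear over the center of `A`. -/
def hochschildD1 : (A →ₗ[k] A) →ₗ[Subalgebra.center k A] (A →ₗ[k] A →ₗ[k] A) where
  toFun f := LinearMap.mk₂ k (fun a b => a * f b - f (a * b) + f a * b)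
    (by intro a a' b; simp only [add_mul, map_add]; abel)
    (by intro c a b; simp [smul_add, smul_sub])
    (by intro a b b'; simp only [mul_add, map_add]; abel)
    (by intro c a b; simp [smul_add, smul_sub])
  map_add' f g := by
    ext a b
    simp only [LinearMap.mk₂_apply, LinearMap.add_apply, mul_add, add_mul]
    abel
  map_smul' c f := by
    ext a b
    have hc : a * (c : A) = (c : A) * a := Subalgebra.mem_center_iff.mp c.2 a
    simp only [LinearMap.mk₂_apply, LinearMap.smul_apply, RingHom.id_apply,
      Subalgebra.smul_def, smul_eq_mul]
    rw [← mul_assoc, hc, mul_add, mul_sub, mul_assoc, mul_assoc]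

/-- The 1-cocycles `Z¹(A, A)`, that is, the `k`-linear derivations of `A`
(see `mem_hochschildZ1_iff`). -/
abbrev hochschildZ1 : Submodule (Subalgebra.center k A) (A →ₗ[k] A) :=
  LinearMap.ker (hochschildD1 k A)

/-- The 1-coboundaries `B¹(A, A)`, that is, the inner derivations of `A`. -/
abbrev hochschildB1 : Submodule (Subalgebra.center k A) (A →ₗ[k] A) :=
  LinearMap.range (hochschildD0 k A)

/-- The first Hochschild cohomology `HH¹(A, A) = Z¹(A, A) / B¹(A, A)`. -/
def HH1 : Type _ :=
  SubmoduleQuotient (hochschildZ1 k A) (hochschildB1 k A)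

instance : AddCommGroup (HH1 k A) :=
  inferInstanceAs (AddCommGroup (SubmoduleQuotient (hochschildZ1 k A) (hochschildB1 k A)))

/-- `HH¹(A, A)` is a module over the center of `A`, through `(c f)(a) = c f(a)`. -/
instance : Module (Subalgebra.center k A) (HH1 k A) :=
  inferInstanceAs (Module (Subalgebra.center k A)
    (SubmoduleQuotient (hochschildZ1 k A) (hochschildB1 k A)))

/-- The map sending a 1-cocycle to its class in `HH¹(A, A)`. -/
def HH1.mk : hochschildZ1 k A →ₗ[Subalgebra.center k A] HH1 k A :=
  SubmoduleQuotient.mk (hochschildZ1 k A) (hochschildB1 k A)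

variable {k A}

/-- `D` satisfies the Leibniz rule. -/
def IsDerivationMap (D : A →ₗ[k] A) : Prop :=
  ∀ a b, D (a * b) = D a * b + a * D b

/-- `D` is of the form `b ↦ [a, b]`. -/
def IsInnerMap (D : A →ₗ[k] A) : Prop :=
  ∃ a, ∀ b, D b = a * b - b * a

theorem mem_hochschildZ1_iff (D : A →ₗ[k] A) : D ∈ hochschildZ1 k A ↔ IsDerivationMap D := by
  rw [LinearMap.mem_ker, LinearMap.ext_iff₂]
  refine forall₂_congr fun a b => ?_
  simp only [hochschildD1, LinearMap.coe_mk, AddHom.coe_mk, LinearMap.mk₂_apply,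
    LinearMap.zero_apply]
  constructor
  · intro h
    rw [sub_add_eq_add_sub, sub_eq_zero] at h
    rw [← h, add_comm]
  · intro h
    rw [h]
    abel

theorem mem_hochschildB1_iff (D : A →ₗ[k] A) : D ∈ hochschildB1 k A ↔ IsInnerMap D := by
  rw [LinearMap.mem_range]
  constructor
  · rintro ⟨a, rfl⟩
    exact ⟨-a, fun b => by simp [hochschildD0]; abel⟩
  · rintro ⟨a, ha⟩
    refine ⟨-a, LinearMap.ext fun b => ?_⟩
    rw [ha]
    simp [hochschildD0]
    abel

theorem hochschildB1_le_hochschildZ1 : hochschildB1 k A ≤ hochschildZ1 k A := by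
  intro D hD
  obtain ⟨a, ha⟩ := (mem_hochschildB1_iff D).mp hD
  rw [mem_hochschildZ1_iff]
  intro b c
  simp only [ha, sub_mul, mul_sub, mul_assoc]
  abel

theorem HH1.mk_surjective : Function.Surjective (HH1.mk k A) :=
  Submodule.mkQ_surjective _

theorem HH1.mk_eq_zero_iff (D : hochschildZ1 k A) : HH1.mk k A D = 0 ↔ IsInnerMap D.1 :=
  (Submodule.Quotient.mk_eq_zero _).trans (mem_hochschildB1_iff D.1)

end Hochschild

/-! ### The Lie algebra `𝔰𝔩₂` and its standard representation -/

/-- The Lie algebra `𝔰𝔩₂` of traceless complex `2 × 2` matrices. -/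
abbrev SL2 : Type := sl (Fin 2) ℂ

/-- The enveloping algebra of `𝔰𝔩₂`. -/
abbrev USL2 : Type := UniversalEnvelopingAlgebra ℂ SL2

/-- The standard two-dimensional representation `V = ℂ²` of `𝔰𝔩₂`: a matrix acts on a column
vector by multiplication. -/
def StdRep : Type := Fin 2 → ℂ

namespace StdRep

instance : AddCommGroup StdRep := inferInstanceAs (AddCommGroup (Fin 2 → ℂ))

instance : Module ℂ StdRep := inferInstanceAs (Module ℂ (Fin 2 → ℂ))

/-- The action of `𝔰𝔩₂` on `V`, `(a, v) ↦ a v`. -/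
def act : SL2 →ₗ[ℂ] StdRep →ₗ[ℂ] StdRep :=
  LinearMap.mk₂ ℂ (fun (a : SL2) (v : Fin 2 → ℂ) => (Matrix.mulVec a.1 v : Fin 2 → ℂ))
    (fun a b v => Matrix.add_mulVec a.1 b.1 v)
    (fun c a v => Matrix.smul_mulVec c a.1 v)
    (fun a v w => Matrix.mulVec_add a.1 v w)
    (fun c a v => Matrix.mulVec_smul a.1 c v)

theorem act_lie (a b : SL2) (v : StdRep) :
    act ⁅a, b⁆ v = act a (act b v) - act b (act a v) := by
  have h : ∀ w : Fin 2 → ℂ, Matrix.mulVec (a.1 * b.1 - b.1 * a.1) w =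
      Matrix.mulVec a.1 (Matrix.mulVec b.1 w) - Matrix.mulVec b.1 (Matrix.mulVec a.1 w) := by
    intro w
    rw [Matrix.sub_mulVec, Matrix.mulVec_mulVec, Matrix.mulVec_mulVec]
  exact h v

/-- The basis vector `x = (1, 0)` of `V`, the highest weight vector. -/
def x : StdRep := (![1, 0] : Fin 2 → ℂ)

/-- The basis vector `y = (0, 1)` of `V`. -/
def y : StdRep := (![0, 1] : Fin 2 → ℂ)

/-- `V` as an abelian Lie algebra. -/
instance : LieRing StdRep where
  bracket _ _ := 0
  add_lie _ _ _ := (add_zero 0).symm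
  lie_add _ _ _ := (add_zero 0).symm
  lie_self _ := rfl
  leibniz_lie _ _ _ := (add_zero 0).symm

instance : LieAlgebra ℂ StdRep where
  lie_smul c _ _ := (smul_zero c).symm

theorem lie_eq_zero (v w : StdRep) : ⁅v, w⁆ = 0 := rfl

/-- The action of `𝔰𝔩₂` on the abelian Lie algebra `V` by derivations. -/
def actDer : SL2 →ₗ⁅ℂ⁆ LieDerivation ℂ StdRep StdRep where
  toFun a :=
    { toLinearMap := act a
      leibniz' := fun v w => by simp [lie_eq_zero] }
  map_add' a b := by
    ext v
    exact LinearMap.congr_fun (map_add act a b) v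
  map_smul' c a := by
    ext v
    exact LinearMap.congr_fun (map_smul act c a) v
  map_lie' := by
    intro a b
    ext v
    rw [LieDerivation.lie_apply]
    exact act_lie a b v

end StdRep

/-- The semidirect product Lie algebra `𝔰𝔩₂ ⋉ V`, with `V` an abelian ideal. -/
abbrev SL2V : Type := LieAlgebra.SemiDirectSum StdRep SL2 StdRep.actDer

/-! ### The infinitesimal Hecke algebras of `𝔰𝔩₂` -/

namespace HeckeAlg

/-- The relations of the semidirect product `U(𝔰𝔩₂) ⋉ T(V)` among the generators
`𝔰𝔩₂ ⊕ V`: the relations of `U(𝔰𝔩₂)`, and `a v - v a = a · v` for `a` in `𝔰𝔩₂`, `v` in `V`. -/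
inductive SmashRel : TensorAlgebra ℂ (SL2 × StdRep) → TensorAlgebra ℂ (SL2 × StdRep) → Prop
  | lie (a b : SL2) : SmashRel
      (TensorAlgebra.ι ℂ (a, 0) * TensorAlgebra.ι ℂ (b, 0))
      (TensorAlgebra.ι ℂ (b, 0) * TensorAlgebra.ι ℂ (a, 0) + TensorAlgebra.ι ℂ (⁅a, b⁆, 0))
  | act (a : SL2) (v : StdRep) : SmashRel
      (TensorAlgebra.ι ℂ (a, 0) * TensorAlgebra.ι ℂ (0, v))
      (TensorAlgebra.ι ℂ (0, v) * TensorAlgebra.ι ℂ (a, 0) +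
        TensorAlgebra.ι ℂ (0, StdRep.act a v))

/-- The semidirect (smash) product `U(𝔰𝔩₂) ⋉ T(V)`. -/
def Smash : Type := RingQuot SmashRel

instance : Ring Smash := inferInstanceAs (Ring (RingQuot SmashRel))

instance : Algebra ℂ Smash := inferInstanceAs (Algebra ℂ (RingQuot SmashRel))

/-- The quotient map onto `U(𝔰𝔩₂) ⋉ T(V)`. -/
def smashMk : TensorAlgebra ℂ (SL2 × StdRep) →ₐ[ℂ] Smash := RingQuot.mkAlgHom ℂ SmashRel

/-- The map `𝔰𝔩₂ ⊕ V → U(𝔰𝔩₂) ⋉ T(V)`. -/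
def smashGen : SL2 × StdRep →ₗ[ℂ] Smash :=
  smashMk.toLinearMap ∘ₗ TensorAlgebra.ι ℂ

attribute [local instance 100] LieRing.ofAssociativeRing in
/-- The map `U(𝔰𝔩₂) → U(𝔰𝔩₂) ⋉ T(V)`. -/
def smashU : USL2 →ₐ[ℂ] Smash :=
  UniversalEnvelopingAlgebra.lift ℂ
    { smashGen ∘ₗ LinearMap.inl ℂ SL2 StdRep with
      map_lie' := by
        intro a b
        have h : smashMk _ = smashMk _ := RingQuot.mkAlgHom_rel ℂ (SmashRel.lie a b)
        rw [map_add, map_mul, map_mul] at h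
        rw [LieRing.of_associative_ring_bracket]
        exact (sub_eq_of_eq_add' h).symm }

/-- The map `V → U(𝔰𝔩₂) ⋉ T(V)`. -/
def smashV : StdRep →ₗ[ℂ] Smash := smashGen ∘ₗ LinearMap.inr ℂ SL2 StdRep

/-- The relation `x y - y x = z`. -/
inductive Rel (z : USL2) : Smash → Smash → Prop
  | comm : Rel z (smashV StdRep.x * smashV StdRep.y)
      (smashV StdRep.y * smashV StdRep.x + smashU z)

end HeckeAlg

/-- The infinitesimal Hecke algebra `H_z` of `𝔰𝔩₂`: the quotient of `U(𝔰𝔩₂) ⋉ T(V)` by the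
relation `[x, y] = z` (of interest for `z` in the center of `U(𝔰𝔩₂)`). -/
def HeckeAlg (z : USL2) : Type := RingQuot (HeckeAlg.Rel z)

namespace HeckeAlg

instance (z : USL2) : Ring (HeckeAlg z) := inferInstanceAs (Ring (RingQuot (Rel z)))

instance (z : USL2) : Algebra ℂ (HeckeAlg z) :=
  inferInstanceAs (Algebra ℂ (RingQuot (Rel z)))

/-- The quotient map `U(𝔰𝔩₂) ⋉ T(V) → H_z`. -/
def mk (z : USL2) : Smash →ₐ[ℂ] HeckeAlg z := RingQuot.mkAlgHom ℂ (Rel z)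

/-- The canonical map `U(𝔰𝔩₂) → H_z`. -/
def ofU (z : USL2) : USL2 →ₐ[ℂ] HeckeAlg z := (mk z).comp smashU

/-- The canonical map `𝔰𝔩₂ → H_z`. -/
def ofSL2 (z : USL2) (a : SL2) : HeckeAlg z := ofU z (UniversalEnvelopingAlgebra.ι ℂ a)

/-- The canonical map `V → H_z`. -/
def ofV (z : USL2) : StdRep →ₗ[ℂ] HeckeAlg z :=
  (mk z).toLinearMap ∘ₗ smashV

end HeckeAlg

end

/-!
Write `Δ` for the Casimir element of `𝔰𝔩₂`, normalized so that it acts by `(m + 1)²` on a highest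
weight vector of weight `m`. The center of `U(𝔰𝔩₂)` is `ℂ[Δ]`, so `z = ζ(Δ)`.

*Reduction to covariants.* The adjoint action of `𝔰𝔩₂` on `H_z` is locally finite, hence its first
cohomology vanishes and every derivation `D` becomes, after subtracting an inner one, zero on `𝔰𝔩₂`
(`Sl2Plane.exists_inner_on_sl2`). Then `(D x, D y)` is a copy of the standard representation, and
`D` is determined by the highest weight vector `D x` of weight `1`.

*A concrete representation.* Let `𝔰𝔩₂` act by linear vector fields on formal series in
`u ^ (i + 1/2) v ^ j`, with coefficients in `ℂ[T]`. On the part of degree `n + 1/2` the element `Δ`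
acts by `c²`, where `c = n + 3/2`. Choose a polynomial `W` with `W(c) - W(c - 1) = c ζ(c²)`. Then
`x` and `y` can act by `u + ψ ∂/∂v` and `v - ψ ∂/∂u`, where `c (c - 1) ψ = T + W(c - 1)`; this defines a
representation of `H_z` (`exists_latModel`, `HeckeAlg.exists_latRep`). Invariants act in it by
polynomials `G(c²)` (`latInv`) and highest weight vectors of weight `1` by operators `latX P`, where
`G` and `P` are polynomials over `ℂ[T]`.

*All covariants are visible.* Ordering words in the generators and reducing modulo the images of
`ad f` and of a power of `ad e` bounds the number of highest weight vectors of weights `0` and `1`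
in each degree (`Sl2Plane.fil_le_reducedSpan`, `Sl2Plane.fil_le_sup_loweredSpan`). The vectors
`Δᵃ tᵏ`, `Δᵃ tᵏ x`, `Δᵃ tᵏ x'`, where `t` is an invariant acting by `T` and `x'` comes from
`[Δ, x]`, attain the bound, since their images are linearly independent. So invariants are the same
as polynomials `G`, and covariants the same as polynomials `P` (`LatModel.invariants`,
`LatModel.covariants`). The bound alone, applied to `U(𝔰𝔩₂)`, gives its center.

*A functional equation.* Let `P` be attached to `D x`. As `D` kills `[x, y] = ζ(Δ)`, the polynomial
`(T + W(X - 1)) (P(X) + P(1 - X))` is invariant under `X ↦ X + 1`, hence constant in `X`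
(`LatModel.exists_C_of_bracket`). On the other hand, the inner derivation of an invariant `G` has
`P(X) = G(X²) - G((X - 1)²)`, and these are exactly the `P` with `P(X) + P(1 - X) = 0`
(`Polynomial.exists_even_sub_comp`). If `ζ ≠ 0`, then `W` is not constant, so `P(X) + P(1 - X)`
vanishes and `D` is inner. If `ζ = 0`, then `P(X) + P(1 - X)` is a polynomial in `T`, which is
accounted for by a multiple of the Euler derivation by a central element; the latter is not inner
unless it vanishes, because `P(X) + P(1 - X)` is not zero.
-/

noncomputable section

/-! ### Operators satisfying the relations of `𝔰𝔩₂` -/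

section Sl2Ops

open Polynomial

theorem Commute.aeval_left {A : Type*} [Ring A] [Algebra ℂ A] {a b : A} (h : Commute a b)
    (p : ℂ[X]) : Commute (aeval a p) b := by
  rw [aeval_eq_sum_range]
  exact Commute.sum_left _ _ _ fun i _ => (h.pow_left i).smul_left _

variable {M : Type*} [AddCommGroup M] [Module ℂ M]

/-- The operators `E`, `F`, `H` define a representation of `𝔰𝔩₂`. -/
structure Sl2Ops (E F H : Module.End ℂ M) : Prop where
  lie_h_e : H * E - E * H = (2 : ℂ) • E
  lie_h_f : H * F - F * H = (-2 : ℂ) • F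
  lie_e_f : E * F - F * E = H

/-- The Casimir operator, normalized to act on a highest weight vector of weight `m` by
`(m + 1) ^ 2`. -/
def casimirOp (E F H : Module.End ℂ M) : Module.End ℂ M :=
  (4 : ℂ) • (F * E) + H * H + (2 : ℂ) • H + 1

namespace Sl2Ops

variable {E F H : Module.End ℂ M}

/-- The Weyl group symmetry, which exchanges raising and lowering. -/
theorem swap (s : Sl2Ops E F H) : Sl2Ops F E (-H) where
  lie_h_e := by rw [neg_mul, mul_neg, ← neg_sub', s.lie_h_f, neg_smul, neg_neg]
  lie_h_f := by rw [neg_mul, mul_neg, ← neg_sub', s.lie_h_e, neg_smul]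
  lie_e_f := by rw [← s.lie_e_f, neg_sub]

theorem casimirOp_swap (s : Sl2Ops E F H) : casimirOp F E (-H) = casimirOp E F H := by
  have h : E * F = F * E + H := by rw [← s.lie_e_f]; abel
  simp only [casimirOp, h, smul_add, neg_mul_neg, smul_neg]
  module

theorem h_e_apply (s : Sl2Ops E F H) (v : M) : H (E v) = E (H v) + (2 : ℂ) • E v := by
  have := LinearMap.congr_fun s.lie_h_e v
  simpa [sub_eq_iff_eq_add'] using this

theorem h_f_apply (s : Sl2Ops E F H) (v : M) : H (F v) = F (H v) - (2 : ℂ) • F v := by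
  have := LinearMap.congr_fun s.lie_h_f v
  rw [LinearMap.sub_apply, Module.End.mul_apply, Module.End.mul_apply, sub_eq_iff_eq_add'] at this
  rw [this, LinearMap.smul_apply, neg_smul, sub_eq_add_neg]

theorem e_f_apply (s : Sl2Ops E F H) (v : M) : E (F v) = F (E v) + H v := by
  have := LinearMap.congr_fun s.lie_e_f v
  simpa [sub_eq_iff_eq_add'] using this

theorem casimirOp_apply (v : M) :
    casimirOp E F H v = (4 : ℂ) • F (E v) + H (H v) + (2 : ℂ) • H v + v := by
  simp [casimirOp]

theorem casimirOp_comm_e (s : Sl2Ops E F H) : Commute (casimirOp E F H) E := by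
  ext v
  simp only [Module.End.mul_apply, casimirOp_apply, map_add, map_smul, s.e_f_apply, s.h_e_apply]
  module

theorem casimirOp_comm_f (s : Sl2Ops E F H) : Commute (casimirOp E F H) F := by
  rw [← s.casimirOp_swap]
  exact s.swap.casimirOp_comm_e

theorem casimirOp_comm_h (s : Sl2Ops E F H) : Commute (casimirOp E F H) H := by
  have := (s.casimirOp_comm_e.mul_right s.casimirOp_comm_f).sub_right
    (s.casimirOp_comm_f.mul_right s.casimirOp_comm_e)
  rwa [s.lie_e_f] at this

theorem weight_pow_e (s : Sl2Ops E F H) {m : ℂ} {v : M} (hv : H v = m • v) (k : ℕ) :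
    H ((E ^ k) v) = (m + 2 * k) • (E ^ k) v := by
  induction k with
  | zero => simpa using hv
  | succ k ih =>
    rw [pow_succ', Module.End.mul_apply, s.h_e_apply, ih, map_smul]
    push_cast
    module

theorem weight_e (s : Sl2Ops E F H) {m : ℂ} {v : M} (hv : H v = m • v) :
    H (E v) = (m + 2) • E v := by
  simpa using s.weight_pow_e hv 1

theorem weight_f (s : Sl2Ops E F H) {m : ℂ} {v : M} (hv : H v = m • v) :
    H (F v) = (m - 2) • F v := by
  rw [s.h_f_apply, hv, map_smul]
  module

theorem casimirOp_of_weight {m : ℂ} {v : M} (hv : H v = m • v) :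
    casimirOp E F H v = (4 : ℂ) • F (E v) + ((m + 1) ^ 2) • v := by
  rw [casimirOp_apply, hv, map_smul, hv]
  module

theorem casimirOp_of_highest {m : ℂ} {v : M} (hv : H v = m • v) (he : E v = 0) :
    casimirOp E F H v = ((m + 1) ^ 2) • v := by
  rw [casimirOp_of_weight hv, he, map_zero, smul_zero, zero_add]

/-- The polynomial with roots `(m + 2 i + 1) ^ 2` for `i < k`: these are the possible eigenvalues
of the Casimir operator on vectors of weight `m` killed by the `k`-th power of the raising
operator. -/
def weightPoly (m : ℂ) (k : ℕ) : ℂ[X] :=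
  ∏ i ∈ Finset.range k, (X - C ((m + 2 * i + 1) ^ 2))

theorem weightPoly_eval_ne_zero (n k : ℕ) :
    (weightPoly (n + 2 : ℂ) k).eval (((n : ℂ) + 1) ^ 2) ≠ 0 := by
  rw [weightPoly, eval_prod, Finset.prod_ne_zero_iff]
  intro i _
  rw [eval_sub, eval_X, eval_C, sub_ne_zero]
  intro h
  have h2 : (n + 1) ^ 2 = (n + 2 + 2 * i + 1) ^ 2 := by exact_mod_cast h
  have : (n + 1) ^ 2 < (n + 2 + 2 * i + 1) ^ 2 := Nat.pow_lt_pow_left (by omega) two_ne_zero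
  omega

theorem aeval_casimirOp_of_pow_e (s : Sl2Ops E F H) {m : ℂ} (k : ℕ) : ∀ v : M, H v = m • v →
    (E ^ k) v = 0 → aeval (casimirOp E F H) (weightPoly m k) v = 0 := by
  induction k with
  | zero => intro v _ h; simpa [weightPoly] using h
  | succ k ih =>
    intro v hv hk
    have h1 : casimirOp E F H ((E ^ k) v) = ((m + 2 * k + 1) ^ 2) • (E ^ k) v := by
      refine casimirOp_of_highest (s.weight_pow_e hv k) ?_
      rwa [pow_succ', Module.End.mul_apply] at hk
    have h2 : (E ^ k) (casimirOp E F H v) = casimirOp E F H ((E ^ k) v) :=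
      LinearMap.congr_fun (s.casimirOp_comm_e.pow_right k).eq.symm v
    have h3 : H (casimirOp E F H v) = casimirOp E F H (H v) :=
      LinearMap.congr_fun s.casimirOp_comm_h.eq.symm v
    have := ih (casimirOp E F H v - ((m + 2 * k + 1) ^ 2) • v)
      (by rw [map_sub, h3, map_smul, hv, map_smul, smul_sub, smul_comm m])
      (by rw [map_sub, h2, h1, map_smul, sub_self])
    rw [weightPoly, Finset.prod_range_succ, map_mul, Module.End.mul_apply, map_sub, aeval_X,
      aeval_C, LinearMap.sub_apply, Algebra.algebraMap_eq_smul_one, LinearMap.smul_apply,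
      Module.End.one_apply]
    exact this

theorem aeval_casimirOp_of_pow_f (s : Sl2Ops E F H) {m : ℂ} (k : ℕ) (v : M) (hv : H v = (-m) • v)
    (hk : (F ^ k) v = 0) : aeval (casimirOp E F H) (weightPoly m k) v = 0 := by
  rw [← s.casimirOp_swap]
  refine s.swap.aeval_casimirOp_of_pow_e k v ?_ hk
  rw [LinearMap.neg_apply, hv, neg_smul, neg_neg]

theorem aeval_comm {S G : Module.End ℂ M} (h : Commute S G) (p : ℂ[X]) {v : M}
    (hv : aeval S p v = 0) : aeval S p (G v) = 0 := by
  have := LinearMap.congr_fun (h.aeval_left p).eq v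
  simpa only [Module.End.mul_apply, hv, map_zero] using this

theorem aeval_of_weight {S : Module.End ℂ M} {c : ℂ} {w : M} (hw : S w = c • w) (p : ℂ[X]) :
    aeval S p w = p.eval c • w := by
  by_cases h0 : w = 0
  · simp [h0]
  · exact Module.End.aeval_apply_of_hasEigenvector ⟨Module.End.mem_eigenspace_iff.2 hw, h0⟩

theorem eq_zero_of_eigenvector {S : Module.End ℂ M} {c : ℂ} {w : M} (hw : S w = c • w) {p : ℂ[X]}
    (hp : aeval S p w = 0) (hc : p.eval c ≠ 0) : w = 0 := by
  rw [aeval_of_weight hw] at hp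
  exact (smul_eq_zero.1 hp).resolve_left hc

/-- A highest weight vector of weight `n` is not a sum of vectors that come by lowering from
weight `n + 2` and by raising from weight `-(n + 2)`: the Casimir operator separates them. -/
theorem highest_eq_zero (s : Sl2Ops E F H) (n : ℕ) {w a b : M} (hw : H w = (n : ℂ) • w)
    (hew : E w = 0) (ha : H a = (n + 2 : ℂ) • a) (hb : H b = (-(n + 2) : ℂ) • b)
    (hae : ∃ k, (E ^ k) a = 0) (hbf : ∃ k, (F ^ k) b = 0) (h : w = F a + (E ^ (n + 1)) b) :
    w = 0 := by
  obtain ⟨k, hk⟩ := hae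
  obtain ⟨l, hl⟩ := hbf
  have h1 := aeval_comm s.casimirOp_comm_f _ (s.aeval_casimirOp_of_pow_e k a ha hk)
  have h2 := aeval_comm (s.casimirOp_comm_e.pow_right (n + 1)) _
    (s.aeval_casimirOp_of_pow_f l b hb hl)
  refine eq_zero_of_eigenvector (casimirOp_of_highest (F := F) hw hew)
    (p := weightPoly (n + 2 : ℂ) k * weightPoly (n + 2 : ℂ) l) ?_ ?_
  · nth_rw 1 [h]
    rw [map_add, map_mul, Module.End.mul_apply, Module.End.mul_apply, h2, map_zero, add_zero,
      ← Module.End.mul_apply, ← map_mul, mul_comm, map_mul, Module.End.mul_apply, h1, map_zero]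
  · rw [eval_mul]
    exact mul_ne_zero (weightPoly_eval_ne_zero n k) (weightPoly_eval_ne_zero n l)

/-- The raising operator maps the vectors of weight `0` onto those of weight `2`: on the latter
`4 E F` is the Casimir operator minus `1`, which is invertible because the eigenvalue `1` of the
Casimir operator does not occur in weight `2`. -/
theorem exists_e_eq (s : Sl2Ops E F H) {v : M} (hv : H v = (2 : ℂ) • v)
    (hk : ∃ k, (E ^ k) v = 0) : ∃ m, H m = 0 ∧ E m = v := by
  obtain ⟨k, hk⟩ := hk
  set q := weightPoly (2 : ℂ) k with hq
  have hq0 : q.eval 1 ≠ 0 := by simpa using weightPoly_eval_ne_zero 0 k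
  have h1 := s.aeval_casimirOp_of_pow_e k v hv hk
  -- as `q(Δ)` kills `v` and `q(1) ≠ 0`, dividing `q` by `X - 1` inverts `Δ - 1` on `v`
  set u := aeval (casimirOp E F H) (q /ₘ (X - C 1)) v with hu
  have hcu : Commute (aeval (casimirOp E F H) (q /ₘ (X - C 1))) H :=
    s.casimirOp_comm_h.aeval_left _
  have hHu : H u = (2 : ℂ) • u := by
    rw [hu, ← Module.End.mul_apply, ← hcu.eq, Module.End.mul_apply, hv, map_smul]
  have h2 : casimirOp E F H u - u + q.eval 1 • v = 0 := by
    have h3 := modByMonic_add_div q (X - C (1 : ℂ))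
    rw [modByMonic_X_sub_C_eq_C_eval] at h3
    rw [← hq, ← h3] at h1
    simp only [map_add, map_mul, aeval_C, map_sub, aeval_X, LinearMap.add_apply,
      Module.End.mul_apply, LinearMap.sub_apply, Algebra.algebraMap_eq_smul_one,
      LinearMap.smul_apply, Module.End.one_apply, one_smul] at h1
    rw [← h1, hu]
    abel
  have h4 : casimirOp E F H u = (4 : ℂ) • E (F u) + u := by
    rw [casimirOp_of_weight hHu, s.e_f_apply, hHu]
    module
  refine ⟨-(q.eval 1)⁻¹ • (4 : ℂ) • F u, ?_, ?_⟩
  · rw [map_smul, map_smul, s.weight_f hHu]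
    simp
  · rw [h4] at h2
    have h5 : q.eval 1 • v = -((4 : ℂ) • E (F u)) := by
      rw [← sub_eq_zero, sub_neg_eq_add, ← h2]; abel
    rw [map_smul, map_smul, neg_smul, ← smul_neg, ← h5, smul_smul, inv_mul_cancel₀ hq0, one_smul]

/-- The square of the raising operator is injective on the vectors of weight `-2`: on a vector
killed by it the Casimir operator would have the eigenvalue `1`, which does not occur in
weight `-2`. -/
theorem eq_zero_of_e_e (s : Sl2Ops E F H) {v : M} (hv : H v = (-2 : ℂ) • v)
    (hk : ∃ k, (F ^ k) v = 0) (h0 : E (E v) = 0) : v = 0 := by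
  obtain ⟨k, hk⟩ := hk
  have hq0 : (weightPoly (2 : ℂ) k).eval 1 ≠ 0 := by simpa using weightPoly_eval_ne_zero 0 k
  have h1 := s.aeval_casimirOp_of_pow_f k v hv hk
  have hw := s.weight_e hv
  have h2 : casimirOp E F H v = (4 : ℂ) • F (E v) + v := by
    rw [casimirOp_of_weight hv]; module
  have h3 : E (F (E v)) = 0 := by
    rw [s.e_f_apply, h0, hw]
    simp
  have hfe : F (E v) = 0 := by
    refine eq_zero_of_eigenvector (S := casimirOp E F H) (c := 1) ?_
      (aeval_comm s.casimirOp_comm_f _ (aeval_comm s.casimirOp_comm_e _ h1)) hq0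
    have := s.weight_f hw
    rw [casimirOp_of_weight this, h3]
    norm_num
  refine eq_zero_of_eigenvector (S := casimirOp E F H) (c := 1) ?_ h1 hq0
  rw [h2, hfe]
  simp

end Sl2Ops

end Sl2Ops
end

noncomputable section

/-! ### Polynomials and difference equations -/

section Difference

open Polynomial

variable {R : Type*} [CommRing R]

theorem Polynomial.eq_zero_of_forall_nat [IsDomain R] [Algebra ℚ R] {P : R[X]} {s : R}
    (h : ∀ n : ℕ, P.eval (s + n) = 0) : P = 0 := by
  have : CharZero R := algebraRat.charZero R
  refine eq_zero_of_infinite_isRoot P (Set.infinite_of_injective_forall_mem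
    (f := fun n : ℕ => s + n) (fun a b hab => ?_) h)
  exact Nat.cast_injective (add_left_cancel hab)

/-- A polynomial `P` with `P(X + 1) = P(X)` is constant. -/
theorem Polynomial.eq_C_of_periodic [IsDomain R] [Algebra ℚ R] {P : R[X]}
    (h : P.comp (X + 1) = P) : P = C (P.eval 0) := by
  rw [← sub_eq_zero]
  refine eq_zero_of_forall_nat (s := 0) fun n => ?_
  rw [eval_sub, eval_C, sub_eq_zero]
  induction n with
  | zero => simp
  | succ n ih =>
    rw [← ih]
    nth_rw 2 [← h]
    simp

/-- Every polynomial is a difference `G(X) - G(X - 1)`. -/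
theorem Polynomial.exists_sub_comp [Algebra ℚ R] (P : R[X]) :
    ∃ G : R[X], G - G.comp (X - 1) = P := by
  have key : ∃ G : R[X], G.comp (X + 1) - G = P := by
    induction P using Polynomial.induction_on' with
    | add p q hp hq =>
      obtain ⟨G, rfl⟩ := hp
      obtain ⟨K, rfl⟩ := hq
      exact ⟨G + K, by rw [add_comp]; ring⟩
    | monomial n a =>
      -- the Bernoulli polynomials provide the primitives of the monomials
      have hb : (bernoulli (n + 1)).comp (X + 1) - bernoulli (n + 1) = (n + 1 : ℚ[X]) * X ^ n := by
        rw [← C_1, ← sub_eq_zero]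
        refine Polynomial.eq_zero_of_forall_nat (s := 0) fun k => ?_
        have := bernoulli_eval_one_add (n + 1) (0 + k : ℚ)
        simp only [eval_sub, eval_comp, eval_add, eval_X, eval_C, eval_mul, eval_natCast,
          eval_pow] at this ⊢
        rw [add_comm _ (1 : ℚ), this]
        simp
      have hb' := congrArg (Polynomial.map (algebraMap ℚ R)) hb
      rw [Polynomial.map_sub, Polynomial.map_comp] at hb'
      simp only [Polynomial.map_add, Polynomial.map_X, Polynomial.map_one, Polynomial.map_mul,
        Polynomial.map_natCast, Polynomial.map_pow] at hb'
      set B := Polynomial.map (algebraMap ℚ R) (bernoulli (n + 1))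
      refine ⟨C (a * algebraMap ℚ R ((n : ℚ) + 1)⁻¹) * B, ?_⟩
      rw [mul_comp, C_comp, ← mul_sub, hb', ← C_mul_X_pow_eq_monomial, ← mul_assoc]
      congr 1
      have h1 : (n + 1 : R[X]) = C (algebraMap ℚ R (n + 1)) := by simp
      rw [h1, ← C_mul, mul_assoc, ← map_mul, inv_mul_cancel₀ (by positivity), map_one, mul_one]
  obtain ⟨G, hG⟩ := key
  refine ⟨G.comp (X + 1), ?_⟩
  rw [comp_assoc]
  simpa using hG

/-- An even polynomial is a polynomial in `X²`. -/
theorem Polynomial.eq_comp_sq_of_even [IsDomain R] [Algebra ℚ R] {P : R[X]} (h : P.comp (-X) = P) :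
    ∃ Q : R[X], P = Q.comp (X ^ 2) := by
  have : CharZero R := algebraRat.charZero R
  refine ⟨contract 2 P, ?_⟩
  rw [← expand_eq_comp_X_pow]
  ext n
  rw [coeff_expand two_pos, coeff_contract two_ne_zero]
  split_ifs with hn
  · rw [Nat.div_mul_cancel hn]
  · have h1 : (P.comp (-X)).coeff n = -P.coeff n := by
      rw [show (-X : R[X]) = C (-1) * X by simp, comp_C_mul_X_coeff,
        Odd.neg_one_pow (Nat.odd_iff.2 (by omega))]
      simp
    rw [h] at h1
    exact self_eq_neg.1 h1

/-- If `P(1 - X) = -P(X)`, then `P(X) = G(X²) - G((X - 1)²)` for some polynomial `G`. -/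
theorem Polynomial.exists_even_sub_comp [IsDomain R] [Algebra ℚ R] {P : R[X]}
    (h : P.comp (1 - X) = -P) :
    ∃ G : R[X], G.comp (X ^ 2) - G.comp ((X - 1) ^ 2) = P := by
  obtain ⟨G, hG⟩ := exists_sub_comp P
  -- a primitive `G` of `P` is even, as `G(-X) - G(X)` is periodic and vanishes at `0`
  have h1 : (G.comp (-X) - G).comp (X - 1) = G.comp (-X) - G := by
    have h2 := congrArg (fun Q => Q.comp (1 - X)) hG
    simp only [sub_comp, comp_assoc, X_comp, one_comp, neg_comp, h] at h2 ⊢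
    rw [show (1 - X - 1 : R[X]) = -X by ring] at h2
    rw [show (-(X - 1) : R[X]) = 1 - X by ring]
    rw [← hG] at h2
    linear_combination h2
  have h3 : (G.comp (-X) - G).comp (X + 1) = G.comp (-X) - G := by
    nth_rw 1 [← h1]
    rw [comp_assoc]
    simp
  have h4 := eq_C_of_periodic h3
  rw [eval_sub, eval_comp] at h4
  simp only [eval_neg, eval_X, neg_zero, sub_self, C_0] at h4
  obtain ⟨Q, hQ⟩ := eq_comp_sq_of_even (sub_eq_zero.1 h4)
  refine ⟨Q, ?_⟩
  rw [← hG, hQ, comp_assoc]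
  simp

end Difference
end

noncomputable section

/-! ### Algebras generated by `𝔰𝔩₂` and its standard representation -/

/-- Names of the generators `e, f, h` of `𝔰𝔩₂` and `x, y` of its standard representation. -/
inductive Gen
  | e | f | h | x | y
  deriving DecidableEq

namespace Gen

instance : Fintype Gen where
  elems := {e, f, h, x, y}
  complete g := by cases g <;> decide

theorem sum_univ {M : Type*} [AddCommMonoid M] (u : Gen → M) :
    ∑ g, u g = u e + u f + u h + u x + u y := by
  have : (Finset.univ : Finset Gen) = {e, f, h, x, y} := rfl
  rw [this]
  simp [add_assoc]

/-- The degree of a generator: `1` on `𝔰𝔩₂`, and a parameter `d` on the plane. -/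
def deg (d : ℕ) : Gen → ℕ
  | e | f | h => 1
  | x | y => d

/-- The weight of a generator, its eigenvalue under `ad h`. -/
def wt : Gen → ℤ
  | e => 2
  | f => -2
  | h => 0
  | x => 1
  | y => -1

/-- `ad e` sends the generator `g` to `g.coefE` times the generator `g.tgtE`. Where the
coefficient vanishes, the target is chosen of the same degree as `g`. -/
def coefE : Gen → ℂ
  | e | x => 0
  | f | y => 1
  | h => -2

/-- The generator of which `ad e` of the given generator is a multiple; see `coefE`. -/
def tgtE : Gen → Gen
  | e | h => e
  | f => h
  | x | y => x

/-- `ad f` sends the generator `g` to `g.coefF` times the generator `g.tgtF`, as for `coefE`. -/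
def coefF : Gen → ℂ
  | f | y => 0
  | e => -1
  | h => 2
  | x => 1

/-- The generator of which `ad f` of the given generator is a multiple; see `coefF`. -/
def tgtF : Gen → Gen
  | f | h => f
  | e => h
  | x | y => y

theorem deg_tgtE (d : ℕ) (g : Gen) : g.tgtE.deg d = g.deg d := by cases g <;> rfl

theorem deg_tgtF (d : ℕ) (g : Gen) : g.tgtF.deg d = g.deg d := by cases g <;> rfl

theorem wt_tgtE {g : Gen} (hg : g.coefE ≠ 0) : g.tgtE.wt = g.wt + 2 := by
  cases g <;> simp_all [coefE, tgtE, wt]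

theorem wt_tgtF {g : Gen} (hg : g.coefF ≠ 0) : g.tgtF.wt = g.wt + (-2) := by
  cases g <;> simp_all [coefF, tgtF, wt]

/-- The degree of a word in the generators. -/
def degW (d : ℕ) (l : List Gen) : ℕ := (l.map (deg d)).sum

/-- The weight of a word in the generators. -/
def wtW (l : List Gen) : ℤ := (l.map wt).sum

@[simp] theorem degW_nil (d : ℕ) : degW d [] = 0 := rfl
@[simp] theorem wtW_nil : wtW [] = 0 := rfl
@[simp] theorem degW_cons (d : ℕ) (g : Gen) (l : List Gen) :
    degW d (g :: l) = g.deg d + degW d l := by simp [degW]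
@[simp] theorem wtW_cons (g : Gen) (l : List Gen) : wtW (g :: l) = g.wt + wtW l := by simp [wtW]
@[simp] theorem degW_append (d : ℕ) (l l' : List Gen) :
    degW d (l ++ l') = degW d l + degW d l' := by simp [degW]
@[simp] theorem wtW_append (l l' : List Gen) : wtW (l ++ l') = wtW l + wtW l' := by simp [wtW]
@[simp] theorem degW_replicate (d n : ℕ) (g : Gen) :
    degW d (List.replicate n g) = n * g.deg d := by simp [degW]
@[simp] theorem wtW_replicate (n : ℕ) (g : Gen) :
    wtW (List.replicate n g) = n * g.wt := by simp [wtW]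

theorem degW_perm (d : ℕ) {l l' : List Gen} (h : l.Perm l') : degW d l = degW d l' :=
  (h.map _).sum_eq

theorem wtW_perm {l l' : List Gen} (h : l.Perm l') : wtW l = wtW l' :=
  (h.map _).sum_eq

/-- The ordered word `eⁱ hᵇ fʲ xᵖ y^q`. -/
def mon (i b j p q : ℕ) : List Gen :=
  List.replicate i e ++ List.replicate b h ++ List.replicate j f ++ List.replicate p x ++
    List.replicate q y

theorem count_mon (i b j p q : ℕ) (g : Gen) : (mon i b j p q).count g =
    match g with
    | e => i
    | h => b
    | f => j
    | x => p
    | y => q := by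
  cases g <;> simp [mon, List.count_replicate]

theorem degW_mon (d i b j p q : ℕ) : degW d (mon i b j p q) = i + b + j + (p + q) * d := by
  simp [mon, deg]; ring

theorem wtW_mon (i b j p q : ℕ) : wtW (mon i b j p q) = 2 * i - 2 * j + p - q := by
  simp [mon, wt]; ring

theorem perm_mon (l : List Gen) :
    l.Perm (mon (l.count e) (l.count h) (l.count f) (l.count x) (l.count y)) := by
  rw [List.perm_iff_count]
  intro g
  rw [count_mon]
  cases g <;> rfl

end Gen

open Gen

/-- An algebra generated by elements `e, f, h, x, y` such that `e, f, h` satisfy the relations of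
`𝔰𝔩₂` and `x, y` span a copy (or a quotient) of its standard representation. -/
structure Sl2Plane (A : Type*) [Ring A] [Algebra ℂ A] where
  /-- The generators. -/
  gen : Gen → A
  lie_e (g : Gen) : gen e * gen g - gen g * gen e = g.coefE • gen g.tgtE
  lie_f (g : Gen) : gen f * gen g - gen g * gen f = g.coefF • gen g.tgtF
  lie_h (g : Gen) : gen h * gen g - gen g * gen h = (g.wt : ℂ) • gen g
  adjoin_eq_top : Algebra.adjoin ℂ (Set.range gen) = ⊤

/-- The commutator `b ↦ a b - b a`. -/
def adOp {A : Type*} [Ring A] [Algebra ℂ A] (a : A) : Module.End ℂ A :=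
  LinearMap.mulLeft ℂ a - LinearMap.mulRight ℂ a

section adOp

variable {A : Type*} [Ring A] [Algebra ℂ A]

theorem adOp_apply (a b : A) : adOp a b = a * b - b * a := rfl

theorem adOp_mul (a b c : A) : adOp a (b * c) = adOp a b * c + b * adOp a c := by
  simp only [adOp_apply]
  noncomm_ring

theorem adOp_one (a : A) : adOp a 1 = 0 := by simp [adOp_apply]

theorem adOp_lie (a b : A) : adOp a * adOp b - adOp b * adOp a = adOp (a * b - b * a) := by
  ext c
  simp only [LinearMap.sub_apply, Module.End.mul_apply, adOp_apply]
  noncomm_ring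

theorem adOp_smul (c : ℂ) (a : A) : adOp (c • a) = c • adOp a := by
  ext b
  simp [adOp_apply, smul_sub]

theorem adOp_add (a b : A) : adOp (a + b) = adOp a + adOp b :=
  LinearMap.ext fun c => by
    simp only [adOp_apply, LinearMap.add_apply]
    noncomm_ring

theorem adOp_eq_zero_iff {a b : A} : adOp a b = 0 ↔ Commute a b := by
  rw [adOp_apply, sub_eq_zero]
  rfl

theorem adOp_mul_of_commute {a b : A} (h : Commute a b) (c : A) :
    adOp a (b * c) = b * adOp a c := by
  rw [adOp_mul, adOp_eq_zero_iff.2 h, zero_mul, zero_add]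

theorem adOp_adOp_of_commute {a b c : A} (h : Commute a b) :
    adOp a (adOp b c) = adOp b (adOp a c) := by
  rw [adOp_apply b, map_sub, adOp_mul, adOp_mul, adOp_eq_zero_iff.2 h]
  simp [adOp_apply b]

end adOp

namespace Sl2Plane

variable {A : Type*} [Ring A] [Algebra ℂ A] (s : Sl2Plane A)

/-- The element of `A` given by a word in the generators. -/
def word (l : List Gen) : A := (l.map s.gen).prod

@[simp] theorem word_nil : s.word [] = 1 := rfl

@[simp] theorem word_cons (g : Gen) (l : List Gen) : s.word (g :: l) = s.gen g * s.word l := by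
  simp [word]

@[simp] theorem word_append (l l' : List Gen) : s.word (l ++ l') = s.word l * s.word l' := by
  simp [word]

/-- The span of the words of degree less than `n` and of weight `μ`. The strict inequality makes
`fil d 0 μ` zero, so that induction on `n` needs no base case. -/
def fil (d n : ℕ) (μ : ℤ) : Submodule ℂ A :=
  Submodule.span ℂ {a | ∃ l : List Gen, degW d l < n ∧ wtW l = μ ∧ s.word l = a}

variable {s} {d : ℕ}

theorem word_mem {n : ℕ} {μ : ℤ} {l : List Gen} (h : degW d l < n) (h' : wtW l = μ) :
    s.word l ∈ s.fil d n μ :=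
  Submodule.subset_span ⟨l, h, h', rfl⟩

theorem one_mem_fil : (1 : A) ∈ s.fil d 1 0 := by
  have : s.word [] ∈ s.fil d 1 0 := word_mem (by simp) rfl
  simpa using this

theorem fil_le_iff {n : ℕ} {μ : ℤ} {K : Submodule ℂ A} :
    s.fil d n μ ≤ K ↔ ∀ l, degW d l < n → wtW l = μ → s.word l ∈ K := by
  rw [fil, Submodule.span_le]
  constructor
  · intro h l h1 h2
    exact h ⟨l, h1, h2, rfl⟩
  · rintro h _ ⟨l, h1, h2, rfl⟩
    exact h l h1 h2

theorem fil_mono {m n : ℕ} (h : m ≤ n) (μ : ℤ) : s.fil d m μ ≤ s.fil d n μ :=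
  fil_le_iff.2 fun _ h1 h2 => word_mem (h1.trans_le h) h2

theorem word_mul_mem {n : ℕ} {μ : ℤ} {a : A} (ha : a ∈ s.fil d n μ) (l : List Gen) :
    s.word l * a ∈ s.fil d (degW d l + n) (wtW l + μ) := by
  have : s.fil d n μ ≤
      (s.fil d (degW d l + n) (wtW l + μ)).comap (LinearMap.mulLeft ℂ (s.word l)) :=
    fil_le_iff.2 fun l' h1 h2 => by
      rw [Submodule.mem_comap, LinearMap.mulLeft_apply, ← word_append]
      exact word_mem (by rw [degW_append]; omega) (by rw [wtW_append, h2])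
  exact this ha

theorem mul_word_mem {n : ℕ} {μ : ℤ} {a : A} (ha : a ∈ s.fil d n μ) (l : List Gen) :
    a * s.word l ∈ s.fil d (n + degW d l) (μ + wtW l) := by
  have : s.fil d n μ ≤
      (s.fil d (n + degW d l) (μ + wtW l)).comap (LinearMap.mulRight ℂ (s.word l)) :=
    fil_le_iff.2 fun l' h1 h2 => by
      rw [Submodule.mem_comap, LinearMap.mulRight_apply, ← word_append]
      exact word_mem (by rw [degW_append]; omega) (by rw [wtW_append, h2])
  exact this ha

theorem gen_mul_mem {n : ℕ} {μ : ℤ} {a : A} (ha : a ∈ s.fil d n μ) (g : Gen) :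
    s.gen g * a ∈ s.fil d (g.deg d + n) (g.wt + μ) := by
  simpa using word_mul_mem ha [g]

theorem mul_mem {m n : ℕ} {μ ν : ℤ} {a b : A} (ha : a ∈ s.fil d (m + 1) μ)
    (hb : b ∈ s.fil d (n + 1) ν) : a * b ∈ s.fil d (m + n + 1) (μ + ν) := by
  have : s.fil d (n + 1) ν ≤ (s.fil d (m + n + 1) (μ + ν)).comap (LinearMap.mulLeft ℂ a) :=
    fil_le_iff.2 fun l' h1 h2 => by
      rw [Submodule.mem_comap, LinearMap.mulLeft_apply]
      have := mul_word_mem ha l'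
      rw [h2] at this
      exact fil_mono (by omega) _ this
  exact this hb

/-- The commutator `[x, y]` has degree less than twice the degree `d` of `x` and `y`, so that the
generators commute up to terms of smaller degree. -/
structure IsFiltered (s : Sl2Plane A) (d : ℕ) : Prop where
  pos : 1 ≤ d
  comm_mem : s.gen x * s.gen y - s.gen y * s.gen x ∈ s.fil d (2 * d) 0

theorem gen_mem {n : ℕ} {μ : ℤ} (g : Gen) (h : g.deg d < n) (h' : g.wt = μ) :
    s.gen g ∈ s.fil d n μ := by
  have : s.word [g] ∈ s.fil d n μ := word_mem (by simpa using h) (by simpa using h')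
  simpa using this

theorem coefE_smul_mem (g : Gen) :
    g.coefE • s.gen g.tgtE ∈ s.fil d (1 + g.deg d) (2 + g.wt) := by
  by_cases h0 : g.coefE = 0
  · simp [h0]
  · exact Submodule.smul_mem _ _ (gen_mem _ (by rw [deg_tgtE]; omega)
      (by rw [wt_tgtE h0, add_comm]))

theorem coefF_smul_mem (g : Gen) :
    g.coefF • s.gen g.tgtF ∈ s.fil d (1 + g.deg d) (-2 + g.wt) := by
  by_cases h0 : g.coefF = 0
  · simp [h0]
  · exact Submodule.smul_mem _ _ (gen_mem _ (by rw [deg_tgtF]; omega)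
      (by rw [wt_tgtF h0, add_comm]))

theorem gen_comm_mem (hs : s.IsFiltered d) (g g' : Gen) :
    s.gen g * s.gen g' - s.gen g' * s.gen g ∈ s.fil d (g.deg d + g'.deg d) (g.wt + g'.wt) := by
  have he : ∀ g, s.gen e * s.gen g - s.gen g * s.gen e ∈ s.fil d (1 + g.deg d) (2 + g.wt) :=
    fun g => s.lie_e g ▸ coefE_smul_mem g
  have hf : ∀ g, s.gen f * s.gen g - s.gen g * s.gen f ∈ s.fil d (1 + g.deg d) (-2 + g.wt) :=
    fun g => s.lie_f g ▸ coefF_smul_mem g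
  have hh : ∀ g, s.gen h * s.gen g - s.gen g * s.gen h ∈ s.fil d (1 + g.deg d) (0 + g.wt) :=
    fun g => s.lie_h g ▸ Submodule.smul_mem _ _ (gen_mem _ (by omega) (by rw [zero_add]))
  have hn : ∀ {n μ} {a b : A}, a * b - b * a ∈ s.fil d n μ → b * a - a * b ∈ s.fil d n μ := by
    intro n μ a b hab
    rw [← neg_sub]
    exact Submodule.neg_mem _ hab
  cases g
  case e => exact he g'
  case f => exact hf g'
  case h => exact hh g'
  all_goals
    cases g'
    case e => exact hn (by rw [add_comm, add_comm (wt _)]; exact he _)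
    case f => exact hn (by rw [add_comm, add_comm (wt _)]; exact hf _)
    case h => exact hn (by rw [add_comm, add_comm (wt _)]; exact hh _)
  · simp
  · simpa [deg, wt, two_mul] using hs.comm_mem
  · simpa [deg, wt, two_mul] using hn hs.comm_mem
  · simp

/-- Permuting the letters of a word changes it by an element of smaller degree. -/
theorem word_perm (hs : s.IsFiltered d) {l l' : List Gen} (h : l.Perm l') :
    s.word l - s.word l' ∈ s.fil d (degW d l) (wtW l) := by
  induction h with
  | nil => simp
  | cons g h ih =>
    rw [word_cons, word_cons, ← mul_sub, degW_cons, wtW_cons]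
    exact gen_mul_mem ih g
  | swap a b l =>
    have := mul_word_mem (gen_comm_mem hs b a) l
    simpa [sub_mul, mul_assoc, add_assoc] using this
  | trans h1 h2 ih1 ih2 =>
    rw [← degW_perm d h1, ← wtW_perm h1] at ih2
    simpa using Submodule.add_mem _ ih1 ih2

/-- The leading part of the commutator of an element `a` with a word, when the commutator of `a`
with each generator is a multiple of a generator. -/
theorem adOp_word_sub_mem (hs : s.IsFiltered d) {a : A} {c : Gen → ℂ} {t : Gen → Gen} {k : ℤ}
    (hc : ∀ g, adOp a (s.gen g) = c g • s.gen (t g)) (hd : ∀ g, (t g).deg d = g.deg d)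
    (hw : ∀ g, c g ≠ 0 → (t g).wt = g.wt + k) (l : List Gen) :
    adOp a (s.word l) - ∑ g, ((l.count g : ℂ) * c g) • s.word (t g :: l.erase g) ∈
      s.fil d (degW d l) (wtW l + k) := by
  induction l with
  | nil => simp [adOp_one]
  | cons b l ih =>
    have h1 := gen_mul_mem ih b
    rw [mul_sub, Finset.mul_sum] at h1
    have h2 : ∀ g, (((b :: l).count g : ℂ) * c g) • s.word (t g :: (b :: l).erase g) -
        ((if g = b then c g else 0) • s.word (t g :: l) +
          s.gen b * (((l.count g : ℂ) * c g) • s.word (t g :: l.erase g))) ∈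
        s.fil d (degW d (b :: l)) (wtW (b :: l) + k) := by
      intro g
      by_cases h0 : c g = 0
      · simp [h0]
      by_cases hgl : g ∈ l
      · have hp2 : (t g :: (b :: l).erase g).Perm (b :: t g :: l.erase g) := by
          refine List.Perm.trans (List.Perm.cons _ ?_) (List.Perm.swap _ _ _)
          by_cases hgb : g = b
          · subst hgb
            simpa using List.perm_cons_erase hgl
          · rw [List.erase_cons_tail (by simpa using Ne.symm hgb)]
        have hm := word_perm hs hp2
        have hdeg : degW d (t g :: (b :: l).erase g) = degW d (b :: l) := by
          rw [degW_perm d (List.perm_cons_erase (List.mem_cons_of_mem b hgl)), degW_cons,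
            degW_cons, hd]
        have hwt : wtW (t g :: (b :: l).erase g) = wtW (b :: l) + k := by
          rw [wtW_perm (List.perm_cons_erase (List.mem_cons_of_mem b hgl)), wtW_cons,
            wtW_cons, hw g h0]
          ring
        rw [hdeg, hwt] at hm
        have hm' := Submodule.smul_mem _ ((l.count g : ℂ) * c g) hm
        rw [word_cons s b, smul_sub] at hm'
        convert hm' using 1
        rw [mul_smul_comm]
        by_cases hgb : g = b
        · subst hgb
          simp only [List.count_cons_self, if_true, List.erase_cons_head]
          push_cast
          module
        · simp only [List.count_cons_of_ne (Ne.symm hgb), if_neg hgb]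
          module
      · by_cases hgb : g = b
        · subst hgb
          simp [List.count_eq_zero_of_not_mem hgl]
        · simp [List.count_eq_zero_of_not_mem hgl, hgb, List.count_cons_of_ne (Ne.symm hgb)]
    have h3 := Submodule.sum_mem _ (fun g (_ : g ∈ Finset.univ) => h2 g)
    rw [Finset.sum_sub_distrib, Finset.sum_add_distrib] at h3
    have h4 : ∑ g, (if g = b then c g else 0) • s.word (t g :: l) =
        adOp a (s.gen b) * s.word l := by
      rw [Finset.sum_eq_single b]
      · simp [hc]
      · intro g _ hg
        simp [hg]
      · simp
    rw [h4] at h3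
    rw [← add_assoc, ← degW_cons, ← wtW_cons] at h1
    have h5 := Submodule.sub_mem _ h1 h3
    rw [word_cons, adOp_mul]
    convert h5 using 1
    abel

end Sl2Plane
end

noncomputable section

open Gen

/-! ### Coinvariants of the adjoint action -/

namespace Sl2Plane

set_option linter.unusedSimpArgs false

variable {A : Type*} [Ring A] [Algebra ℂ A] (s : Sl2Plane A)

/-- The Casimir element, normalized to act on a highest weight vector of weight `m` by
`(m + 1) ^ 2`. -/
def cas : A :=
  (4 : ℂ) • (s.gen f * s.gen e) + s.gen h * s.gen h + (2 : ℂ) • s.gen h + 1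

theorem e_h : s.gen h * s.gen e - s.gen e * s.gen h = (2 : ℂ) • s.gen e := by
  simpa [wt] using s.lie_h e

theorem f_h : s.gen h * s.gen f - s.gen f * s.gen h = (-2 : ℂ) • s.gen f := by
  simpa [wt] using s.lie_h f

theorem e_f : s.gen e * s.gen f - s.gen f * s.gen e = s.gen h := by
  simpa [coefE, tgtE] using s.lie_e f

theorem sl2Ops_adOp : Sl2Ops (adOp (s.gen e)) (adOp (s.gen f)) (adOp (s.gen h)) where
  lie_h_e := by rw [adOp_lie, s.e_h, adOp_smul]
  lie_h_f := by rw [adOp_lie, s.f_h, adOp_smul]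
  lie_e_f := by rw [adOp_lie, s.e_f]

theorem sl2Ops_mulLeft : Sl2Ops (LinearMap.mulLeft ℂ (s.gen e)) (LinearMap.mulLeft ℂ (s.gen f))
    (LinearMap.mulLeft ℂ (s.gen h)) where
  lie_h_e := by
    ext a
    simp only [LinearMap.sub_apply, Module.End.mul_apply, LinearMap.mulLeft_apply,
      LinearMap.smul_apply, ← mul_assoc, ← sub_mul, s.e_h, smul_mul_assoc]
  lie_h_f := by
    ext a
    simp only [LinearMap.sub_apply, Module.End.mul_apply, LinearMap.mulLeft_apply,
      LinearMap.smul_apply, ← mul_assoc, ← sub_mul, s.f_h, smul_mul_assoc]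
  lie_e_f := by
    ext a
    simp only [LinearMap.sub_apply, Module.End.mul_apply, LinearMap.mulLeft_apply,
      ← mul_assoc, ← sub_mul, s.e_f]

theorem casimirOp_mulLeft : casimirOp (LinearMap.mulLeft ℂ (s.gen e))
    (LinearMap.mulLeft ℂ (s.gen f)) (LinearMap.mulLeft ℂ (s.gen h)) =
    LinearMap.mulLeft ℂ s.cas := by
  ext a
  simp [Sl2Ops.casimirOp_apply, cas, add_mul, mul_assoc]

variable {s}

/-- The Casimir element commutes with `e`; this is the commutation of the Casimir operator of the
left regular representation, evaluated at `1`. -/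
theorem commute_e_cas : Commute (s.gen e) s.cas := by
  have := s.sl2Ops_mulLeft.casimirOp_comm_e
  rw [casimirOp_mulLeft] at this
  change s.gen e * s.cas = s.cas * s.gen e
  simpa using LinearMap.congr_fun this.eq.symm 1

theorem commute_f_cas : Commute (s.gen f) s.cas := by
  have := s.sl2Ops_mulLeft.casimirOp_comm_f
  rw [casimirOp_mulLeft] at this
  change s.gen f * s.cas = s.cas * s.gen f
  simpa using LinearMap.congr_fun this.eq.symm 1

theorem commute_h_cas : Commute (s.gen h) s.cas := by
  have := s.sl2Ops_mulLeft.casimirOp_comm_h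
  rw [casimirOp_mulLeft] at this
  change s.gen h * s.cas = s.cas * s.gen h
  simpa using LinearMap.congr_fun this.eq.symm 1

variable {d : ℕ}

theorem adOp_mem {a : A} {c : Gen → ℂ} {t : Gen → Gen} {k : ℤ}
    (hc : ∀ g, adOp a (s.gen g) = c g • s.gen (t g)) (hd : ∀ g, (t g).deg d = g.deg d)
    (hw : ∀ g, c g ≠ 0 → (t g).wt = g.wt + k) {n : ℕ} {μ : ℤ} {b : A} (hb : b ∈ s.fil d n μ) :
    adOp a b ∈ s.fil d n (μ + k) := by
  have key : ∀ l : List Gen, adOp a (s.word l) ∈ s.fil d (degW d l + 1) (wtW l + k) := by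
    intro l
    induction l with
    | nil => simp [adOp_one]
    | cons g l ih =>
      rw [word_cons, adOp_mul, hc, degW_cons, wtW_cons]
      refine Submodule.add_mem _ ?_ ?_
      · by_cases h0 : c g = 0
        · simp [h0]
        · rw [smul_mul_assoc, ← word_cons]
          refine Submodule.smul_mem _ _ (word_mem ?_ ?_)
          · rw [degW_cons, hd]; omega
          · rw [wtW_cons, hw g h0]; ring
      · rw [add_assoc, add_assoc]
        exact gen_mul_mem ih g
  have : s.fil d n μ ≤ (s.fil d n (μ + k)).comap (adOp a) :=
    fil_le_iff.2 fun l h1 h2 => by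
      have := key l
      rw [h2] at this
      exact fil_mono (by omega) _ this
  exact this hb

theorem adOp_e_mem {n : ℕ} {μ : ℤ} {b : A} (hb : b ∈ s.fil d n μ) :
    adOp (s.gen e) b ∈ s.fil d n (μ + 2) :=
  adOp_mem s.lie_e (deg_tgtE d) (fun _ => wt_tgtE) hb

theorem adOp_f_mem {n : ℕ} {μ : ℤ} {b : A} (hb : b ∈ s.fil d n μ) :
    adOp (s.gen f) b ∈ s.fil d n (μ + (-2)) :=
  adOp_mem s.lie_f (deg_tgtF d) (fun _ => wt_tgtF) hb

theorem adOp_h_word (l : List Gen) : adOp (s.gen h) (s.word l) = (wtW l : ℂ) • s.word l := by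
  induction l with
  | nil => simp [adOp_one]
  | cons g l ih =>
    rw [word_cons, adOp_mul, ih, show adOp (s.gen h) (s.gen g) = _ from s.lie_h g, wtW_cons,
      smul_mul_assoc, mul_smul_comm]
    push_cast
    module

theorem adOp_h_of_mem {n : ℕ} {μ : ℤ} {b : A} (hb : b ∈ s.fil d n μ) :
    adOp (s.gen h) b = (μ : ℂ) • b := by
  have : s.fil d n μ ≤ LinearMap.ker (adOp (s.gen h) - (μ : ℂ) • LinearMap.id) :=
    fil_le_iff.2 fun l _ h2 => by
      rw [LinearMap.mem_ker, LinearMap.sub_apply, adOp_h_word, h2]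
      simp
  have := this hb
  rw [LinearMap.mem_ker, LinearMap.sub_apply, sub_eq_zero] at this
  exact this

theorem abs_wtW_le (hd : 1 ≤ d) (l : List Gen) : |wtW l| ≤ 2 * degW d l := by
  induction l with
  | nil => simp
  | cons g l ih =>
    rw [wtW_cons, degW_cons]
    refine (abs_add_le _ _).trans ?_
    have : |g.wt| ≤ 2 * g.deg d := by cases g <;> simp [wt, deg] <;> omega
    push_cast
    omega

/-- The weight of a word is bounded in terms of its degree. This makes `ad e` and `ad f` locally
nilpotent. -/
theorem fil_eq_bot (hd : 1 ≤ d) {n : ℕ} {μ : ℤ} (h : 2 * (n : ℤ) ≤ |μ|) : s.fil d n μ = ⊥ := by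
  rw [eq_bot_iff]
  refine fil_le_iff.2 fun l h1 h2 => ?_
  have := abs_wtW_le hd l
  rw [h2] at this
  omega

theorem pow_adOp_e_mem {n : ℕ} {μ : ℤ} {b : A} (hb : b ∈ s.fil d n μ) (k : ℕ) :
    ((adOp (s.gen e)) ^ k) b ∈ s.fil d n (μ + 2 * k) := by
  induction k with
  | zero => simpa using hb
  | succ k ih =>
    rw [pow_succ', Module.End.mul_apply]
    have := adOp_e_mem ih
    rwa [show μ + 2 * k + 2 = μ + 2 * (k + 1 : ℕ) by push_cast; ring] at this

theorem pow_adOp_f_mem {n : ℕ} {μ : ℤ} {b : A} (hb : b ∈ s.fil d n μ) (k : ℕ) :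
    ((adOp (s.gen f)) ^ k) b ∈ s.fil d n (μ - 2 * k) := by
  induction k with
  | zero => simpa using hb
  | succ k ih =>
    rw [pow_succ', Module.End.mul_apply]
    have := adOp_f_mem ih
    rwa [show μ - 2 * k + (-2) = μ - 2 * (k + 1 : ℕ) by push_cast; ring] at this

theorem exists_pow_adOp_e_eq_zero (hd : 1 ≤ d) {n : ℕ} {μ : ℤ} {b : A} (hb : b ∈ s.fil d n μ) :
    ∃ k, ((adOp (s.gen e)) ^ k) b = 0 := by
  refine ⟨n + μ.natAbs, ?_⟩
  have := pow_adOp_e_mem hb (n + μ.natAbs)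
  rw [fil_eq_bot hd] at this
  · simpa using this
  · refine le_trans ?_ (le_abs_self _)
    push_cast
    have := neg_abs_le μ
    have := abs_nonneg μ
    omega

theorem exists_pow_adOp_f_eq_zero (hd : 1 ≤ d) {n : ℕ} {μ : ℤ} {b : A} (hb : b ∈ s.fil d n μ) :
    ∃ k, ((adOp (s.gen f)) ^ k) b = 0 := by
  refine ⟨n + μ.natAbs, ?_⟩
  have := pow_adOp_f_mem hb (n + μ.natAbs)
  rw [fil_eq_bot hd] at this
  · simpa using this
  · refine le_trans ?_ (neg_le_abs _)
    push_cast
    have := le_abs_self μ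
    have := abs_nonneg μ
    omega

theorem smul_word_sub_mem (hs : s.IsFiltered d) {c : ℂ} {l l' : List Gen} {m : ℕ} {ν : ℤ}
    (h : c ≠ 0 → l.Perm l' ∧ degW d l' = m ∧ wtW l' = ν) :
    c • s.word l - c • s.word l' ∈ s.fil d m ν := by
  by_cases h0 : c = 0
  · simp [h0]
  · obtain ⟨h1, h2, h3⟩ := h h0
    rw [← smul_sub, ← h2, ← h3, ← degW_perm d h1, ← wtW_perm h1]
    exact Submodule.smul_mem _ _ (word_perm hs h1)

/-- The leading part of `ad f` on an ordered monomial. -/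
theorem adOp_f_mon (hs : s.IsFiltered d) (i b j p q : ℕ) :
    adOp (s.gen f) (s.word (mon i b j p q)) -
      ((-i : ℂ) • s.word (mon (i - 1) (b + 1) j p q) +
        (b * 2 : ℂ) • s.word (mon i (b - 1) (j + 1) p q) +
        (p : ℂ) • s.word (mon i b j (p - 1) (q + 1))) ∈
      s.fil d (degW d (mon i b j p q)) (wtW (mon i b j p q) + (-2)) := by
  have h1 := adOp_word_sub_mem hs s.lie_f (deg_tgtF d) (fun _ => wt_tgtF) (mon i b j p q)
  rw [sum_univ] at h1
  simp only [count_mon, coefF, tgtF, mul_zero, zero_smul, add_zero, mul_neg, mul_one] at h1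
  have he := smul_word_sub_mem hs (c := (-i : ℂ)) (l := h :: (mon i b j p q).erase e)
    (l' := mon (i - 1) (b + 1) j p q) (m := degW d (mon i b j p q))
    (ν := wtW (mon i b j p q) + (-2)) (by
      intro h0
      have hi : i ≠ 0 := by rintro rfl; simp at h0
      obtain ⟨i, rfl⟩ := Nat.exists_eq_succ_of_ne_zero hi
      refine ⟨?_, ?_, ?_⟩
      · rw [List.perm_iff_count]
        intro g
        cases g <;> simp [List.count_cons, count_mon, List.count_erase]
      · simp only [degW_mon, Nat.succ_sub_one]; omega
      · simp only [wtW_mon, Nat.succ_sub_one]; push_cast; ring)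
  have hh := smul_word_sub_mem hs (c := (b * 2 : ℂ)) (l := f :: (mon i b j p q).erase h)
    (l' := mon i (b - 1) (j + 1) p q) (m := degW d (mon i b j p q))
    (ν := wtW (mon i b j p q) + (-2)) (by
      intro h0
      have hi : b ≠ 0 := by rintro rfl; simp at h0
      obtain ⟨b, rfl⟩ := Nat.exists_eq_succ_of_ne_zero hi
      refine ⟨?_, ?_, ?_⟩
      · rw [List.perm_iff_count]
        intro g
        cases g <;> simp [List.count_cons, count_mon, List.count_erase]
      · simp only [degW_mon, Nat.succ_sub_one]; omega
      · simp only [wtW_mon, Nat.succ_sub_one]; push_cast; ring)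
  have hx := smul_word_sub_mem hs (c := (p : ℂ)) (l := y :: (mon i b j p q).erase x)
    (l' := mon i b j (p - 1) (q + 1)) (m := degW d (mon i b j p q))
    (ν := wtW (mon i b j p q) + (-2)) (by
      intro h0
      have hi : p ≠ 0 := by rintro rfl; simp at h0
      obtain ⟨p, rfl⟩ := Nat.exists_eq_succ_of_ne_zero hi
      refine ⟨?_, ?_, ?_⟩
      · rw [List.perm_iff_count]
        intro g
        cases g <;> simp [List.count_cons, count_mon, List.count_erase]
      · simp only [degW_mon, Nat.succ_sub_one, Nat.succ_eq_add_one]; ring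
      · simp only [wtW_mon, Nat.succ_sub_one]; push_cast; ring)
  have := Submodule.add_mem _ (Submodule.add_mem _ (Submodule.add_mem _ h1 he) hh) hx
  convert this using 1
  abel

/-- The leading part of `ad e` on a monomial without `h` and `f`. -/
theorem adOp_e_mon (hs : s.IsFiltered d) (i p q : ℕ) :
    adOp (s.gen e) (s.word (mon i 0 0 p (q + 1))) -
      ((q : ℂ) + 1) • s.word (mon i 0 0 (p + 1) q) ∈
      s.fil d (degW d (mon i 0 0 (p + 1) q)) (wtW (mon i 0 0 (p + 1) q)) := by
  have hd : degW d (mon i 0 0 p (q + 1)) = degW d (mon i 0 0 (p + 1) q) := by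
    simp only [degW_mon]; ring
  have hw : wtW (mon i 0 0 p (q + 1)) + 2 = wtW (mon i 0 0 (p + 1) q) := by
    simp only [wtW_mon]; push_cast; ring
  have h1 := adOp_word_sub_mem hs s.lie_e (deg_tgtE d) (fun _ => wt_tgtE) (mon i 0 0 p (q + 1))
  rw [sum_univ, hd, hw] at h1
  simp only [count_mon, coefE, tgtE, mul_zero, zero_smul, add_zero, mul_one, zero_mul,
    zero_add, Nat.cast_zero, Nat.cast_add, Nat.cast_one] at h1
  have hy := smul_word_sub_mem hs (c := (q : ℂ) + 1) (l := x :: (mon i 0 0 p (q + 1)).erase y)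
    (l' := mon i 0 0 (p + 1) q) (m := degW d (mon i 0 0 (p + 1) q))
    (ν := wtW (mon i 0 0 (p + 1) q)) (by
      intro _
      refine ⟨?_, rfl, rfl⟩
      rw [List.perm_iff_count]
      intro g
      cases g <;> simp [List.count_cons, count_mon, List.count_erase])
  have := Submodule.add_mem _ h1 hy
  convert this using 1
  abel

theorem cas_mul_mem {n : ℕ} {μ : ℤ} {a : A} (ha : a ∈ s.fil d n μ) :
    s.cas * a ∈ s.fil d (n + 2) μ := by
  have h1 := gen_mul_mem (gen_mul_mem ha e) f
  have h2 := gen_mul_mem (gen_mul_mem ha h) h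
  have h3 := gen_mul_mem ha h
  simp only [deg, wt, zero_add, neg_add_cancel_left] at h1 h2 h3
  rw [cas, add_mul, add_mul, add_mul, one_mul, smul_mul_assoc, smul_mul_assoc, mul_assoc, mul_assoc]
  exact Submodule.add_mem _ (Submodule.add_mem _ (Submodule.add_mem _
    (Submodule.smul_mem _ _ (fil_mono (by omega) _ h1)) (fil_mono (by omega) _ h2))
    (Submodule.smul_mem _ _ (fil_mono (by omega) _ h3))) (fil_mono (by omega) _ ha)

theorem cas_pow_mul_mem {n : ℕ} {μ : ℤ} {a : A} (ha : a ∈ s.fil d n μ) (c : ℕ) :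
    s.cas ^ c * a ∈ s.fil d (n + 2 * c) μ := by
  induction c with
  | zero => simpa using ha
  | succ c ih =>
    rw [pow_succ', mul_assoc]
    exact cas_mul_mem ih

variable (s d) in
/-- The span of the elements `Δᶜ eᵏ xᵖ y^q` of degree less than `n` and weight `μ`, where `Δ` is
the Casimir element, together with the image of `ad f`. -/
def reducedSpan (n : ℕ) (μ : ℤ) : Submodule ℂ A :=
  Submodule.span ℂ {a | ∃ c k p q : ℕ, 2 * c + degW d (mon k 0 0 p q) < n ∧
    wtW (mon k 0 0 p q) = μ ∧ s.cas ^ c * s.word (mon k 0 0 p q) = a} ⊔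
  (s.fil d n (μ + 2)).map (adOp (s.gen f))

theorem reducedSpan_mono {m n : ℕ} (hmn : m ≤ n) (μ : ℤ) :
    reducedSpan s d m μ ≤ reducedSpan s d n μ := by
  refine sup_le_sup (Submodule.span_mono ?_) (Submodule.map_mono (fil_mono hmn _))
  rintro a ⟨c, k, p, q, h1, h2⟩
  exact ⟨c, k, p, q, h1.trans_le hmn, h2⟩

theorem cas_mul_mem_reducedSpan {n : ℕ} {μ : ℤ} {a : A} (ha : a ∈ reducedSpan s d n μ) :
    s.cas * a ∈ reducedSpan s d (n + 2) μ := by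
  have : reducedSpan s d n μ ≤ (reducedSpan s d (n + 2) μ).comap (LinearMap.mulLeft ℂ s.cas) := by
    refine sup_le (Submodule.span_le.2 ?_) ?_
    · rintro _ ⟨c, k, p, q, h1, h2, rfl⟩
      refine Submodule.mem_sup_left (Submodule.subset_span ⟨c + 1, k, p, q, by omega, h2, ?_⟩)
      rw [LinearMap.mulLeft_apply, pow_succ', mul_assoc]
    · rintro _ ⟨b, hb, rfl⟩
      refine Submodule.mem_sup_right ⟨s.cas * b, cas_mul_mem hb, ?_⟩
      rw [LinearMap.mulLeft_apply, adOp_mul_of_commute commute_f_cas]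
  exact this ha

/-- Modulo the image of `ad f`, every element is a combination of the `Δᶜ eᵏ xᵖ y^q`: the image of
`ad f` allows to replace `h` and `f` by operations on `xᵖ y^q`, and `h²` is
`Δ - 4 e f` up to terms of smaller degree. -/
theorem fil_le_reducedSpan (hs : s.IsFiltered d) (n : ℕ) :
    ∀ μ : ℤ, s.fil d n μ ≤ reducedSpan s d n μ := by
  induction n using Nat.strong_induction_on with
  | _ n ih =>
  rcases n with _ | m
  · exact fun μ => fil_le_iff.2 fun l h => absurd h (Nat.not_lt_zero _)
  have hlow : ∀ μ, s.fil d m μ ≤ reducedSpan s d (m + 1) μ :=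
    fun μ => (ih m (Nat.lt_succ_self m) μ).trans (reducedSpan_mono (Nat.le_succ m) μ)
  have hcas : ∀ l, degW d l + 2 = m → s.cas * s.word l ∈ reducedSpan s d (m + 1) (wtW l) := by
    intro l hl
    have := cas_mul_mem_reducedSpan (ih (degW d l + 1) (by omega) (wtW l)
      (word_mem (Nat.lt_succ_self _) rfl))
    exact reducedSpan_mono (by omega) _ this
  -- replacing `h²` by `-4 e f`
  have hhh : ∀ i b j p q, degW d (mon i (b + 2) j p q) = m →
      s.word (mon i (b + 2) j p q) + (4 : ℂ) • s.word (mon (i + 1) b (j + 1) p q) ∈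
        reducedSpan s d (m + 1) (wtW (mon i (b + 2) j p q)) := by
    intro i b j p q hm
    have hdeg : degW d (mon i b j p q) + 2 = m := by
      rw [← hm, degW_mon, degW_mon]; omega
    have hwt : wtW (mon i b j p q) = wtW (mon i (b + 2) j p q) := by rw [wtW_mon, wtW_mon]
    have p1 : (mon i (b + 2) j p q).Perm (h :: h :: mon i b j p q) := by
      rw [List.perm_iff_count]
      intro g
      cases g <;> simp [count_mon]
    have p2 : (mon (i + 1) b (j + 1) p q).Perm (f :: e :: mon i b j p q) := by
      rw [List.perm_iff_count]
      intro g
      cases g <;> simp [count_mon]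
    have m1 := word_perm hs p1
    have m2 := word_perm hs p2
    rw [degW_perm d p2, wtW_perm p2] at m2
    simp only [degW_cons, wtW_cons, hwt] at m2
    simp only [deg, wt, neg_add_cancel_left] at m2
    rw [hm] at m1
    rw [show 1 + (1 + degW d (mon i b j p q)) = m by omega] at m2
    have m3 : s.word (h :: mon i b j p q) ∈ s.fil d m (wtW (mon i (b + 2) j p q)) :=
      word_mem (by simp [deg]; omega) (by simp [wt, hwt])
    have m4 : s.word (mon i b j p q) ∈ s.fil d m (wtW (mon i (b + 2) j p q)) :=
      word_mem (by omega) hwt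
    have m5 := Submodule.add_mem _ (hlow _ (Submodule.sub_mem _ (Submodule.sub_mem _
      (Submodule.add_mem _ m1 (Submodule.smul_mem _ (4 : ℂ) m2)) (Submodule.smul_mem _ (2 : ℂ) m3))
      m4)) (hwt ▸ hcas _ hdeg)
    convert m5 using 1
    simp only [word_cons, cas, add_mul, one_mul, smul_mul_assoc, mul_assoc, smul_sub]
    abel
  have hadF : ∀ l μ, degW d l = m → wtW l = μ + 2 →
      adOp (s.gen f) (s.word l) ∈ reducedSpan s d (m + 1) μ := fun l μ hl hμ =>
    Submodule.mem_sup_right ⟨_, word_mem (by omega) hμ, rfl⟩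
  -- monomials with at most one `h`, by induction on `2 j + b`: a letter `f` is removed through
  -- `ad f` of `eⁱ h fʲ xᵖ y^q`, the letter `h` through `ad f` of `eⁱ⁺¹ fʲ xᵖ y^q`
  have hA : ∀ r i b j p q, b ≤ 1 → 2 * j + b = r → degW d (mon i b j p q) = m →
      s.word (mon i b j p q) ∈ reducedSpan s d (m + 1) (wtW (mon i b j p q)) := by
    intro r
    induction r using Nat.strong_induction_on with
    | _ r ihr =>
    intro i b j p q hb hr hm
    have hb' : b = 0 ∨ b = 1 := by omega
    rcases hb' with rfl | rfl
    · rcases j with _ | j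
      · exact Submodule.mem_sup_left (Submodule.subset_span
          ⟨0, i, p, q, by omega, rfl, by rw [pow_zero, one_mul]⟩)
      · have hm1 : degW d (mon i 1 j p q) = m := by
          rw [← hm, degW_mon, degW_mon]; omega
        have hw1 : wtW (mon i 1 j p q) = wtW (mon i 0 (j + 1) p q) + 2 := by
          rw [wtW_mon, wtW_mon]; push_cast; ring
        have h1 := adOp_f_mon hs i 1 j p q
        rw [hm1, hw1, show wtW (mon i 0 (j + 1) p q) + 2 + (-2) = wtW (mon i 0 (j + 1) p q) by ring]
          at h1
        have h2 := Submodule.sub_mem _ (hadF _ _ hm1 hw1) (hlow _ h1)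
        have h3 : (p : ℂ) • s.word (mon i 1 j (p - 1) (q + 1)) ∈
            reducedSpan s d (m + 1) (wtW (mon i 0 (j + 1) p q)) := by
          rcases p with _ | p
          · simp
          · refine Submodule.smul_mem _ _ ?_
            rw [Nat.add_sub_cancel]
            have := ihr (2 * j + 1) (by omega) i 1 j p (q + 1) le_rfl rfl (by
              rw [← hm, degW_mon, degW_mon]; ring)
            convert this using 2
            rw [wtW_mon, wtW_mon]; push_cast; ring
        have h4 : (i : ℂ) • (s.word (mon (i - 1) 2 j p q) +
            (4 : ℂ) • s.word (mon i 0 (j + 1) p q)) ∈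
            reducedSpan s d (m + 1) (wtW (mon i 0 (j + 1) p q)) := by
          rcases i with _ | i
          · simp
          · refine Submodule.smul_mem _ _ ?_
            rw [Nat.add_sub_cancel]
            have := hhh i 0 j p q (by rw [← hm, degW_mon, degW_mon]; omega)
            convert this using 2
            rw [wtW_mon, wtW_mon]; push_cast; ring
        have h5 := Submodule.add_mem _ (Submodule.sub_mem _ h2 h3) h4
        have h6 : ((4 : ℂ) * i + 2) • s.word (mon i 0 (j + 1) p q) ∈
            reducedSpan s d (m + 1) (wtW (mon i 0 (j + 1) p q)) := by
          convert h5 using 1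
          simp only [Nat.cast_one]
          module
        refine (Submodule.smul_mem_iff _ ?_).1 h6
        have : (4 * i + 2 : ℕ) ≠ 0 := by omega
        exact_mod_cast this
    · have hm1 : degW d (mon (i + 1) 0 j p q) = m := by
        rw [← hm, degW_mon, degW_mon]
      have hw1 : wtW (mon (i + 1) 0 j p q) = wtW (mon i 1 j p q) + 2 := by
        rw [wtW_mon, wtW_mon]; push_cast; ring
      have h1 := adOp_f_mon hs (i + 1) 0 j p q
      rw [hm1, hw1, show wtW (mon i 1 j p q) + 2 + (-2) = wtW (mon i 1 j p q) by ring] at h1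
      have h2 := Submodule.sub_mem _ (hadF _ _ hm1 hw1) (hlow _ h1)
      have h3 : (p : ℂ) • s.word (mon (i + 1) 0 j (p - 1) (q + 1)) ∈
          reducedSpan s d (m + 1) (wtW (mon i 1 j p q)) := by
        rcases p with _ | p
        · simp
        · refine Submodule.smul_mem _ _ ?_
          rw [Nat.add_sub_cancel]
          have := ihr (2 * j) (by omega) (i + 1) 0 j p (q + 1) (by omega) rfl (by
            rw [← hm, degW_mon, degW_mon]; ring)
          convert this using 2
          rw [wtW_mon, wtW_mon]; push_cast; ring
      have h4 := Submodule.sub_mem _ h3 h2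
      have h5 : ((i : ℂ) + 1) • s.word (mon i 1 j p q) ∈
          reducedSpan s d (m + 1) (wtW (mon i 1 j p q)) := by
        convert h4 using 1
        simp only [Nat.cast_zero, zero_mul, zero_smul, Nat.cast_add, Nat.cast_one,
          Nat.add_sub_cancel]
        module
      refine (Submodule.smul_mem_iff _ ?_).1 h5
      exact_mod_cast Nat.succ_ne_zero i
  -- the letters `h` are removed in pairs
  have hB : ∀ b i j p q, degW d (mon i b j p q) = m →
      s.word (mon i b j p q) ∈ reducedSpan s d (m + 1) (wtW (mon i b j p q)) := by
    intro b
    induction b using Nat.strong_induction_on with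
    | _ b ihb =>
    intro i j p q hm
    rcases Nat.lt_or_ge b 2 with hb | hb
    · exact hA _ i b j p q (by omega) rfl hm
    · obtain ⟨b, rfl⟩ := Nat.exists_eq_add_of_le' hb
      have h1 := ihb b (by omega) (i + 1) (j + 1) p q (by
        rw [← hm, degW_mon, degW_mon]; omega)
      rw [show wtW (mon (i + 1) b (j + 1) p q) = wtW (mon i (b + 2) j p q) by
        rw [wtW_mon, wtW_mon]; push_cast; ring] at h1
      have := Submodule.sub_mem _ (hhh i b j p q hm) (Submodule.smul_mem _ (4 : ℂ) h1)
      simpa using this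
  intro μ
  refine fil_le_iff.2 fun l h1 h2 => ?_
  subst h2
  rcases Nat.lt_or_ge (degW d l) m with hl | hl
  · exact hlow _ (word_mem hl rfl)
  · have hl' : degW d l = m := by omega
    have hp := perm_mon l
    have h3 := hlow _ (hl' ▸ word_perm hs hp)
    have h4 := hB _ _ _ _ _ ((degW_perm d hp).symm.trans hl')
    rw [← wtW_perm hp] at h4
    simpa using Submodule.add_mem _ h3 h4

end Sl2Plane
end

noncomputable section

/-! ### First cohomology of `𝔰𝔩₂` -/

namespace Sl2Ops

open Polynomial

variable {M : Type*} [AddCommGroup M] [Module ℂ M] {E F H : Module.End ℂ M}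

/-- Every vector is a finite sum of vectors of integral weight. -/
def HasWeights (H : Module.End ℂ M) : Prop :=
  ∀ v : M, ∃ (S : Finset ℤ) (u : ℤ → M), (∀ μ, H (u μ) = (μ : ℂ) • u μ) ∧ v = ∑ μ ∈ S, u μ

/-- Generalized eigenvectors of a diagonalizable operator are eigenvectors. -/
theorem HasWeights.weight_of_sq (hH : HasWeights H) {μ : ℤ} {v w : M}
    (h1 : H v = (μ : ℂ) • v + w) (h2 : H w = (μ : ℂ) • w) : w = 0 := by
  obtain ⟨S, u, hu, hv⟩ := hH v
  set q : ℂ[X] := ∏ ν ∈ S.erase μ, (X - C (ν : ℂ)) with hq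
  have hq0 : q.eval (μ : ℂ) ≠ 0 := by
    rw [hq, eval_prod, Finset.prod_ne_zero_iff]
    intro ν hν
    rw [eval_sub, eval_X, eval_C, sub_ne_zero]
    exact fun h => (Finset.mem_erase.1 hν).1 (by exact_mod_cast h.symm)
  have h3 : aeval H (q * (X - C (μ : ℂ))) v = 0 := by
    rw [hv, map_sum]
    refine Finset.sum_eq_zero fun ν hν => ?_
    rw [aeval_of_weight (hu ν), eval_mul]
    by_cases hνμ : ν = μ
    · simp [hνμ]
    · rw [hq, eval_prod, Finset.prod_eq_zero (Finset.mem_erase.2 ⟨hνμ, hν⟩)] <;> simp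
  have h4 : aeval H (X - C (μ : ℂ)) v = w := by
    rw [map_sub, aeval_X, aeval_C, LinearMap.sub_apply, Algebra.algebraMap_eq_smul_one,
      LinearMap.smul_apply, Module.End.one_apply, h1, add_sub_cancel_left]
  rw [map_mul, Module.End.mul_apply, h4] at h3
  exact eq_zero_of_eigenvector h2 h3 hq0

/-- A 1-cocycle of `𝔰𝔩₂`, given by its values `a`, `b`, `c` on `e`, `f`, `h`, with values in a
locally finite representation is a coboundary. -/
theorem exists_coboundary (s : Sl2Ops E F H) (hH : HasWeights H) (hE : ∀ v, ∃ k, (E ^ k) v = 0)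
    (hF : ∀ v, ∃ k, (F ^ k) v = 0) {a b c : M} (h1 : H a - E c = (2 : ℂ) • a)
    (h2 : H b - F c = (-2 : ℂ) • b) (h3 : E b - F a = c) :
    ∃ m, E m = a ∧ F m = b ∧ H m = c := by
  -- subtracting a coboundary makes `c` of weight zero
  obtain ⟨m₀, hm₀⟩ : ∃ m₀, H (c - H m₀) = 0 := by
    obtain ⟨S, u, hu, hc⟩ := hH c
    refine ⟨∑ μ ∈ S, (μ : ℂ)⁻¹ • u μ, ?_⟩
    rw [hc, map_sum, ← Finset.sum_sub_distrib, map_sum]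
    refine Finset.sum_eq_zero fun μ _ => ?_
    rw [map_smul, map_sub, map_smul, hu, map_smul, hu]
    by_cases h0 : (μ : ℂ) = 0
    · simp [h0]
    · rw [smul_smul, inv_mul_cancel₀ h0, one_smul, sub_self]
  set a' := a - E m₀ with ha'
  set b' := b - F m₀ with hb'
  set c' := c - H m₀ with hc'
  have h1' : H a' = (2 : ℂ) • a' + E c' := by
    rw [ha', hc', map_sub, map_sub, s.h_e_apply, smul_sub, ← h1]
    abel
  have h2' : H b' = (-2 : ℂ) • b' + F c' := by
    rw [hb', hc', map_sub, map_sub, s.h_f_apply, smul_sub, ← h2]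
    module
  have h3' : E b' = F a' + c' := by
    rw [ha', hb', hc', map_sub, map_sub, s.e_f_apply, ← h3]
    abel
  have hec : E c' = 0 := hH.weight_of_sq (μ := 2) (by exact_mod_cast h1') (by
    rw [s.h_e_apply, hm₀, map_zero, zero_add]; norm_num)
  have hfc : F c' = 0 := hH.weight_of_sq (μ := -2) (by exact_mod_cast h2') (by
    rw [s.h_f_apply, hm₀, map_zero, zero_sub, ← neg_smul]; norm_num)
  rw [hec, add_zero] at h1'
  rw [hfc, add_zero] at h2'
  obtain ⟨m, hm0, hma⟩ := s.exists_e_eq h1' (hE a')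
  have h4 : E (b' - F m) = c' := by
    rw [map_sub, s.e_f_apply, hma, hm0, h3']
    abel
  have h5 : b' - F m = 0 := by
    refine s.eq_zero_of_e_e ?_ (hF _) (by rw [h4, hec])
    rw [map_sub, s.h_f_apply, hm0, h2', map_zero, smul_sub]
    module
  have h6 : c' = 0 := by rw [← h4, h5, map_zero]
  refine ⟨m₀ + m, ?_, ?_, ?_⟩
  · rw [map_add, hma, ha']; abel
  · rw [map_add, ← sub_eq_zero.1 h5, hb']; abel
  · rw [map_add, hm0, add_zero]; exact (sub_eq_zero.1 h6).symm

end Sl2Ops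

open Gen Polynomial

namespace Sl2Plane

variable {A : Type*} [Ring A] [Algebra ℂ A] {s : Sl2Plane A}

/-- Every element is a finite sum of elements of bounded degree and of integral weights. -/
theorem exists_weight_decomposition (d : ℕ) (a : A) : ∃ (n : ℕ) (S : Finset ℤ) (u : ℤ → A),
    (∀ μ, u μ ∈ s.fil d n μ) ∧ (∀ μ, μ ∉ S → u μ = 0) ∧ a = ∑ μ ∈ S, u μ := by
  have ha : a ∈ Subalgebra.toSubmodule (Algebra.adjoin ℂ (Set.range s.gen)) := by
    rw [s.adjoin_eq_top]; trivial
  rw [Algebra.adjoin_eq_span] at ha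
  induction ha using Submodule.span_induction with
  | mem a ha =>
    obtain ⟨l, hl, rfl⟩ := Submonoid.exists_list_of_mem_closure ha
    obtain ⟨l, rfl⟩ : ∃ l' : List Gen, l'.map s.gen = l := by
      rw [← Set.mem_range, Set.range_list_map]
      exact hl
    refine ⟨degW d l + 1, {wtW l}, Pi.single (wtW l) (s.word l), fun μ => ?_, fun μ hμ => ?_, ?_⟩
    · by_cases h : μ = wtW l
      · subst h
        rw [Pi.single_eq_same]
        exact word_mem (Nat.lt_succ_self _) rfl
      · rw [Pi.single_eq_of_ne h]
        exact Submodule.zero_mem _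
    · rw [Pi.single_eq_of_ne (by simpa using hμ)]
    · rw [Finset.sum_singleton, Pi.single_eq_same]
      rfl
  | zero => exact ⟨0, ∅, 0, fun μ => Submodule.zero_mem _, fun _ _ => rfl, by simp⟩
  | add a b _ _ iha ihb =>
    obtain ⟨n, S, u, h1, h2, h3⟩ := iha
    obtain ⟨n', S', u', h1', h2', h3'⟩ := ihb
    refine ⟨max n n', S ∪ S', u + u', fun μ => Submodule.add_mem _
      (fil_mono (le_max_left _ _) _ (h1 μ)) (fil_mono (le_max_right _ _) _ (h1' μ)),
      fun μ hμ => ?_, ?_⟩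
    · rw [Finset.mem_union, not_or] at hμ
      rw [Pi.add_apply, h2 _ hμ.1, h2' _ hμ.2, add_zero]
    · simp only [Pi.add_apply]
      rw [Finset.sum_add_distrib, h3, h3']
      congr 1
      · exact Finset.sum_subset Finset.subset_union_left fun μ _ hμ => h2 μ hμ
      · exact Finset.sum_subset Finset.subset_union_right fun μ _ hμ => h2' μ hμ
  | smul c a _ iha =>
    obtain ⟨n, S, u, h1, h2, h3⟩ := iha
    refine ⟨n, S, c • u, fun μ => Submodule.smul_mem _ _ (h1 μ), fun μ hμ => ?_, ?_⟩
    · rw [Pi.smul_apply, h2 _ hμ, smul_zero]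
    · rw [h3, Finset.smul_sum]
      rfl

variable (s) in
theorem hasWeights : Sl2Ops.HasWeights (adOp (s.gen h)) := fun a => by
  obtain ⟨n, S, u, h1, -, h3⟩ := exists_weight_decomposition (s := s) 1 a
  exact ⟨S, u, fun μ => adOp_h_of_mem (h1 μ), h3⟩

theorem exists_pow_apply_sum_eq_zero {M ι : Type*} [AddCommGroup M] [Module ℂ M]
    (E : Module.End ℂ M) (S : Finset ι) (u : ι → M) (hu : ∀ i, ∃ k, (E ^ k) (u i) = 0) :
    ∃ k, (E ^ k) (∑ i ∈ S, u i) = 0 := by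
  choose k hk using hu
  refine ⟨S.sup k, ?_⟩
  rw [map_sum]
  refine Finset.sum_eq_zero fun i hi => ?_
  obtain ⟨j, hj⟩ := Nat.exists_eq_add_of_le' (Finset.le_sup (f := k) hi)
  rw [hj, pow_add, Module.End.mul_apply, hk, map_zero]

variable (s) in
theorem adOp_e_locally_nilpotent (a : A) : ∃ k, ((adOp (s.gen e)) ^ k) a = 0 := by
  obtain ⟨n, S, u, h1, -, h3⟩ := exists_weight_decomposition (s := s) 1 a
  rw [h3]
  exact exists_pow_apply_sum_eq_zero _ _ _ fun μ => exists_pow_adOp_e_eq_zero le_rfl (h1 μ)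

variable (s) in
theorem adOp_f_locally_nilpotent (a : A) : ∃ k, ((adOp (s.gen f)) ^ k) a = 0 := by
  obtain ⟨n, S, u, h1, -, h3⟩ := exists_weight_decomposition (s := s) 1 a
  rw [h3]
  exact exists_pow_apply_sum_eq_zero _ _ _ fun μ => exists_pow_adOp_f_eq_zero le_rfl (h1 μ)

variable (s) in
/-- Every derivation agrees with an inner one on `𝔰𝔩₂`. -/
theorem exists_inner_on_sl2 (D : A →ₗ[ℂ] A) (hD : IsDerivationMap D) :
    ∃ m, D (s.gen e) = adOp m (s.gen e) ∧ D (s.gen f) = adOp m (s.gen f) ∧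
      D (s.gen h) = adOp m (s.gen h) := by
  have key : ∀ a b, D (a * b - b * a) = adOp a (D b) - adOp b (D a) := by
    intro a b
    rw [map_sub, hD, hD, adOp_apply, adOp_apply]
    abel
  have h1 := key (s.gen h) (s.gen e)
  have h2 := key (s.gen h) (s.gen f)
  have h3 := key (s.gen e) (s.gen f)
  rw [s.e_h, map_smul] at h1
  rw [s.f_h, map_smul] at h2
  rw [s.e_f] at h3
  obtain ⟨m, he, hf, hh⟩ := s.sl2Ops_adOp.exists_coboundary s.hasWeights
    s.adOp_e_locally_nilpotent s.adOp_f_locally_nilpotent h1.symm h2.symm h3.symm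
  have hn : ∀ a, adOp (-m) a = adOp a m := fun a => by
    rw [adOp_apply, adOp_apply]; noncomm_ring
  exact ⟨-m, by rw [hn, he], by rw [hn, hf], by rw [hn, hh]⟩

/-- An eigenvector of `ad h` is a combination of words of the corresponding weight. -/
theorem exists_mem_fil (d : ℕ) {a : A} {μ : ℤ} (ha : adOp (s.gen h) a = (μ : ℂ) • a) :
    ∃ n, a ∈ s.fil d n μ := by
  obtain ⟨n, S, u, h1, h2, h3⟩ := exists_weight_decomposition (s := s) d a
  refine ⟨n, ?_⟩
  set q : ℂ[X] := ∏ ν ∈ S.erase μ, (X - C (ν : ℂ)) with hq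
  have hq0 : q.eval (μ : ℂ) ≠ 0 := by
    rw [hq, eval_prod, Finset.prod_ne_zero_iff]
    intro ν hν
    rw [eval_sub, eval_X, eval_C, sub_ne_zero]
    exact fun h => (Finset.mem_erase.1 hν).1 (by exact_mod_cast h.symm)
  have h4 : aeval (adOp (s.gen h)) q a = q.eval (μ : ℂ) • u μ := by
    rw [h3, map_sum, Finset.sum_eq_single μ]
    · rw [Sl2Ops.aeval_of_weight (adOp_h_of_mem (h1 μ))]
    · intro ν hν hνμ
      rw [Sl2Ops.aeval_of_weight (adOp_h_of_mem (h1 ν)), hq, eval_prod,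
        Finset.prod_eq_zero (Finset.mem_erase.2 ⟨hνμ, hν⟩) (by simp), zero_smul]
    · intro hμ
      rw [h2 μ hμ, map_zero]
  rw [Sl2Ops.aeval_of_weight ha] at h4
  rw [smul_right_injective A hq0 h4]
  exact h1 μ

/-! ### Highest weight vectors of the adjoint action -/

variable {d : ℕ}

/-- Up to terms of smaller degree, `(ad e)ʳ` turns `r` letters `y` into letters `x`. -/
theorem pow_adOp_e_mon (hs : s.IsFiltered d) (k : ℕ) : ∀ r p q : ℕ, ∃ c : ℂ, c ≠ 0 ∧
    ((adOp (s.gen e)) ^ r) (s.word (mon k 0 0 p (q + r))) - c • s.word (mon k 0 0 (p + r) q) ∈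
      s.fil d (degW d (mon k 0 0 (p + r) q)) (wtW (mon k 0 0 (p + r) q)) := by
  intro r
  induction r with
  | zero => exact fun p q => ⟨1, one_ne_zero, by simp⟩
  | succ r ih =>
    intro p q
    obtain ⟨c, hc, h1⟩ := ih (p + 1) q
    rw [show p + 1 + r = p + (r + 1) by ring] at h1
    refine ⟨((q + r : ℕ) + 1) * c, mul_ne_zero (by exact_mod_cast Nat.succ_ne_zero (q + r)) hc, ?_⟩
    have h2 := pow_adOp_e_mem (adOp_e_mon hs k p (q + r)) r
    rw [map_sub, map_smul, ← Module.End.mul_apply, ← pow_succ] at h2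
    have hd : degW d (mon k 0 0 (p + 1) (q + r)) = degW d (mon k 0 0 (p + (r + 1)) q) := by
      rw [degW_mon, degW_mon]; ring
    have hw : wtW (mon k 0 0 (p + 1) (q + r)) + 2 * r = wtW (mon k 0 0 (p + (r + 1)) q) := by
      rw [wtW_mon, wtW_mon]; push_cast; ring
    rw [hd, hw] at h2
    have h3 := Submodule.add_mem _ h2 (Submodule.smul_mem _ ((q + r : ℕ) + 1 : ℂ) h1)
    convert h3 using 1
    rw [smul_sub, smul_smul, add_assoc q]
    abel

variable (s d) in
/-- The span of the images of `ad f` and of `(ad e) ^ (ν + 1)` in weight `ν`; it contains no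
highest weight vectors. -/
def loweredSpan (ν n : ℕ) : Submodule ℂ A :=
  (s.fil d n (ν + 2)).map (adOp (s.gen f)) ⊔
    (s.fil d n (-(ν + 2))).map ((adOp (s.gen e)) ^ (ν + 1))

theorem loweredSpan_mono (ν : ℕ) {m n : ℕ} (hmn : m ≤ n) :
    loweredSpan s d ν m ≤ loweredSpan s d ν n :=
  sup_le_sup (Submodule.map_mono (fil_mono hmn _)) (Submodule.map_mono (fil_mono hmn _))

variable (s d) in
/-- The elements `Δᶜ eᵏ xᵖ y^q` of weight `ν` and of degree less than `n` with `p ≤ ν`. -/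
def reducedMonomials (ν n : ℕ) : Set A :=
  {a | ∃ c k p q : ℕ, p ≤ ν ∧ 2 * c + degW d (mon k 0 0 p q) < n ∧ wtW (mon k 0 0 p q) = ν ∧
    s.cas ^ c * s.word (mon k 0 0 p q) = a}

theorem reducedMonomials_mono (ν : ℕ) {m n : ℕ} (hmn : m ≤ n) :
    reducedMonomials s d ν m ⊆ reducedMonomials s d ν n := by
  rintro a ⟨c, k, p, q, h1, h2, h3⟩
  exact ⟨c, k, p, q, h1, h2.trans_le hmn, h3⟩

theorem pow_adOp_mul_of_commute {a b : A} (h : Commute a b) (r : ℕ) (c : A) :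
    ((adOp a) ^ r) (b * c) = b * ((adOp a) ^ r) c := by
  induction r with
  | zero => simp
  | succ r ih =>
    rw [pow_succ', Module.End.mul_apply, ih, adOp_mul_of_commute h, Module.End.mul_apply]

/-- Modulo `loweredSpan`, the vectors of weight `ν` are combinations of the `Δᶜ eᵏ xᵖ y^q` with
`p ≤ ν`: for `p > ν`, such a monomial is the leading part of a multiple of
`(ad e) ^ (ν + 1)` of the monomial with `ν + 1` letters `x` replaced by `y`. -/
theorem fil_le_sup_loweredSpan (hs : s.IsFiltered d) (ν : ℕ) (n : ℕ) :
    s.fil d n ν ≤ Submodule.span ℂ (reducedMonomials s d ν n) ⊔ loweredSpan s d ν n := by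
  induction n using Nat.strong_induction_on with
  | _ n ih =>
  refine (fil_le_reducedSpan hs n ν).trans (sup_le (Submodule.span_le.2 ?_)
    (le_sup_left.trans le_sup_right))
  rintro _ ⟨c, k, p, q, h1, h2, rfl⟩
  by_cases hp : p ≤ ν
  · exact Submodule.mem_sup_left (Submodule.subset_span ⟨c, k, p, q, hp, h1, h2, rfl⟩)
  obtain ⟨p, rfl⟩ : ∃ p', p = p' + (ν + 1) := ⟨p - (ν + 1), by omega⟩
  obtain ⟨C, hC, h3⟩ := pow_adOp_e_mon hs k (ν + 1) p q
  have hd : degW d (mon k 0 0 p (q + (ν + 1))) = degW d (mon k 0 0 (p + (ν + 1)) q) := by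
    rw [degW_mon, degW_mon]; ring
  have hw : wtW (mon k 0 0 p (q + (ν + 1))) = -(ν + 2) := by
    rw [wtW_mon] at h2 ⊢
    push_cast at h2 ⊢
    linarith
  have h4 : s.cas ^ c * s.word (mon k 0 0 p (q + (ν + 1))) ∈ s.fil d n (-(ν + 2)) :=
    fil_mono (by omega) _ (cas_pow_mul_mem (word_mem (Nat.lt_succ_self _) hw) c)
  have h5 := cas_pow_mul_mem h3 c
  rw [h2] at h5
  have hlt : degW d (mon k 0 0 (p + (ν + 1)) q) + 2 * c < n := by omega
  have h6 := (ih _ hlt).trans (sup_le_sup (Submodule.span_mono (reducedMonomials_mono ν hlt.le))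
    (loweredSpan_mono ν hlt.le)) h5
  have h7 : ((adOp (s.gen e)) ^ (ν + 1)) (s.cas ^ c * s.word (mon k 0 0 p (q + (ν + 1)))) ∈
      loweredSpan s d ν n := Submodule.mem_sup_right ⟨_, h4, rfl⟩
  rw [pow_adOp_mul_of_commute (commute_e_cas.pow_right c)] at h7
  have h8 := Submodule.sub_mem _ (Submodule.mem_sup_right h7) h6
  rw [mul_sub, sub_sub_cancel, mul_smul_comm] at h8
  exact (Submodule.smul_mem_iff _ hC).1 h8

theorem eq_zero_of_mem_loweredSpan (hd : 1 ≤ d) {ν n : ℕ} {w : A} (hw : w ∈ s.fil d n ν)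
    (hew : adOp (s.gen e) w = 0) (h : w ∈ loweredSpan s d ν n) : w = 0 := by
  obtain ⟨_, ⟨a, ha, rfl⟩, _, ⟨b, hb, rfl⟩, h⟩ := Submodule.mem_sup.1 h
  refine s.sl2Ops_adOp.highest_eq_zero ν (by simpa using adOp_h_of_mem hw) hew
    (by simpa using adOp_h_of_mem ha) ?_ (exists_pow_adOp_e_eq_zero hd ha)
    (exists_pow_adOp_f_eq_zero hd hb) h.symm
  have := adOp_h_of_mem hb
  push_cast at this
  exact this

end Sl2Plane

/-- A dimension count: if `W` is spanned modulo a complement-like subspace `L` by as many vectors as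
there are elements `v i` of `W` with linearly independent images under `ρ`, then the `v i` span
`W`, and `ρ` is injective on `W`. -/
theorem Submodule.le_span_of_linearIndependent {M N ι : Type*} [AddCommGroup M] [Module ℂ M]
    [AddCommGroup N] [Module ℂ N] {W L : Submodule ℂ M} (hWL : Disjoint W L) (I : Finset ι)
    (b v : ι → M) (hb : W ≤ Submodule.span ℂ (b '' I) ⊔ L) (hv : ∀ i ∈ I, v i ∈ W)
    (ρ : M →ₗ[ℂ] N) (hρ : LinearIndependent ℂ fun i : I => ρ (v i)) :
    W ≤ Submodule.span ℂ (v '' I) ∧ ∀ w ∈ W, ρ w = 0 → w = 0 := by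
  classical
  let T : Submodule ℂ (M ⧸ L) := Submodule.span ℂ (L.mkQ '' (b '' I))
  have hT : ∀ w : W, L.mkQ w ∈ T := by
    intro w
    have h1 : (w : M) ∈ Submodule.span ℂ (b '' I) ⊔ L := hb w.2
    obtain ⟨p, hp, q, hq, hpq⟩ := Submodule.mem_sup.1 h1
    rw [← hpq, map_add, Submodule.mkQ_apply L q, (Submodule.Quotient.mk_eq_zero L).2 hq, add_zero]
    show _ ∈ Submodule.span ℂ _
    rw [Submodule.span_image]
    exact Submodule.mem_map_of_mem hp
  let g : W →ₗ[ℂ] T := (L.mkQ ∘ₗ W.subtype).codRestrict T hT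
  have hg : Function.Injective g := by
    rw [← LinearMap.ker_eq_bot, LinearMap.ker_eq_bot']
    intro w hw
    have h1 : L.mkQ (w : M) = 0 := congrArg Subtype.val hw
    rw [Submodule.mkQ_apply, Submodule.Quotient.mk_eq_zero] at h1
    exact Subtype.ext (Submodule.disjoint_def.1 hWL _ w.2 h1)
  have hfin : (L.mkQ '' (b '' (I : Set ι))).Finite := (I.finite_toSet.image b).image _
  have : FiniteDimensional ℂ T := FiniteDimensional.span_of_finite ℂ hfin
  have hfdW : FiniteDimensional ℂ W := FiniteDimensional.of_injective g hg
  have hcard : Module.finrank ℂ W ≤ I.card := by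
    refine (LinearMap.finrank_le_finrank_of_injective hg).trans ?_
    have h1 : L.mkQ '' (b '' (I : Set ι)) = ((I.image b).image L.mkQ : Finset (M ⧸ L)) := by
      simp
    show Module.finrank ℂ (Submodule.span ℂ _) ≤ _
    rw [h1]
    exact (finrank_span_finset_le_card _).trans (Finset.card_image_le.trans Finset.card_image_le)
  let v' : I → W := fun i => ⟨v i, hv i i.2⟩
  have hv' : LinearIndependent ℂ v' := LinearIndependent.of_comp (ρ ∘ₗ W.subtype) hρ
  have hspan : Submodule.span ℂ (Set.range v') = ⊤ := by
    refine hv'.span_eq_top_of_card_eq_finrank' (le_antisymm ?_ ?_)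
    · exact hv'.fintype_card_le_finrank
    · simpa using hcard
  have hW : ∀ w : W, ∃ c : I → ℂ, w = ∑ i, c i • v' i := by
    intro w
    have : w ∈ Submodule.span ℂ (Set.range v') := hspan ▸ Submodule.mem_top
    obtain ⟨c, hc⟩ := (Submodule.mem_span_range_iff_exists_fun ℂ).1 this
    exact ⟨c, hc.symm⟩
  constructor
  · intro w hw
    obtain ⟨c, hc⟩ := hW ⟨w, hw⟩
    have h1 : w = ∑ i, c i • v i := by simpa [v'] using congrArg Subtype.val hc
    rw [h1]
    exact Submodule.sum_mem _ fun i _ => Submodule.smul_mem _ _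
      (Submodule.subset_span ⟨i, i.2, rfl⟩)
  · intro w hw h0
    obtain ⟨c, hc⟩ := hW ⟨w, hw⟩
    have h1 : w = ∑ i, c i • v i := by simpa [v'] using congrArg Subtype.val hc
    rw [h1, map_sum] at h0
    simp only [map_smul] at h0
    have h2 := Fintype.linearIndependent_iff.1 hρ c h0
    rw [h1]
    simp [h2]

end

noncomputable section

/-! ### A representation on functions on a lattice -/

section Lattice

open Polynomial

/-- Functions `F` on `ℤ × ℤ` with values in `ℂ[T]`. The value `F i j` stands for the coefficient
of `u ^ (i + 1/2) v ^ j` in a formal series in two variables `u`, `v`. The shift by `1/2` makes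
`c (c - 1)` nonzero for each number `c` by which `u ∂/∂u + v ∂/∂v + 1` acts. -/
abbrev LatFun : Type := ℤ → ℤ → ℂ[X]

/-- On monomials of degree `n + 1/2`, the element `u ∂/∂u + v ∂/∂v + 1` acts by this number. -/
def latC (n : ℤ) : ℂ[X] := (n : ℂ[X]) + 3 * C (1 / 2)

/-- The operator `u ∂/∂v`. -/
def latE : Module.End ℂ LatFun where
  toFun F i j := ((j : ℂ[X]) + 1) * F (i - 1) (j + 1)
  map_add' F G := by ext1 i; ext1 j; simp only [Pi.add_apply]; ring
  map_smul' c F := by ext1 i; ext1 j; simp only [Pi.smul_apply, mul_smul_comm, RingHom.id_apply]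

/-- The operator `v ∂/∂u`. -/
def latF : Module.End ℂ LatFun where
  toFun F i j := ((i : ℂ[X]) + 3 * C (1 / 2)) * F (i + 1) (j - 1)
  map_add' F G := by ext1 i; ext1 j; simp only [Pi.add_apply]; ring
  map_smul' c F := by ext1 i; ext1 j; simp only [Pi.smul_apply, mul_smul_comm, RingHom.id_apply]

/-- The operator `u ∂/∂u - v ∂/∂v`. -/
def latH : Module.End ℂ LatFun where
  toFun F i j := ((i : ℂ[X]) + C (1 / 2) - (j : ℂ[X])) * F i j
  map_add' F G := by ext1 i; ext1 j; simp only [Pi.add_apply]; ring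
  map_smul' c F := by ext1 i; ext1 j; simp only [Pi.smul_apply, mul_smul_comm, RingHom.id_apply]

/-- The operator of multiplication by a function of the degree. -/
def latDiag (g : ℤ → ℂ[X]) : Module.End ℂ LatFun where
  toFun F i j := g (i + j) * F i j
  map_add' F G := by ext1 i; ext1 j; simp only [Pi.add_apply]; ring
  map_smul' c F := by ext1 i; ext1 j; simp only [Pi.smul_apply, mul_smul_comm, RingHom.id_apply]

/-- The highest weight component of the covariant operator attached to a polynomial `P`. Up to
coefficients that depend only on the degree, it is the sum of the operators `u` and `∂/∂v`, which
intertwine representations with Casimir eigenvalues `c²` and `(c - 1)²`; the two summands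
correspond to the two choices of the sign of `c`. -/
def latX (ψ : ℤ → ℂ[X]) : ℂ[X][X] →ₗ[ℂ] Module.End ℂ LatFun :=
  LinearMap.mk₂ ℂ (fun P F i j => P.eval (latC (i + j)) * F (i - 1) j +
      ((j : ℂ[X]) + 1) * ψ (i + j + 1) * P.eval (-latC (i + j)) * F i (j + 1))
    (fun P Q F => by ext1 i; ext1 j; simp only [eval_add, Pi.add_apply]; ring)
    (fun c P F => by
      ext1 i; ext1 j
      simp only [Pi.smul_apply, eval_smul, smul_add, smul_mul_assoc, mul_smul_comm])
    (fun P F G => by ext1 i; ext1 j; simp only [Pi.add_apply]; ring)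
    (fun c P F => by ext1 i; ext1 j; simp only [Pi.smul_apply, smul_add, mul_smul_comm])

/-- The lowest weight component of the covariant operator attached to a polynomial `P`, built from
the operators `v` and `-∂/∂u`. -/
def latY (ψ : ℤ → ℂ[X]) : ℂ[X][X] →ₗ[ℂ] Module.End ℂ LatFun :=
  LinearMap.mk₂ ℂ (fun P F i j => P.eval (latC (i + j)) * F i (j - 1) -
      ((i : ℂ[X]) + 3 * C (1 / 2)) * ψ (i + j + 1) * P.eval (-latC (i + j)) * F (i + 1) j)
    (fun P Q F => by ext1 i; ext1 j; simp only [eval_add, Pi.add_apply]; ring)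
    (fun c P F => by
      ext1 i; ext1 j
      simp only [Pi.smul_apply, eval_smul, smul_sub, smul_mul_assoc, mul_smul_comm])
    (fun P F G => by ext1 i; ext1 j; simp only [Pi.add_apply]; ring)
    (fun c P F => by ext1 i; ext1 j; simp only [Pi.smul_apply, smul_sub, mul_smul_comm])

theorem latE_apply (F : LatFun) (i j : ℤ) :
    latE F i j = ((j : ℂ[X]) + 1) * F (i - 1) (j + 1) := rfl
theorem latF_apply (F : LatFun) (i j : ℤ) :
    latF F i j = ((i : ℂ[X]) + 3 * C (1 / 2)) * F (i + 1) (j - 1) := rfl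
theorem latH_apply (F : LatFun) (i j : ℤ) :
    latH F i j = ((i : ℂ[X]) + C (1 / 2) - (j : ℂ[X])) * F i j := rfl
theorem latDiag_apply (g : ℤ → ℂ[X]) (F : LatFun) (i j : ℤ) :
    latDiag g F i j = g (i + j) * F i j := rfl
theorem latX_apply (ψ : ℤ → ℂ[X]) (P : ℂ[X][X]) (F : LatFun) (i j : ℤ) :
    latX ψ P F i j = P.eval (latC (i + j)) * F (i - 1) j +
      ((j : ℂ[X]) + 1) * ψ (i + j + 1) * P.eval (-latC (i + j)) * F i (j + 1) := rfl
theorem latY_apply (ψ : ℤ → ℂ[X]) (P : ℂ[X][X]) (F : LatFun) (i j : ℤ) :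
    latY ψ P F i j = P.eval (latC (i + j)) * F i (j - 1) -
      ((i : ℂ[X]) + 3 * C (1 / 2)) * ψ (i + j + 1) * P.eval (-latC (i + j)) * F (i + 1) j := rfl

theorem lat_ext {A B : Module.End ℂ LatFun} (h : ∀ F i j, A F i j = B F i j) : A = B :=
  LinearMap.ext fun F => funext fun i => funext fun j => h F i j

variable (ψ : ℤ → ℂ[X]) (P : ℂ[X][X])

theorem latHalf : (2 : ℂ[X]) * C (1 / 2) = 1 := by
  rw [← map_ofNat C 2, ← C_mul, ← C_1]
  norm_num

theorem latH_latE : latH * latE - latE * latH = (2 : ℂ) • latE := by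
  refine lat_ext fun F i j => ?_
  simp only [LinearMap.sub_apply, LinearMap.smul_apply, Module.End.mul_apply, Pi.sub_apply,
    Pi.smul_apply, latE_apply, latH_apply, smul_eq_C_mul, map_ofNat]
  push_cast
  ring

theorem latH_latF : latH * latF - latF * latH = (-2 : ℂ) • latF := by
  refine lat_ext fun F i j => ?_
  simp only [LinearMap.sub_apply, LinearMap.smul_apply, Module.End.mul_apply, Pi.sub_apply,
    Pi.smul_apply, latF_apply, latH_apply, smul_eq_C_mul, map_ofNat, map_neg]
  push_cast
  ring

theorem latE_latF : latE * latF - latF * latE = latH := by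
  refine lat_ext fun F i j => ?_
  simp only [LinearMap.sub_apply, Module.End.mul_apply, Pi.sub_apply,
    latF_apply, latH_apply, latE_apply, sub_add_cancel, add_sub_cancel_right]
  push_cast
  linear_combination (F i j) * latHalf

theorem latE_latX : latE * latX ψ P - latX ψ P * latE = 0 := by
  refine lat_ext fun F i j => ?_
  simp only [LinearMap.sub_apply, Module.End.mul_apply, Pi.sub_apply, LinearMap.zero_apply,
    Pi.zero_apply, latE_apply, latX_apply, sub_add_add_cancel]
  push_cast
  ring

theorem latE_latY : latE * latY ψ P - latY ψ P * latE = latX ψ P := by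
  refine lat_ext fun F i j => ?_
  simp only [LinearMap.sub_apply, Module.End.mul_apply, Pi.sub_apply, latE_apply, latX_apply,
    latY_apply, sub_add_cancel, add_sub_cancel_right]
  rw [show i - 1 + (j + 1) = i + j by ring]
  push_cast
  ring

theorem latH_latX : latH * latX ψ P - latX ψ P * latH = latX ψ P := by
  refine lat_ext fun F i j => ?_
  simp only [LinearMap.sub_apply, Module.End.mul_apply, Pi.sub_apply, latH_apply, latX_apply]
  push_cast
  ring

theorem latH_latY : latH * latY ψ P - latY ψ P * latH = -latY ψ P := by
  refine lat_ext fun F i j => ?_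
  simp only [LinearMap.sub_apply, Module.End.mul_apply, Pi.sub_apply, latH_apply, latY_apply,
    LinearMap.neg_apply, Pi.neg_apply]
  push_cast
  ring

theorem latF_latX : latF * latX ψ P - latX ψ P * latF = latY ψ P := by
  refine lat_ext fun F i j => ?_
  simp only [LinearMap.sub_apply, Module.End.mul_apply, Pi.sub_apply, latF_apply, latX_apply,
    latY_apply, sub_add_cancel, add_sub_cancel_right]
  rw [show i + 1 + (j - 1) = i + j by ring]
  push_cast
  ring

theorem latF_latY : latF * latY ψ P - latY ψ P * latF = 0 := by
  refine lat_ext fun F i j => ?_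
  simp only [LinearMap.sub_apply, Module.End.mul_apply, Pi.sub_apply, LinearMap.zero_apply,
    Pi.zero_apply, latF_apply, latY_apply]
  rw [show i + 1 + (j - 1) = i + j by ring]
  push_cast
  ring

theorem latC_add_one (n : ℤ) : latC (n + 1) = latC n + 1 := by
  simp only [latC]; push_cast; ring

theorem latC_sub_one (n : ℤ) : latC (n - 1) = latC n - 1 := by
  simp only [latC]; push_cast; ring

theorem lat_casimir : (4 : ℂ) • (latF * latE) + latH * latH + (2 : ℂ) • latH + 1 =
    latDiag fun n => latC n ^ 2 := by
  refine lat_ext fun F i j => ?_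
  simp only [LinearMap.add_apply, LinearMap.smul_apply, Module.End.mul_apply, Pi.add_apply,
    Pi.smul_apply, latF_apply, latH_apply, latE_apply, latDiag_apply, smul_eq_C_mul, map_ofNat,
    sub_add_cancel, add_sub_cancel_right, Module.End.one_apply, latC]
  push_cast
  linear_combination ((2 * j - 4 * C (1 / 2) - 2 * i - 1) * F i j) * latHalf

theorem latDiag_mul_latX {g : ℤ → ℂ[X]} {G : ℂ[X][X]} (h1 : ∀ n, g n = G.eval (latC n))
    (h2 : ∀ n, g n = G.eval (-latC n)) : latDiag g * latX ψ P = latX ψ (G * P) := by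
  refine lat_ext fun F i j => ?_
  simp only [Module.End.mul_apply, latX_apply, latDiag_apply, eval_mul]
  rw [mul_add, ← h2]
  nth_rw 1 [h1]
  ring

theorem latX_mul_latDiag {g : ℤ → ℂ[X]} {G : ℂ[X][X]} (h1 : ∀ n, g n = G.eval (latC n))
    (h2 : ∀ n, g n = G.eval (-latC n)) : latX ψ P * latDiag g = latX ψ (G.comp (X - 1) * P) := by
  refine lat_ext fun F i j => ?_
  simp only [Module.End.mul_apply, latX_apply, latDiag_apply, eval_mul, eval_comp, eval_sub,
    eval_X, eval_one]
  rw [show i - 1 + j = i + j - 1 by ring, h1, ← add_assoc i j 1, h2, latC_sub_one, latC_add_one,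
    neg_add, ← sub_eq_add_neg]
  ring

/-- The commutator of the operators of `x` and `y`. -/
theorem latX_latY_comm : latX ψ 1 * latY ψ 1 - latY ψ 1 * latX ψ 1 =
    latDiag fun n => (latC n + 1) * ψ (n + 1) - (latC n - 1) * ψ n := by
  refine lat_ext fun F i j => ?_
  simp only [LinearMap.sub_apply, Module.End.mul_apply, Pi.sub_apply, latX_apply, latY_apply,
    latDiag_apply, eval_one, latC, sub_add_cancel, add_sub_cancel_right]
  rw [show i - 1 + j + 1 = i + j by ring, show i + (j - 1) + 1 = i + j by ring,
    show i + (j + 1) + 1 = i + j + 2 by ring, show i + 1 + j + 1 = i + j + 2 by ring]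
  push_cast
  ring

/-- The bracket of the covariants attached to `P` and to `1`, and its symmetrization. -/
theorem latX_latY_bracket : latX ψ P * latY ψ 1 - latY ψ 1 * latX ψ P +
    (latX ψ 1 * latY ψ P - latY ψ P * latX ψ 1) =
    latDiag fun n => (latC n + 1) * ψ (n + 1) * (P.eval (latC n + 1) + P.eval (-latC n)) -
      (latC n - 1) * ψ n * (P.eval (latC n) + P.eval (1 - latC n)) := by
  refine lat_ext fun F i j => ?_
  simp only [LinearMap.sub_apply, LinearMap.add_apply, Pi.add_apply, Module.End.mul_apply,
    Pi.sub_apply, latX_apply, latY_apply,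
    latDiag_apply, eval_one, sub_add_cancel, add_sub_cancel_right]
  rw [show i - 1 + j + 1 = i + j by ring, show i + (j - 1) + 1 = i + j by ring,
    show i + (j + 1) + 1 = i + j + 2 by ring, show i + 1 + j + 1 = i + j + 2 by ring,
    show i - 1 + j = i + j - 1 by ring, show i + (j - 1) = i + j - 1 by ring,
    show i + (j + 1) = i + j + 1 by ring, show i + 1 + j = i + j + 1 by ring,
    latC_sub_one, latC_add_one, neg_sub]
  have hc : latC (i + j) = (i : ℂ[X]) + (j : ℂ[X]) + 3 * C (1 / 2) := by
    simp only [latC]; push_cast; ring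
  generalize latC (i + j) = c at hc ⊢
  push_cast
  linear_combination (-(ψ (i + j + 1) * (P.eval (c + 1) + P.eval (-c)) -
    ψ (i + j) * (P.eval c + P.eval (1 - c))) * F i j) * hc

/-- The invariant pairing of the covariants attached to `P` and to `1`. -/
theorem latX_latY_wedge : latX ψ P * latY ψ 1 - latY ψ P * latX ψ 1 =
    latDiag fun n => (latC n + 1) * ψ (n + 1) * P.eval (-latC n) -
      (latC n - 1) * ψ n * P.eval (latC n) := by
  refine lat_ext fun F i j => ?_
  simp only [LinearMap.sub_apply, Module.End.mul_apply,
    Pi.sub_apply, latX_apply, latY_apply,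
    latDiag_apply, eval_one, sub_add_cancel, add_sub_cancel_right]
  rw [show i - 1 + j + 1 = i + j by ring, show i + (j - 1) + 1 = i + j by ring,
    show i + (j + 1) + 1 = i + j + 2 by ring, show i + 1 + j + 1 = i + j + 2 by ring]
  have hc : latC (i + j) = (i : ℂ[X]) + (j : ℂ[X]) + 3 * C (1 / 2) := by
    simp only [latC]; push_cast; ring
  generalize latC (i + j) = c at hc ⊢
  push_cast
  linear_combination (-(ψ (i + j + 1) * P.eval (-c) - ψ (i + j) * P.eval c) * F i j) * hc

variable {ψ P}

theorem latC_natCast (n : ℕ) : latC n = 3 * C (1 / 2) + (n : ℂ[X]) := by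
  simp only [latC]; push_cast; ring

theorem eq_zero_of_eval_latC (h : ∀ n, P.eval (latC n) = 0) : P = 0 :=
  eq_zero_of_forall_nat (s := 3 * C (1 / 2)) fun n => by rw [← latC_natCast, h]

theorem latDiag_eq_zero {g : ℤ → ℂ[X]} (h : latDiag g = 0) (n : ℤ) : g n = 0 := by
  have := congrFun (congrFun (LinearMap.congr_fun h (fun _ _ => 1)) n) 0
  simpa [latDiag_apply] using this

theorem latX_injective (ψ : ℤ → ℂ[X]) : Function.Injective (latX ψ) := by
  rw [← LinearMap.ker_eq_bot, LinearMap.ker_eq_bot']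
  intro P h
  refine eq_zero_of_eval_latC fun n => ?_
  have := congrFun (congrFun (LinearMap.congr_fun h
    (fun _ j => if j = 0 then 1 else 0)) n) 0
  simpa [latX_apply] using this

theorem latDiag_add (g g' : ℤ → ℂ[X]) : latDiag (g + g') = latDiag g + latDiag g' :=
  lat_ext fun F i j => by
    simp only [latDiag_apply, LinearMap.add_apply, Pi.add_apply, add_mul]

theorem latDiag_smul (c : ℂ) (g : ℤ → ℂ[X]) : latDiag (c • g) = c • latDiag g :=
  lat_ext fun F i j => by
    simp only [latDiag_apply, LinearMap.smul_apply, Pi.smul_apply, smul_mul_assoc]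

theorem latDiag_mul (g g' : ℤ → ℂ[X]) : latDiag g * latDiag g' = latDiag (g * g') :=
  lat_ext fun F i j => by
    simp only [latDiag_apply, Module.End.mul_apply, Pi.mul_apply, mul_assoc]

theorem latDiag_one : latDiag 1 = 1 :=
  lat_ext fun F i j => by
    simp only [latDiag_apply, Module.End.one_apply, Pi.one_apply, one_mul]

/-- The operator by which an invariant acts: multiplication by `G(c²)`. -/
def latInv : ℂ[X][X] →ₗ[ℂ] Module.End ℂ LatFun where
  toFun G := latDiag fun n => G.eval (latC n ^ 2)
  map_add' G K := by rw [← latDiag_add]; congr 1; ext1 n; simp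
  map_smul' c G := by
    rw [RingHom.id_apply, ← latDiag_smul]; congr 1; ext1 n; simp [eval_smul]

theorem latInv_apply (G : ℂ[X][X]) : latInv G = latDiag fun n => G.eval (latC n ^ 2) := rfl

theorem latInv_injective : Function.Injective latInv := by
  rw [← LinearMap.ker_eq_bot, LinearMap.ker_eq_bot']
  intro G h
  rw [latInv_apply] at h
  have h1 : G.comp (X ^ 2) = 0 := by
    refine eq_zero_of_eval_latC fun n => ?_
    rw [eval_comp, eval_pow, eval_X]
    exact latDiag_eq_zero h n
  rw [← expand_eq_comp_X_pow] at h1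
  exact (expand_eq_zero two_pos).1 h1

theorem latInv_mul_latX (G P : ℂ[X][X]) :
    latInv G * latX ψ P = latX ψ (G.comp (X ^ 2) * P) := by
  rw [latInv_apply]
  refine latDiag_mul_latX ψ P (G := G.comp (X ^ 2)) (fun n => ?_) (fun n => ?_)
  · rw [eval_comp, eval_pow, eval_X]
  · rw [eval_comp, eval_pow, eval_X, neg_sq]

theorem latX_mul_latInv (P G : ℂ[X][X]) :
    latX ψ P * latInv G = latX ψ (G.comp ((X - 1) ^ 2) * P) := by
  have h : (G.comp (X ^ 2)).comp (X - 1) = G.comp ((X - 1) ^ 2) := by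
    rw [comp_assoc, X_pow_comp]
  rw [latInv_apply, ← h]
  refine latX_mul_latDiag ψ P (G := G.comp (X ^ 2)) (fun n => ?_) (fun n => ?_)
  · rw [eval_comp, eval_pow, eval_X]
  · rw [eval_comp, eval_pow, eval_X, neg_sq]

/-- The monomials `T ^ k X ^ m`. -/
def biMonomial (p : ℕ × ℕ) : ℂ[X][X] := C (X ^ p.2) * X ^ p.1

theorem linearIndependent_biMonomial : LinearIndependent ℂ biMonomial := by
  classical
  rw [linearIndependent_iff']
  intro I c h p hp
  have := congrArg (fun Q => (Q.coeff p.1).coeff p.2) h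
  simp only [finsetSum_coeff, coeff_smul, coeff_zero, biMonomial, coeff_C_mul_X_pow] at this
  rw [Finset.sum_eq_single p] at this
  · simpa using this
  · intro q _ hqp
    by_cases h1 : p.1 = q.1
    · have h2 : p.2 ≠ q.2 := fun h2 => hqp (Prod.ext h1 h2).symm
      simp [h1, coeff_X_pow, h2]
    · simp [h1]
  · exact fun h => absurd hp h

theorem induction_biMonomial {p : ℂ[X][X] → Prop} (G : ℂ[X][X])
    (hadd : ∀ G K, p G → p K → p (G + K)) (hsmul : ∀ (c : ℂ) G, p G → p (c • G))
    (hmon : ∀ m k, p (biMonomial (m, k))) : p G := by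
  induction G using Polynomial.induction_on' with
  | add G K hG hK => exact hadd G K hG hK
  | monomial m a =>
    induction a using Polynomial.induction_on' with
    | add a b ha hb => rw [map_add]; exact hadd _ _ ha hb
    | monomial k c =>
      have : monomial m (monomial k c) = c • biMonomial (m, k) := by
        rw [biMonomial, ← C_mul_X_pow_eq_monomial, ← C_mul_X_pow_eq_monomial, C_mul, mul_assoc,
          ← smul_eq_C_mul]
        ext i j
        simp
      rw [this]
      exact hsmul _ _ (hmon m k)

end Lattice
end

noncomputable section

open Gen Polynomial

/-! ### Classification of invariants and covariants -/

namespace Sl2Plane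

variable {A : Type*} [Ring A] [Algebra ℂ A] {s : Sl2Plane A} {d : ℕ}

/-- If highest weight vectors of weight `ν` have linearly independent images and are in bijection
with vectors spanning the reduced monomials, then they span the highest weight vectors, and `ρ` is
injective on these. -/
theorem highest_le_span (hs : s.IsFiltered d) {ν n : ℕ} {ι N : Type*} [AddCommGroup N] [Module ℂ N]
    (I : Finset ι) (b v : ι → A) (hb : reducedMonomials s d ν n ⊆ Submodule.span ℂ (b '' I))
    (hv : ∀ i ∈ I, v i ∈ s.fil d n ν) (hev : ∀ i ∈ I, adOp (s.gen e) (v i) = 0)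
    (ρ : A →ₗ[ℂ] N) (hρ : LinearIndependent ℂ fun i : I => ρ (v i)) {w : A}
    (hw : w ∈ s.fil d n ν) (hew : adOp (s.gen e) w = 0) :
    w ∈ Submodule.span ℂ (v '' I) ∧ (ρ w = 0 → w = 0) := by
  have hdis : Disjoint (s.fil d n ν ⊓ LinearMap.ker (adOp (s.gen e))) (loweredSpan s d ν n) := by
    rw [Submodule.disjoint_def]
    exact fun a ha ha' => eq_zero_of_mem_loweredSpan hs.pos ha.1 ha.2 ha'
  have := Submodule.le_span_of_linearIndependent hdis I b v
    (inf_le_left.trans ((fil_le_sup_loweredSpan hs ν n).trans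
      (sup_le_sup_right (Submodule.span_le.2 hb) _)))
    (fun i hi => ⟨hv i hi, hev i hi⟩) ρ hρ
  exact ⟨this.1 ⟨hw, hew⟩, this.2 w ⟨hw, hew⟩⟩

variable (s) in
/-- The highest weight component `(Δ x - x Δ + x) / 2` of the second basic covariant, where `Δ` is
the Casimir element. -/
def xCas : A := (1 / 2 : ℂ) • (s.cas * s.gen x - s.gen x * s.cas + s.gen x)

variable (s) in
/-- The lowest weight component of the second basic covariant. -/
def yCas : A := (1 / 2 : ℂ) • (s.cas * s.gen y - s.gen y * s.cas + s.gen y)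

/-- The second basic covariant transforms like the first one. -/
theorem adOp_mul_sub_mul {a b c c' : A} (h : Commute a b) (hc : adOp a c = c') :
    adOp a ((1 / 2 : ℂ) • (b * c - c * b + c)) = (1 / 2 : ℂ) • (b * c' - c' * b + c') := by
  rw [map_smul, map_add, map_sub, adOp_mul, adOp_mul, adOp_eq_zero_iff.2 h, hc]
  simp

theorem adOp_e_x : adOp (s.gen e) (s.gen x) = 0 := by
  simpa [coefE, adOp_apply] using s.lie_e x
theorem adOp_e_y : adOp (s.gen e) (s.gen y) = s.gen x := by
  simpa [coefE, tgtE, adOp_apply] using s.lie_e y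
theorem adOp_f_x : adOp (s.gen f) (s.gen x) = s.gen y := by
  simpa [coefF, tgtF, adOp_apply] using s.lie_f x
theorem adOp_f_y : adOp (s.gen f) (s.gen y) = 0 := by
  simpa [coefF, adOp_apply] using s.lie_f y

theorem adOp_h_x : adOp (s.gen h) (s.gen x) = s.gen x := by
  have := s.lie_h x
  rw [adOp_apply, this]
  simp [wt]

theorem adOp_e_xCas : adOp (s.gen e) s.xCas = 0 :=
  (adOp_mul_sub_mul commute_e_cas adOp_e_x).trans (by simp)
theorem adOp_e_yCas : adOp (s.gen e) s.yCas = s.xCas := adOp_mul_sub_mul commute_e_cas adOp_e_y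
theorem adOp_f_xCas : adOp (s.gen f) s.xCas = s.yCas := adOp_mul_sub_mul commute_f_cas adOp_f_x
theorem adOp_f_yCas : adOp (s.gen f) s.yCas = 0 :=
  (adOp_mul_sub_mul commute_f_cas adOp_f_y).trans (by simp)

/-- In the commutator of `Δ` with `x` the terms of degree `d + 2` cancel. -/
theorem xCas_mem (hs : s.IsFiltered d) : s.xCas ∈ s.fil d (d + 2) 1 := by
  have key : ∀ l l' : List Gen, l.Perm l' → degW d l ≤ d + 2 → wtW l = 1 →
      s.word l - s.word l' ∈ s.fil d (d + 2) 1 :=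
    fun l l' hp hd hw => hw ▸ fil_mono hd _ (word_perm hs hp)
  have h1 := key [f, e, x] [x, f, e] (by decide) (by simp [deg]; omega) rfl
  have h2 := key [h, h, x] [x, h, h] (by decide) (by simp [deg]; omega) rfl
  have h3 := key [h, x] [x, h] (by decide) (by simp [deg]; omega) rfl
  simp only [word_cons, word_nil, mul_one] at h1 h2 h3
  have h4 : s.gen x ∈ s.fil d (d + 2) 1 := gen_mem _ (by simp [deg]) rfl
  have h5 : s.cas * s.gen x - s.gen x * s.cas =
      (4 : ℂ) • (s.gen f * (s.gen e * s.gen x) - s.gen x * (s.gen f * s.gen e)) +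
        (s.gen h * (s.gen h * s.gen x) - s.gen x * (s.gen h * s.gen h)) +
        (2 : ℂ) • (s.gen h * s.gen x - s.gen x * s.gen h) := by
    simp only [cas, add_mul, mul_add, smul_mul_assoc, mul_smul_comm, one_mul, mul_one, mul_assoc]
    module
  rw [xCas, h5]
  exact Submodule.smul_mem _ _ (Submodule.add_mem _ (Submodule.add_mem _ (Submodule.add_mem _
    (Submodule.smul_mem _ _ h1) h2) (Submodule.smul_mem _ _ h3)) h4)

theorem yCas_mem (hs : s.IsFiltered d) : s.yCas ∈ s.fil d (d + 2) (-1) := by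
  rw [← adOp_f_xCas]
  have h := adOp_f_mem (xCas_mem hs)
  norm_num at h
  exact h

end Sl2Plane

open Sl2Plane

/-- An action of `A` on functions on the lattice, together with an invariant element `t` of `A`
acting by the variable `T`, the formal counterpart of `x' y - y' x` for the two basic covariants
`(x, y)` and `(x', y')`. -/
structure LatModel {A : Type*} [Ring A] [Algebra ℂ A] (s : Sl2Plane A) (d : ℕ) where
  filtered : s.IsFiltered d
  /-- The coefficients of the lowering part of the action of `x` and `y`. -/
  ψ : ℤ → ℂ[X]
  /-- The action. -/
  ρ : A →ₐ[ℂ] Module.End ℂ LatFun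
  ρ_e : ρ (s.gen e) = latE
  ρ_f : ρ (s.gen f) = latF
  ρ_h : ρ (s.gen h) = latH
  ρ_x : ρ (s.gen x) = latX ψ 1
  ρ_y : ρ (s.gen y) = latY ψ 1
  /-- The invariant element. -/
  t : A
  t_mem : t ∈ s.fil d (2 * d + 2) 0
  e_t : Commute (s.gen e) t
  f_t : Commute (s.gen f) t
  ρ_t : ρ t = latInv (C X)

theorem latInv_mul (G K : ℂ[X][X]) : latInv (G * K) = latInv G * latInv K := by
  rw [latInv_apply, latInv_apply, latInv_apply, latDiag_mul]
  congr 1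
  ext1 n
  rw [eval_mul]
  rfl

theorem latInv_one : latInv 1 = 1 := by
  rw [latInv_apply, ← latDiag_one]
  congr 1
  ext1 n
  rw [eval_one]
  rfl

theorem latInv_pow (G : ℂ[X][X]) (k : ℕ) : latInv (G ^ k) = latInv G ^ k := by
  induction k with
  | zero => rw [pow_zero, pow_zero, latInv_one]
  | succ k ih => rw [pow_succ, pow_succ, latInv_mul, ih]

theorem latInv_X : latInv X = latDiag fun n => latC n ^ 2 := by
  rw [latInv_apply]
  simp only [eval_X]

namespace LatModel

variable {A : Type*} [Ring A] [Algebra ℂ A] {s : Sl2Plane A} {d : ℕ} (M : LatModel s d)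

/-- The Casimir element acts by `c²`, provided that `e`, `f`, `h` act in the standard way. -/
theorem ρ_cas_of {ρ : A →ₐ[ℂ] Module.End ℂ LatFun} (he : ρ (s.gen e) = latE)
    (hf : ρ (s.gen f) = latF) (hh : ρ (s.gen h) = latH) : ρ s.cas = latInv X := by
  rw [latInv_X, ← lat_casimir, cas]
  simp only [map_add, map_smul, map_mul, map_one, he, hf, hh]

theorem ρ_cas : M.ρ s.cas = latInv X := ρ_cas_of M.ρ_e M.ρ_f M.ρ_h

/-- The second basic covariant is attached to the polynomial `X`, because
`c² - (c - 1)² + 1 = 2 c`. -/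
theorem ρ_xCas_of {ρ : A →ₐ[ℂ] Module.End ℂ LatFun} {ψ : ℤ → ℂ[X]} (hc : ρ s.cas = latInv X)
    (hx : ρ (s.gen x) = latX ψ 1) : ρ s.xCas = latX ψ X := by
  rw [xCas, map_smul, map_add, map_sub, map_mul, map_mul, hc, hx, latInv_mul_latX, latX_mul_latInv,
    ← map_sub, ← map_add, ← map_smul]
  congr 1
  rw [X_comp, X_comp, mul_one, mul_one,
    show (X ^ 2 - (X - 1) ^ 2 + 1 : ℂ[X][X]) = (2 : ℂ) • X by
      rw [two_smul]; ring, smul_smul]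
  norm_num

theorem ρ_xCas : M.ρ s.xCas = latX M.ψ X := ρ_xCas_of M.ρ_cas M.ρ_x

theorem h_t : Commute (s.gen h) M.t := by
  have := (M.e_t.mul_left M.f_t).sub_left (M.f_t.mul_left M.e_t)
  rwa [s.e_f] at this

theorem t_pow_mem (k : ℕ) : M.t ^ k ∈ s.fil d (k * (2 * d + 1) + 1) 0 := by
  induction k with
  | zero =>
    rw [pow_zero, zero_mul]
    exact one_mem_fil
  | succ k ih =>
    rw [pow_succ, show (k + 1) * (2 * d + 1) + 1 = k * (2 * d + 1) + (2 * d + 1) + 1 by ring]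
    have h := mul_mem (n := 2 * d + 1) ih M.t_mem
    rwa [add_zero] at h

theorem biMonomial_eq (p : ℕ × ℕ) : biMonomial p = X ^ p.1 * (C X) ^ p.2 := by
  rw [biMonomial, C_pow, mul_comm]

/-- The invariants `Δᵃ tᵏ`, for `p = (a, k)`. -/
def inv (p : ℕ × ℕ) : A := s.cas ^ p.1 * M.t ^ p.2

theorem ρ_inv (p : ℕ × ℕ) : M.ρ (M.inv p) = latInv (biMonomial p) := by
  rw [inv, map_mul, map_pow, map_pow, M.ρ_cas, M.ρ_t, biMonomial_eq, latInv_mul, latInv_pow,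
    latInv_pow]

/-- The highest weight vectors of covariants, `Δᵃ tᵏ x` for `p = (2 a, k)` and `Δᵃ tᵏ x'` for
`p = (2 a + 1, k)`. They act by the polynomials `X ^ p.1 * T ^ p.2`. -/
def cov (p : ℕ × ℕ) : A :=
  s.cas ^ (p.1 / 2) * (M.t ^ p.2 * if p.1 % 2 = 0 then s.gen x else s.xCas)

theorem ρ_cov (p : ℕ × ℕ) : M.ρ (M.cov p) = latX M.ψ (biMonomial p) := by
  have h1 : M.ρ (if p.1 % 2 = 0 then s.gen x else s.xCas) = latX M.ψ (X ^ (p.1 % 2)) := by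
    rcases Nat.mod_two_eq_zero_or_one p.1 with h | h
    · rw [h, if_pos rfl, pow_zero, M.ρ_x]
    · rw [h, if_neg one_ne_zero, pow_one, M.ρ_xCas]
  rw [cov, map_mul, map_mul, map_pow, map_pow, M.ρ_cas, M.ρ_t, h1, ← latInv_pow, ← latInv_pow,
    latInv_mul_latX, latInv_mul_latX, biMonomial_eq]
  congr 1
  conv_rhs => rw [← Nat.div_add_mod p.1 2]
  rw [pow_add, pow_mul, ← C_pow, C_comp, X_pow_comp]
  ring

theorem adOp_e_inv (p : ℕ × ℕ) : adOp (s.gen e) (M.inv p) = 0 :=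
  adOp_eq_zero_iff.2 ((commute_e_cas.pow_right _).mul_right (M.e_t.pow_right _))

theorem adOp_e_cov (p : ℕ × ℕ) : adOp (s.gen e) (M.cov p) = 0 := by
  rw [cov, adOp_mul_of_commute (commute_e_cas.pow_right _),
    adOp_mul_of_commute (M.e_t.pow_right _)]
  split_ifs
  · rw [adOp_e_x, mul_zero, mul_zero]
  · rw [adOp_e_xCas, mul_zero, mul_zero]

theorem inv_mem {p : ℕ × ℕ} {n : ℕ} (hp : 2 * p.1 + p.2 * (2 * d + 1) < n) :
    M.inv p ∈ s.fil d n 0 :=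
  fil_mono (by omega) _ (cas_pow_mul_mem (M.t_pow_mem p.2) p.1)

theorem cov_mem {p : ℕ × ℕ} {n : ℕ} (hp : p.1 + p.2 * (2 * d + 1) + d < n) :
    M.cov p ∈ s.fil d n 1 := by
  have h1 : (if p.1 % 2 = 0 then s.gen x else s.xCas) ∈ s.fil d (d + p.1 % 2 + 1) 1 := by
    rcases Nat.mod_two_eq_zero_or_one p.1 with h | h
    · rw [h, if_pos rfl]
      exact gen_mem _ (by simp [deg]) rfl
    · rw [h, if_neg one_ne_zero]
      exact xCas_mem M.filtered
  have h2 := cas_pow_mul_mem (mul_mem (M.t_pow_mem p.2) h1) (p.1 / 2)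
  exact fil_mono (by omega) _ h2

/-- The vectors of weight `0` killed by `ad e` act by polynomials in `c²` and `T`, faithfully. -/
theorem invariants (n : ℕ) {w : A} (hw : w ∈ s.fil d n 0) (hew : adOp (s.gen e) w = 0) :
    (∃ G, M.ρ w = latInv G) ∧ (M.ρ w = 0 → w = 0) := by
  let I : Finset (ℕ × ℕ) := (Finset.range n ×ˢ Finset.range n).filter
    fun p => 2 * p.1 + p.2 * (2 * d + 1) < n
  have hI : ∀ p, p ∈ I ↔ 2 * p.1 + p.2 * (2 * d + 1) < n := by
    intro p
    simp only [I, Finset.mem_filter, Finset.mem_product, Finset.mem_range, and_iff_right_iff_imp]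
    intro hp
    have : p.2 ≤ p.2 * (2 * d + 1) := Nat.le_mul_of_pos_right _ (by omega)
    omega
  have key := highest_le_span (ν := 0) M.filtered I
    (fun p => s.cas ^ p.1 * s.word (mon p.2 0 0 0 (2 * p.2))) M.inv ?_
    (fun p hp => by simpa using M.inv_mem ((hI p).1 hp)) (fun p _ => M.adOp_e_inv p)
    M.ρ.toLinearMap ?_ (by simpa using hw) hew
  · refine ⟨?_, key.2⟩
    have : Submodule.span ℂ (M.inv '' I) ≤ (LinearMap.range latInv).comap M.ρ.toLinearMap := by
      rw [Submodule.span_le]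
      rintro _ ⟨p, -, rfl⟩
      exact ⟨_, (M.ρ_inv p).symm⟩
    obtain ⟨G, hG⟩ := this key.1
    exact ⟨G, hG.symm⟩
  · rintro _ ⟨c, k, p, q, h1, h2, h3, rfl⟩
    obtain rfl : p = 0 := by omega
    obtain rfl : q = 2 * k := by rw [wtW_mon] at h3; push_cast at h3; omega
    refine Submodule.subset_span ⟨(c, k), (hI _).2 ?_, rfl⟩
    rw [degW_mon] at h2
    convert h2 using 1
    ring
  · have : (fun i : I => M.ρ.toLinearMap (M.inv i)) = fun i : I => latInv (biMonomial i) :=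
      funext fun i => M.ρ_inv i
    rw [this]
    exact (linearIndependent_biMonomial.map' latInv
      (LinearMap.ker_eq_bot.2 latInv_injective)).comp _ Subtype.val_injective

/-- The vectors of weight `1` killed by `ad e` act by the operators `latX`, faithfully. -/
theorem covariants (n : ℕ) {w : A} (hw : w ∈ s.fil d n 1) (hew : adOp (s.gen e) w = 0) :
    (∃ P, M.ρ w = latX M.ψ P) ∧ (M.ρ w = 0 → w = 0) := by
  let I : Finset (ℕ × ℕ) := (Finset.range n ×ˢ Finset.range n).filter
    fun p => p.1 + p.2 * (2 * d + 1) + d < n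
  have hI : ∀ p, p ∈ I ↔ p.1 + p.2 * (2 * d + 1) + d < n := by
    intro p
    simp only [I, Finset.mem_filter, Finset.mem_product, Finset.mem_range, and_iff_right_iff_imp]
    intro hp
    have : p.2 ≤ p.2 * (2 * d + 1) := Nat.le_mul_of_pos_right _ (by omega)
    omega
  have key := highest_le_span (ν := 1) M.filtered I
    (fun p => s.cas ^ (p.1 / 2) * if p.1 % 2 = 0 then s.word (mon p.2 0 0 1 (2 * p.2)) else
      s.word (mon (p.2 + 1) 0 0 0 (2 * p.2 + 1))) M.cov ?_
    (fun p hp => by simpa using M.cov_mem ((hI p).1 hp)) (fun p _ => M.adOp_e_cov p)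
    M.ρ.toLinearMap ?_ (by simpa using hw) hew
  · refine ⟨?_, key.2⟩
    have : Submodule.span ℂ (M.cov '' I) ≤
        (LinearMap.range (latX M.ψ)).comap M.ρ.toLinearMap := by
      rw [Submodule.span_le]
      rintro _ ⟨p, -, rfl⟩
      exact ⟨_, (M.ρ_cov p).symm⟩
    obtain ⟨G, hG⟩ := this key.1
    exact ⟨G, hG.symm⟩
  · rintro _ ⟨c, k, p, q, h1, h2, h3, rfl⟩
    have hp : p = 0 ∨ p = 1 := by omega
    rcases hp with rfl | rfl
    · obtain ⟨k, rfl⟩ : ∃ k', k = k' + 1 := by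
        rw [wtW_mon] at h3; push_cast at h3
        exact ⟨k - 1, by omega⟩
      obtain rfl : q = 2 * k + 1 := by rw [wtW_mon] at h3; push_cast at h3; omega
      refine Submodule.subset_span ⟨(2 * c + 1, k), (hI _).2 ?_, ?_⟩
      · rw [degW_mon] at h2
        convert h2 using 1
        ring
      · have h4 : (2 * c + 1) / 2 = c := by omega
        have h5 : ¬(2 * c + 1) % 2 = 0 := by omega
        simp only [h4, h5, if_false]
    · obtain rfl : q = 2 * k := by rw [wtW_mon] at h3; push_cast at h3; omega
      refine Submodule.subset_span ⟨(2 * c, k), (hI _).2 ?_, ?_⟩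
      · rw [degW_mon] at h2
        convert h2 using 1
        ring
      · have h4 : 2 * c / 2 = c := by omega
        have h5 : 2 * c % 2 = 0 := by omega
        simp only [h4, h5, if_true]
  · have : (fun i : I => M.ρ.toLinearMap (M.cov i)) = fun i : I => latX M.ψ (biMonomial i) :=
      funext fun i => M.ρ_cov i
    rw [this]
    exact (linearIndependent_biMonomial.map' (latX M.ψ)
      (LinearMap.ker_eq_bot.2 (latX_injective M.ψ))).comp _ Subtype.val_injective

/-- An element commuting with `e` and `h` acts by `G(c²)` for some polynomial `G`. -/
theorem exists_latInv {g : A} (he : Commute (s.gen e) g) (hh : Commute (s.gen h) g) :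
    ∃ G, M.ρ g = latInv G := by
  obtain ⟨n, hn⟩ := exists_mem_fil (s := s) d (a := g) (μ := 0) (by
    rw [adOp_eq_zero_iff.2 hh]; simp)
  exact (M.invariants n hn (adOp_eq_zero_iff.2 he)).1

theorem eq_zero_of_invariant {g : A} (he : Commute (s.gen e) g) (hh : Commute (s.gen h) g)
    (h0 : M.ρ g = 0) : g = 0 := by
  obtain ⟨n, hn⟩ := exists_mem_fil (s := s) d (a := g) (μ := 0) (by
    rw [adOp_eq_zero_iff.2 hh]; simp)
  exact (M.invariants n hn (adOp_eq_zero_iff.2 he)).2 h0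

theorem exists_latX {p : A} (he : adOp (s.gen e) p = 0) (hh : adOp (s.gen h) p = p) :
    ∃ P, M.ρ p = latX M.ψ P := by
  obtain ⟨n, hn⟩ := exists_mem_fil (s := s) d (a := p) (μ := 1) (by rw [hh]; simp)
  exact (M.covariants n hn he).1

theorem eq_zero_of_covariant {p : A} (he : adOp (s.gen e) p = 0) (hh : adOp (s.gen h) p = p)
    (h0 : M.ρ p = 0) : p = 0 := by
  obtain ⟨n, hn⟩ := exists_mem_fil (s := s) d (a := p) (μ := 1) (by rw [hh]; simp)
  exact (M.covariants n hn he).2 h0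

theorem exists_invariant (G : ℂ[X][X]) : ∃ g, Commute (s.gen e) g ∧ Commute (s.gen f) g ∧
    Commute (s.gen h) g ∧ M.ρ g = latInv G := by
  induction G using induction_biMonomial with
  | hadd G K hG hK =>
    obtain ⟨g, h1, h2, h3, h4⟩ := hG
    obtain ⟨k, h1', h2', h3', h4'⟩ := hK
    exact ⟨g + k, h1.add_right h1', h2.add_right h2', h3.add_right h3', by
      rw [map_add, map_add, h4, h4']⟩
  | hsmul c G hG =>
    obtain ⟨g, h1, h2, h3, h4⟩ := hG
    exact ⟨c • g, h1.smul_right c, h2.smul_right c, h3.smul_right c, by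
      rw [map_smul, map_smul, h4]⟩
  | hmon m k =>
    exact ⟨M.inv (m, k), (commute_e_cas.pow_right _).mul_right (M.e_t.pow_right _),
      (commute_f_cas.pow_right _).mul_right (M.f_t.pow_right _),
      (commute_h_cas.pow_right _).mul_right (M.h_t.pow_right _), M.ρ_inv _⟩

end LatModel
end

noncomputable section

open Gen Polynomial Sl2Plane

/-! ### Construction of the lattice representation -/

theorem latC_eq (n : ℤ) : latC n = C ((n : ℂ) + 3 / 2) := by
  rw [latC, C_add, map_intCast, show (3 / 2 : ℂ) = 3 * (1 / 2) by norm_num, C_mul]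
  congr 2

theorem intCast_add_half_ne_zero (n : ℤ) : (n : ℂ) + 1 / 2 ≠ 0 := by
  intro h
  have h1 : ((2 * n + 1 : ℤ) : ℂ) = 0 := by push_cast; linear_combination 2 * h
  have h2 : 2 * n + 1 = 0 := by exact_mod_cast h1
  omega

theorem latC_ne_zero (n : ℤ) : latC n ≠ 0 := by
  rw [latC_eq, Ne, C_eq_zero]
  have := intCast_add_half_ne_zero (n + 1)
  push_cast at this
  rwa [add_assoc, show (1 + 1 / 2 : ℂ) = 3 / 2 by norm_num] at this

/-- The coefficients `(T + W(c - 1)) / (c (c - 1))` at `c = n + 3 / 2`. -/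
def latPsi (W : ℂ[X]) (n : ℤ) : ℂ[X] :=
  C (((n : ℂ) + 1 / 2) * ((n : ℂ) + 3 / 2))⁻¹ * (X + (W.map C).eval (latC n - 1))

theorem latC_mul_latPsi (W : ℂ[X]) (n : ℤ) :
    (latC n - 1) * latC n * latPsi W n = X + (W.map C).eval (latC n - 1) := by
  have h : (latC n - 1) * latC n * C (((n : ℂ) + 1 / 2) * ((n : ℂ) + 3 / 2))⁻¹ = 1 := by
    rw [latC_eq, ← C_1, ← C_sub, ← C_mul, ← C_mul]
    congr 1
    rw [show (n : ℂ) + 3 / 2 - 1 = n + 1 / 2 by ring]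
    refine mul_inv_cancel₀ (mul_ne_zero (intCast_add_half_ne_zero n) ?_)
    have := intCast_add_half_ne_zero (n + 1)
    push_cast at this
    rwa [add_assoc, show (1 + 1 / 2 : ℂ) = 3 / 2 by norm_num] at this
  rw [latPsi, ← mul_assoc, h, one_mul]

theorem latC_mul_latPsi_add_one (W : ℂ[X]) (n : ℤ) :
    latC n * (latC n + 1) * latPsi W (n + 1) = X + (W.map C).eval (latC n) := by
  have := latC_mul_latPsi W (n + 1)
  rwa [latC_add_one, add_sub_cancel_right] at this

theorem latInv_map_C (p : ℂ[X]) : latInv (p.map C) = aeval (latInv X) p := by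
  induction p using Polynomial.induction_on' with
  | add p q hp hq => rw [Polynomial.map_add, map_add, map_add, hp, hq]
  | monomial n a =>
    rw [aeval_monomial, ← latInv_pow, ← C_mul_X_pow_eq_monomial, Polynomial.map_mul,
      Polynomial.map_pow, map_C, map_X, ← smul_eq_C_mul, ← Algebra.smul_def]
    rw [← map_smul]
    congr 1
    rw [smul_eq_C_mul]
    ext i j
    simp only [coeff_C_mul, coeff_smul, coeff_X_pow]
    split_ifs <;> simp

section Primitive

variable {ζ W : ℂ[X]}

theorem eval_primitive (hW : W - W.comp (X - 1) = X * ζ.comp (X ^ 2)) (n : ℤ) :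
    (W.map C).eval (latC n) - (W.map C).eval (latC n - 1) =
    latC n * (ζ.map C).eval (latC n ^ 2) := by
  have := congrArg (fun p : ℂ[X] => (p.map C).eval (latC n)) hW
  simpa [map_comp, eval_comp] using this

/-- The primitive `W` is symmetric about `- 1 / 2`, so that `W(X) + W(X - 1)` is even. -/
theorem exists_even_primitive (hW : W - W.comp (X - 1) = X * ζ.comp (X ^ 2)) :
    ∃ r : ℂ[X], r.comp (X ^ 2) = C (1 / 2) * (W + W.comp (X - 1)) := by
  have hW' : ∀ q : ℂ[X], W.comp q - W.comp (q - 1) = q * ζ.comp (q ^ 2) := by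
    intro q
    have := congrArg (fun p : ℂ[X] => p.comp q) hW
    simpa only [sub_comp, mul_comp, comp_assoc, X_comp, pow_comp, one_comp] using this
  have h1 : (W.comp (-1 - X) - W).comp (X + 1) = W.comp (-1 - X) - W := by
    have h2 := hW' (-1 - X)
    have h3 := hW' (X + 1)
    rw [add_sub_cancel_right, comp_X] at h3
    rw [show (-1 - X : ℂ[X]) ^ 2 = (X + 1) ^ 2 by ring] at h2
    simp only [sub_comp, comp_assoc, X_comp, neg_comp, one_comp]
    rw [show (-1 - (X + 1) : ℂ[X]) = -1 - X - 1 by ring]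
    linear_combination -h2 - h3
  have h2 : W.comp (-1 - X) = W := by
    have h3 := eq_C_of_periodic h1
    have h4 : (W.comp (-1 - X) - W).eval (-1 / 2) = 0 := by
      simp only [eval_sub, eval_comp, eval_X, eval_neg, eval_one]
      norm_num
    rw [h3, eval_C] at h4
    rwa [h4, C_0, sub_eq_zero] at h3
  obtain ⟨r, hr⟩ := eq_comp_sq_of_even (P := C (1 / 2) * (W + W.comp (X - 1))) (by
    have h3 := congrArg (fun p : ℂ[X] => p.comp (-X)) h2
    have h4 := congrArg (fun p : ℂ[X] => p.comp (X - 1)) h2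
    simp only [comp_assoc, sub_comp, X_comp, neg_comp, one_comp] at h3 h4
    rw [show (-1 - -X : ℂ[X]) = X - 1 by ring] at h3
    rw [show (-1 - (X - 1) : ℂ[X]) = -X by ring] at h4
    rw [mul_comp, C_comp, add_comp, comp_assoc, sub_comp, X_comp, one_comp, ← h3,
      show (-X - 1 : ℂ[X]) = -1 - X by ring, h2]
    ring)
  exact ⟨r, hr.symm⟩

/-- For the coefficients `latPsi W` the commutator of `x` and `y` is `ζ(c²)`, since
`c ζ(c²) = W(c) - W(c - 1)`. -/
theorem latX_latY_comm_latPsi (hW : W - W.comp (X - 1) = X * ζ.comp (X ^ 2)) :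
    latX (latPsi W) 1 * latY (latPsi W) 1 -
    latY (latPsi W) 1 * latX (latPsi W) 1 = latInv (ζ.map C) := by
  rw [latX_latY_comm, latInv_apply]
  congr 1
  ext1 n
  refine mul_left_cancel₀ (latC_ne_zero n) ?_
  linear_combination latC_mul_latPsi_add_one W n - latC_mul_latPsi W n + eval_primitive hW n

/-- The pairing of the two basic covariants recovers the variable `T`, up to a polynomial in the
Casimir element. -/
theorem latX_latY_wedge_latPsi {r : ℂ[X]}
    (hr : r.comp (X ^ 2) = C (1 / 2) * (W + W.comp (X - 1))) :
    latX (latPsi W) X * latY (latPsi W) 1 - latY (latPsi W) X * latX (latPsi W) 1 =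
      (-2 : ℂ) • latInv (C X + r.map C) := by
  rw [latX_latY_wedge, latInv_apply, ← latDiag_smul]
  congr 1
  ext1 n
  have h1 := congrArg (fun p : ℂ[X] => (p.map C).eval (latC n)) hr
  simp only [map_comp, eval_comp, Polynomial.map_mul, Polynomial.map_add, Polynomial.map_pow,
    Polynomial.map_sub, map_X, map_C, Polynomial.map_one, eval_mul, eval_add, eval_sub, eval_pow,
    eval_X, eval_C, eval_one] at h1
  simp only [Pi.smul_apply, eval_add, eval_C, eval_X, h1, smul_eq_C_mul, map_neg, map_ofNat]
  linear_combination -latC_mul_latPsi_add_one W n - latC_mul_latPsi W n +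
    ((W.map C).eval (latC n) + (W.map C).eval (latC n - 1)) * latHalf

end Primitive

variable {A : Type*} [Ring A] [Algebra ℂ A] {s : Sl2Plane A}

theorem aeval_cas_mem {d n : ℕ} (p : ℂ[X]) (hp : 2 * p.natDegree < n) :
    aeval s.cas p ∈ s.fil d n 0 := by
  rw [aeval_eq_sum_range]
  refine Submodule.sum_mem _ fun i hi => Submodule.smul_mem _ _ ?_
  have := cas_pow_mul_mem (one_mem_fil (s := s) (d := d)) i
  rw [mul_one] at this
  rw [Finset.mem_range] at hi
  exact fil_mono (by omega) _ this

/-- If `[x, y] = ζ(Δ)` and the operators on the lattice satisfying this relation define a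
representation of `A`, then `A` has a lattice model. -/
theorem exists_latModel (ζ W : ℂ[X]) (hW : W - W.comp (X - 1) = X * ζ.comp (X ^ 2))
    (hxy : s.gen x * s.gen y - s.gen y * s.gen x = aeval s.cas ζ)
    (hρ : ∀ ψ, latX ψ 1 * latY ψ 1 - latY ψ 1 * latX ψ 1 = aeval (latInv X) ζ →
      ∃ ρ : A →ₐ[ℂ] Module.End ℂ LatFun, ρ (s.gen e) = latE ∧ ρ (s.gen f) = latF ∧
        ρ (s.gen h) = latH ∧ ρ (s.gen x) = latX ψ 1 ∧ ρ (s.gen y) = latY ψ 1) :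
    ∃ d, ∃ M : LatModel s d, M.ψ = latPsi W := by
  obtain ⟨r, hr⟩ := exists_even_primitive hW
  obtain ⟨ρ, he, hf, hh, hx, hy⟩ := hρ (latPsi W) (by
    rw [latX_latY_comm_latPsi hW, latInv_map_C])
  -- large enough for `[x, y] = ζ(Δ)` and for the correction term `r(Δ)` of `t`
  let d := r.natDegree + ζ.natDegree + 1
  have hs : s.IsFiltered d := ⟨by omega, by
    rw [hxy]
    exact aeval_cas_mem ζ (by omega)⟩
  have hc : ρ s.cas = latInv X := LatModel.ρ_cas_of he hf hh
  have hxc : ρ s.xCas = latX (latPsi W) X := LatModel.ρ_xCas_of hc hx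
  have hyc : ρ s.yCas = latY (latPsi W) X := by
    rw [← adOp_f_xCas, adOp_apply, map_sub, map_mul, map_mul, hf, hxc, latF_latX]
  refine ⟨d, ⟨hs, latPsi W, ρ, he, hf, hh, hx, hy,
    (-1 / 2 : ℂ) • (s.xCas * s.gen y - s.yCas * s.gen x) - aeval s.cas r, ?_, ?_, ?_, ?_⟩, rfl⟩
  · refine Submodule.sub_mem _ (Submodule.smul_mem _ _ (Submodule.sub_mem _ ?_ ?_)) ?_
    · have h1 := mul_mem (m := d + 1) (n := d) (xCas_mem hs) (gen_mem (s := s) (d := d) y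
        (by simp [deg]) rfl)
      rw [show 1 + y.wt = 0 from rfl] at h1
      exact fil_mono (by omega) _ h1
    · have h1 := mul_mem (m := d + 1) (n := d) (yCas_mem hs) (gen_mem (s := s) (d := d) x
        (by simp [deg]) rfl)
      rw [show -1 + x.wt = 0 from rfl] at h1
      exact fil_mono (by omega) _ h1
    · exact aeval_cas_mem r (by omega)
  · refine adOp_eq_zero_iff.1 ?_
    rw [map_sub, map_smul, map_sub, adOp_mul, adOp_mul, adOp_e_xCas, adOp_e_yCas, adOp_e_x,
      adOp_e_y, adOp_eq_zero_iff.2 (commute_e_cas.symm.aeval_left r).symm]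
    simp
  · refine adOp_eq_zero_iff.1 ?_
    rw [map_sub, map_smul, map_sub, adOp_mul, adOp_mul, adOp_f_xCas, adOp_f_yCas, adOp_f_x,
      adOp_f_y, adOp_eq_zero_iff.2 (commute_f_cas.symm.aeval_left r).symm]
    simp
  · rw [map_sub, map_smul, map_sub, map_mul, map_mul, hxc, hyc, hx, hy,
      latX_latY_wedge_latPsi hr, smul_smul, ← aeval_algHom_apply, hc, ← latInv_map_C, ← map_smul,
      ← map_sub]
    congr 1
    norm_num

end

noncomputable section

open Gen Polynomial Sl2Plane

/-! ### Derivations of an algebra with a lattice model -/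

section Derivations

variable {A : Type*} [Ring A] [Algebra ℂ A] {s : Sl2Plane A} {d : ℕ}

theorem IsDerivationMap.map_one {D : A →ₗ[ℂ] A} (hD : IsDerivationMap D) : D 1 = 0 := by
  have := hD 1 1
  simpa using this

theorem IsDerivationMap.map_adOp {D : A →ₗ[ℂ] A} (hD : IsDerivationMap D) {a : A} (ha : D a = 0)
    (b : A) : D (adOp a b) = adOp a (D b) := by
  rw [adOp_apply, adOp_apply, map_sub, hD, hD, ha, zero_mul, mul_zero, zero_add, add_zero]

theorem IsDerivationMap.sub {D D' : A →ₗ[ℂ] A} (hD : IsDerivationMap D)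
    (hD' : IsDerivationMap D') : IsDerivationMap (D - D') := by
  intro a b
  simp only [LinearMap.sub_apply, hD a b, hD' a b]
  noncomm_ring

theorem isDerivationMap_adOp (a : A) : IsDerivationMap (adOp a) := fun b c => adOp_mul a b c

theorem IsDerivationMap.map_aeval {D : A →ₗ[ℂ] A} (hD : IsDerivationMap D) {a : A} (ha : D a = 0)
    (p : ℂ[X]) : D (aeval a p) = 0 := by
  have h : ∀ n, D (a ^ n) = 0 := by
    intro n
    induction n with
    | zero => rw [pow_zero, hD.map_one]
    | succ n ih => rw [pow_succ, hD, ih, ha, zero_mul, mul_zero, add_zero]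
  rw [aeval_eq_sum_range, map_sum]
  exact Finset.sum_eq_zero fun i _ => by rw [map_smul, h, smul_zero]

namespace Sl2Plane

/-- A derivation is determined by its values on the generators. -/
theorem derivation_eq_zero {D : A →ₗ[ℂ] A} (hD : IsDerivationMap D) (h : ∀ i, D (s.gen i) = 0) :
    D = 0 := by
  refine LinearMap.ext fun a => ?_
  have ha : a ∈ Algebra.adjoin ℂ (Set.range s.gen) := s.adjoin_eq_top ▸ Algebra.mem_top
  induction ha using Algebra.adjoin_induction with
  | mem x hx => obtain ⟨i, rfl⟩ := hx; exact h i
  | algebraMap r => rw [Algebra.algebraMap_eq_smul_one, map_smul, hD.map_one, smul_zero]; rfl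
  | add x y _ _ hx hy => rw [map_add, hx, hy, map_add]
  | mul x y _ _ hx hy => rw [hD, hx, hy]; simp

theorem derivation_ext {D D' : A →ₗ[ℂ] A} (hD : IsDerivationMap D) (hD' : IsDerivationMap D')
    (h : ∀ i, D (s.gen i) = D' (s.gen i)) : D = D' :=
  sub_eq_zero.1 (derivation_eq_zero (hD.sub hD') fun i => by rw [LinearMap.sub_apply, h, sub_self])

theorem commute_of_gen {a : A} (h : ∀ i, Commute a (s.gen i)) (b : A) : Commute a b := by
  rw [← adOp_eq_zero_iff,
    derivation_eq_zero (s := s) (isDerivationMap_adOp a) fun i => adOp_eq_zero_iff.2 (h i)]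
  rfl

end Sl2Plane

namespace LatModel

variable (M : LatModel s d)

/-- Covariants are determined by their highest weight component, on which `ρ` is injective. -/
theorem eq_of_covariant {p p' : A} (he : adOp (s.gen e) p = 0) (hh : adOp (s.gen h) p = p)
    (he' : adOp (s.gen e) p' = 0) (hh' : adOp (s.gen h) p' = p') (h : M.ρ p = M.ρ p') :
    p = p' :=
  sub_eq_zero.1 (M.eq_zero_of_covariant (by rw [map_sub, he, he', sub_self])
    (by rw [map_sub, hh, hh']) (by rw [map_sub, h, sub_self]))

/-- An element commuting with `e`, `f`, `h` that acts by a polynomial in `T` alone is central. -/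
theorem commute_of_ρ_eq_C {k : A} (he : Commute (s.gen e) k) (hf : Commute (s.gen f) k)
    (hh : Commute (s.gen h) k) {σ : ℂ[X]} (hk : M.ρ k = latInv (C σ)) (a : A) : Commute k a := by
  have hx : k * s.gen x = s.gen x * k := by
    refine M.eq_of_covariant ?_ ?_ ?_ ?_ ?_
    · rw [adOp_mul_of_commute he, adOp_e_x, mul_zero]
    · rw [adOp_mul_of_commute hh, adOp_h_x]
    · rw [adOp_mul, adOp_e_x, adOp_eq_zero_iff.2 he, mul_zero, zero_mul, add_zero]
    · rw [adOp_mul, adOp_h_x, adOp_eq_zero_iff.2 hh, mul_zero, add_zero]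
    · rw [map_mul, map_mul, hk, M.ρ_x, latInv_mul_latX, latX_mul_latInv, C_comp, C_comp]
  have hy : k * s.gen y = s.gen y * k := by
    have := congrArg (adOp (s.gen f)) hx
    rwa [adOp_mul_of_commute hf, adOp_mul, adOp_eq_zero_iff.2 hf, adOp_f_x, mul_zero,
      add_zero] at this
  refine commute_of_gen (s := s) (fun i => ?_) a
  cases i
  exacts [he.symm, hf.symm, hh.symm, hx, hy]

variable {M} {ζ W : ℂ[X]}

/-- The functional equation for the polynomial `P` attached to the values of a derivation on `x`,
`y`. It says that `(T + W(X - 1)) (P(X) + P(1 - X))` is periodic, hence of degree zero in `X`; if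
`W` is not constant, this forces `P(X) + P(1 - X)` to vanish. -/
theorem exists_C_of_bracket (hψ : M.ψ = latPsi W) (hW : W - W.comp (X - 1) = X * ζ.comp (X ^ 2))
    {P : ℂ[X][X]} (hP : latX M.ψ P * latY M.ψ 1 - latY M.ψ 1 * latX M.ψ P +
      (latX M.ψ 1 * latY M.ψ P - latY M.ψ P * latX M.ψ 1) = 0) :
    ∃ σ : ℂ[X], P + P.comp (1 - X) = C σ ∧ (ζ ≠ 0 → σ = 0) := by
  set S := P + P.comp (1 - X) with hS
  set L : ℂ[X][X] := C X + (W.map C).comp (X - 1) with hL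
  have hper : (L * S).comp (X + 1) = L * S := by
    rw [← sub_eq_zero]
    refine eq_zero_of_eval_latC fun n => ?_
    have h1 := latDiag_eq_zero (latX_latY_bracket M.ψ P ▸ hP) n
    rw [hψ] at h1
    have h2 := latC_mul_latPsi_add_one W n
    have h3 := latC_mul_latPsi W n
    simp only [hS, hL, eval_sub, eval_mul, eval_comp, eval_add, eval_X, eval_one, eval_C,
      add_sub_cancel_right]
    rw [show 1 - (latC n + 1) = -latC n by ring]
    linear_combination latC n * h1 - h2 * (P.eval (latC n + 1) + P.eval (-latC n)) +
      h3 * (P.eval (latC n) + P.eval (1 - latC n))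
  have hC := eq_C_of_periodic hper
  by_cases hS0 : S = 0
  · exact ⟨0, by rw [hS0, C_0], fun _ => rfl⟩
  have hL0 : L ≠ 0 := by
    intro h0
    have := congrArg (fun Q : ℂ[X][X] => (Q.eval 1).coeff 1) h0
    simp [hL, eval_comp] at this
  have hdeg : L.natDegree + S.natDegree = 0 := by
    rw [← natDegree_mul hL0 hS0, hC, natDegree_C]
  obtain ⟨σ, hσ⟩ := natDegree_eq_zero.1 (Nat.add_eq_zero_iff.1 hdeg).2
  refine ⟨σ, hσ.symm, fun hζ => absurd ?_ hζ⟩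
  have hWd : W.natDegree = 0 := by
    have h1 : ((W.map C).comp (X - 1) : ℂ[X][X]).natDegree = 0 := by
      have := (Nat.add_eq_zero_iff.1 hdeg).1
      rwa [hL, natDegree_C_add] at this
    rwa [natDegree_comp, natDegree_map_eq_of_injective C_injective,
      ← C_1, natDegree_X_sub_C, mul_one] at h1
  obtain ⟨w, rfl⟩ := natDegree_eq_zero.1 hWd
  rw [C_comp, sub_self, eq_comm, mul_eq_zero, ← expand_eq_comp_X_pow, expand_eq_zero two_pos] at hW
  exact hW.resolve_left X_ne_zero

/-- Up to an inner derivation, every derivation is a central multiple of the one that kills `e`,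
`f`, `h` and fixes `x`, `y`, and it is inner if `[x, y] ≠ 0`. -/
theorem exists_inner_add (hψ : M.ψ = latPsi W) (hW : W - W.comp (X - 1) = X * ζ.comp (X ^ 2))
    (hxy : s.gen x * s.gen y - s.gen y * s.gen x = aeval s.cas ζ) {D : A →ₗ[ℂ] A}
    (hD : IsDerivationMap D) : ∃ g k, (∀ a, Commute k a) ∧ (ζ ≠ 0 → k = 0) ∧
      (∀ i, i ≠ x → i ≠ y → D (s.gen i) = adOp g (s.gen i)) ∧
      (∀ i, i = x ∨ i = y → D (s.gen i) = adOp g (s.gen i) + k * s.gen i) := by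
  -- `D'` kills `e`, `f`, `h`, so that its values on `x` and `y` form a covariant
  obtain ⟨m, hme, hmf, hmh⟩ := exists_inner_on_sl2 s D hD
  set D' := D - adOp m with hD'
  have hder : IsDerivationMap D' := hD.sub (isDerivationMap_adOp m)
  have h_e : D' (s.gen e) = 0 := by rw [hD', LinearMap.sub_apply, hme, sub_self]
  have h_f : D' (s.gen f) = 0 := by rw [hD', LinearMap.sub_apply, hmf, sub_self]
  have h_h : D' (s.gen h) = 0 := by rw [hD', LinearMap.sub_apply, hmh, sub_self]
  have hcas : D' s.cas = 0 := by
    simp only [cas, map_add, map_smul, hder _ _, h_e, h_f, h_h, hder.map_one]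
    simp
  have hq : D' (s.gen y) = adOp (s.gen f) (D' (s.gen x)) := by
    rw [← hder.map_adOp h_f, adOp_f_x]
  have hpe : adOp (s.gen e) (D' (s.gen x)) = 0 := by
    rw [← hder.map_adOp h_e, adOp_e_x, map_zero]
  have hph : adOp (s.gen h) (D' (s.gen x)) = D' (s.gen x) := by
    rw [← hder.map_adOp h_h, adOp_h_x]
  obtain ⟨P, hP⟩ := M.exists_latX hpe hph
  have hQ : M.ρ (D' (s.gen y)) = latY M.ψ P := by
    rw [hq, adOp_apply, map_sub, map_mul, map_mul, M.ρ_f, hP, latF_latX]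
  have hbr := congrArg (fun a => M.ρ (D' a)) hxy
  simp only [hder.map_aeval hcas, map_sub, hder _ _, map_add, map_mul, hP, hQ, M.ρ_x, M.ρ_y,
    map_zero] at hbr
  obtain ⟨σ, hσ, hσ0⟩ := exists_C_of_bracket hψ hW (P := P) (by rw [← hbr]; noncomm_ring)
  -- the antisymmetric part of `P` comes from an inner derivation, the symmetric part from `E`
  obtain ⟨G, hG⟩ := exists_even_sub_comp (P := P - C ((1 / 2 : ℂ) • σ)) (by
    rw [sub_comp, C_comp]
    have : (C σ : ℂ[X][X]) = C ((1 / 2 : ℂ) • σ) + C ((1 / 2 : ℂ) • σ) := by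
      rw [← C_add, ← add_smul]; norm_num
    linear_combination hσ + this)
  obtain ⟨g, hge, hgf, hgh, hg⟩ := M.exists_invariant G
  obtain ⟨k, hke, hkf, hkh, hk⟩ := M.exists_invariant (C ((1 / 2 : ℂ) • σ))
  have hx : D' (s.gen x) = adOp g (s.gen x) + k * s.gen x := by
    refine M.eq_of_covariant hpe hph ?_ ?_ ?_
    · rw [map_add, adOp_adOp_of_commute hge, adOp_mul_of_commute hke, adOp_e_x, map_zero,
        mul_zero, add_zero]
    · rw [map_add, adOp_adOp_of_commute hgh, adOp_mul_of_commute hkh, adOp_h_x]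
    · rw [hP, adOp_apply, map_add, map_sub, map_mul, map_mul, map_mul, hg, hk, M.ρ_x,
        latInv_mul_latX, latX_mul_latInv, latInv_mul_latX, ← map_sub, ← map_add]
      congr 1
      rw [C_comp]
      linear_combination -hG
  refine ⟨m + g, k, M.commute_of_ρ_eq_C hke hkf hkh hk, fun hζ => ?_, fun i hi hi' => ?_, ?_⟩
  · refine M.eq_zero_of_invariant hke hkh ?_
    rw [hk, hσ0 hζ, smul_zero, C_0, map_zero]
  · rw [adOp_add]
    cases i
    · rw [LinearMap.add_apply, hme, adOp_eq_zero_iff.2 hge.symm, add_zero]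
    · rw [LinearMap.add_apply, hmf, adOp_eq_zero_iff.2 hgf.symm, add_zero]
    · rw [LinearMap.add_apply, hmh, adOp_eq_zero_iff.2 hgh.symm, add_zero]
    · exact absurd rfl hi
    · exact absurd rfl hi'
  · have hDD : ∀ a, D a = adOp m a + D' a := fun a => by
      rw [hD', LinearMap.sub_apply, add_sub_cancel]
    rintro _ (rfl | rfl)
    · rw [hDD, hx, adOp_add, LinearMap.add_apply, add_assoc]
    · rw [hDD, hq, hx, map_add, adOp_adOp_of_commute hgf, adOp_mul_of_commute hkf, adOp_f_x,
        adOp_add, LinearMap.add_apply, add_assoc]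

/-- A central multiple `k E` of the Euler derivation is inner only for `k = 0`. -/
theorem eq_zero_of_inner (M : LatModel s d) {g k : A} (hk : ∀ a, Commute k a)
    (he : Commute (s.gen e) g)
    (hh : Commute (s.gen h) g) (hx : adOp g (s.gen x) = k * s.gen x) : k = 0 := by
  obtain ⟨Z, hZ⟩ := M.exists_latInv (hk _).symm (hk _).symm
  obtain ⟨G, hG⟩ := M.exists_latInv he hh
  have h1 : Z.comp (X ^ 2) = Z.comp ((X - 1) ^ 2) := by
    have := congrArg M.ρ (hk (s.gen x)).eq
    rw [map_mul, map_mul, hZ, M.ρ_x, latInv_mul_latX, latX_mul_latInv] at this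
    simpa using latX_injective _ this
  have h2 : G.comp (X ^ 2) - G.comp ((X - 1) ^ 2) = Z.comp (X ^ 2) := by
    have := congrArg M.ρ hx
    rw [adOp_apply, map_sub, map_mul, map_mul, map_mul, hZ, hG, M.ρ_x, latInv_mul_latX,
      latX_mul_latInv, latInv_mul_latX, ← map_sub] at this
    simpa using latX_injective _ this
  -- the substitution `X ↦ 1 - X` changes the sign of the left side and not that of the right
  have h3 := congrArg (fun Q : ℂ[X][X] => Q.comp (1 - X)) h2
  simp only [sub_comp, comp_assoc, pow_comp, X_comp, one_comp] at h3
  rw [show ((1 - X) ^ 2 : ℂ[X][X]) = (X - 1) ^ 2 by ring,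
    show ((1 - X - 1) ^ 2 : ℂ[X][X]) = X ^ 2 by ring, ← h1] at h3
  have h4 : (2 : ℂ[X][X]) * Z.comp (X ^ 2) = 0 := by linear_combination -h2 - h3
  rw [mul_eq_zero, ← expand_eq_comp_X_pow, expand_eq_zero two_pos] at h4
  refine M.eq_zero_of_invariant (hk _).symm (hk _).symm ?_
  rw [hZ, h4.resolve_left two_ne_zero, map_zero]

end LatModel

end Derivations

end

noncomputable section

/-! ### Generators of `𝔰𝔩₂` and of its standard representation -/

namespace SL2

/-- The matrix unit `e`. -/
protected def e : SL2 := ⟨!![0, 1; 0, 0], by simp [sl, Matrix.trace_fin_two]⟩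

/-- The matrix unit `f`. -/
protected def f : SL2 := ⟨!![0, 0; 1, 0], by simp [sl, Matrix.trace_fin_two]⟩

/-- The diagonal matrix `h`. -/
protected def h : SL2 := ⟨!![1, 0; 0, -1], by simp [sl, Matrix.trace_fin_two]⟩

theorem one_one (a : SL2) : a.1 1 1 = -a.1 0 0 := by
  have := a.2
  simp only [sl, LieSubalgebra.mem_mk_iff'] at this
  have h : Matrix.trace a.1 = 0 := this
  rw [Matrix.trace_fin_two] at h
  linear_combination h

theorem eq_sum (a : SL2) : a = a.1 0 1 • SL2.e + a.1 1 0 • SL2.f + a.1 0 0 • SL2.h := by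
  refine Subtype.ext (Matrix.ext fun i j => ?_)
  fin_cases i <;> fin_cases j <;> simp [SL2.e, SL2.f, SL2.h, one_one a]

theorem lie_apply (a b : SL2) (i j : Fin 2) : (⁅a, b⁆ : SL2).1 i j =
    a.1 i 0 * b.1 0 j + a.1 i 1 * b.1 1 j - (b.1 i 0 * a.1 0 j + b.1 i 1 * a.1 1 j) := by
  rw [sl_bracket]
  simp [Matrix.mul_apply, Fin.sum_univ_two]

theorem lie_h_e : ⁅SL2.h, SL2.e⁆ = (2 : ℂ) • SL2.e := by
  refine Subtype.ext (Matrix.ext fun i j => ?_)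
  rw [lie_apply]
  fin_cases i <;> fin_cases j <;> simp [SL2.e, SL2.h]
  norm_num

theorem lie_h_f : ⁅SL2.h, SL2.f⁆ = (-2 : ℂ) • SL2.f := by
  refine Subtype.ext (Matrix.ext fun i j => ?_)
  rw [lie_apply]
  fin_cases i <;> fin_cases j <;> simp [SL2.f, SL2.h]
  norm_num

theorem lie_e_f : ⁅SL2.e, SL2.f⁆ = SL2.h := by
  refine Subtype.ext (Matrix.ext fun i j => ?_)
  rw [lie_apply]
  fin_cases i <;> fin_cases j <;> simp [SL2.e, SL2.f, SL2.h]

variable {B : Type*} [Ring B] [Algebra ℂ B]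

/-- The linear map on `𝔰𝔩₂` with prescribed values on `e`, `f`, `h`. -/
def toLin (E F H : B) : SL2 →ₗ[ℂ] B where
  toFun a := a.1 0 1 • E + a.1 1 0 • F + a.1 0 0 • H
  map_add' a b := by
    change (a.1 0 1 + b.1 0 1) • E + (a.1 1 0 + b.1 1 0) • F + (a.1 0 0 + b.1 0 0) • H = _
    module
  map_smul' c a := by
    change (c * a.1 0 1) • E + (c * a.1 1 0) • F + (c * a.1 0 0) • H = _
    rw [RingHom.id_apply]
    module

theorem toLin_apply (E F H : B) (a : SL2) :
    toLin E F H a = a.1 0 1 • E + a.1 1 0 • F + a.1 0 0 • H := rfl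

theorem toLin_e (E F H : B) : toLin E F H SL2.e = E := by simp [toLin_apply, SL2.e]
theorem toLin_f (E F H : B) : toLin E F H SL2.f = F := by simp [toLin_apply, SL2.f]
theorem toLin_h (E F H : B) : toLin E F H SL2.h = H := by simp [toLin_apply, SL2.h]

theorem toLin_lie {E F H : B} (hE : H * E - E * H = (2 : ℂ) • E)
    (hF : H * F - F * H = (-2 : ℂ) • F) (hEF : E * F - F * E = H) (a b : SL2) :
    toLin E F H ⁅a, b⁆ = toLin E F H a * toLin E F H b - toLin E F H b * toLin E F H a := by
  have hE' := eq_add_of_sub_eq hE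
  have hF' := eq_add_of_sub_eq hF
  have hEF' := eq_add_of_sub_eq hEF
  simp only [toLin_apply, lie_apply, one_one, add_mul, mul_add, smul_mul_smul_comm, hE', hF', hEF']
  module

end SL2

namespace StdRep

theorem act_x_eq (a : SL2) : act a x = a.1 0 0 • x + a.1 1 0 • y := by
  refine funext fun i => ?_
  change Matrix.mulVec a.1 ![1, 0] i = a.1 0 0 * (![1, 0] : Fin 2 → ℂ) i +
    a.1 1 0 * (![0, 1] : Fin 2 → ℂ) i
  fin_cases i <;> simp [Matrix.mulVec, dotProduct]

theorem act_y_eq (a : SL2) : act a y = a.1 0 1 • x - a.1 0 0 • y := by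
  refine funext fun i => ?_
  change Matrix.mulVec a.1 ![0, 1] i = a.1 0 1 * (![1, 0] : Fin 2 → ℂ) i -
    a.1 0 0 * (![0, 1] : Fin 2 → ℂ) i
  fin_cases i <;> simp [Matrix.mulVec, dotProduct, SL2.one_one a]

/-- The coordinates with respect to `x`, `y`. -/
def coord (i : Fin 2) : StdRep →ₗ[ℂ] ℂ := LinearMap.proj (R := ℂ) (φ := fun _ : Fin 2 => ℂ) i

theorem eq_sum (v : StdRep) : v = coord 0 v • x + coord 1 v • y := by
  refine funext fun i => ?_
  change (v : Fin 2 → ℂ) i = (v : Fin 2 → ℂ) 0 * (![1, 0] : Fin 2 → ℂ) i +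
    (v : Fin 2 → ℂ) 1 * (![0, 1] : Fin 2 → ℂ) i
  fin_cases i <;> simp

variable {B : Type*} [Ring B] [Algebra ℂ B]

/-- The linear map on `V` with prescribed values on `x`, `y`. -/
def toLin (S T : B) : StdRep →ₗ[ℂ] B :=
  (coord 0).smulRight S + (coord 1).smulRight T

theorem toLin_x (S T : B) : toLin S T x = S := by
  change (1 : ℂ) • S + (0 : ℂ) • T = S
  simp

theorem toLin_y (S T : B) : toLin S T y = T := by
  change (0 : ℂ) • S + (1 : ℂ) • T = T
  simp

end StdRep

/-- The relations `a v - v a = a · v` follow from those for basis elements. -/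
theorem act_relation_of_basis {B : Type*} [Ring B] [Algebra ℂ B] (g : SL2 →ₗ[ℂ] B)
    (v : StdRep →ₗ[ℂ] B)
    (hex : g SL2.e * v StdRep.x - v StdRep.x * g SL2.e = 0)
    (hey : g SL2.e * v StdRep.y - v StdRep.y * g SL2.e = v StdRep.x)
    (hfx : g SL2.f * v StdRep.x - v StdRep.x * g SL2.f = v StdRep.y)
    (hfy : g SL2.f * v StdRep.y - v StdRep.y * g SL2.f = 0)
    (hhx : g SL2.h * v StdRep.x - v StdRep.x * g SL2.h = v StdRep.x)
    (hhy : g SL2.h * v StdRep.y - v StdRep.y * g SL2.h = -v StdRep.y) (a : SL2) (w : StdRep) :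
    g a * v w = v w * g a + v (StdRep.act a w) := by
  have h1 := eq_add_of_sub_eq hex
  have h2 := eq_add_of_sub_eq hey
  have h3 := eq_add_of_sub_eq hfx
  have h4 := eq_add_of_sub_eq hfy
  have h5 := eq_add_of_sub_eq hhx
  have h6 := eq_add_of_sub_eq hhy
  have ha : g a = a.1 0 1 • g SL2.e + a.1 1 0 • g SL2.f + a.1 0 0 • g SL2.h := by
    conv_lhs => rw [SL2.eq_sum a]
    simp only [map_add, map_smul]
  have hw : v w = StdRep.coord 0 w • v StdRep.x + StdRep.coord 1 w • v StdRep.y := by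
    conv_lhs => rw [StdRep.eq_sum w]
    simp only [map_add, map_smul]
  have haw : v (StdRep.act a w) =
      StdRep.coord 0 w • (a.1 0 0 • v StdRep.x + a.1 1 0 • v StdRep.y) +
      StdRep.coord 1 w • (a.1 0 1 • v StdRep.x - a.1 0 0 • v StdRep.y) := by
    conv_lhs => rw [StdRep.eq_sum w]
    simp only [map_add, map_smul, map_sub, StdRep.act_x_eq, StdRep.act_y_eq]
  rw [haw, ha, hw]
  simp only [add_mul, mul_add, smul_mul_smul_comm, h1, h2, h3, h4, h5, h6]
  module

/-! ### Universal properties -/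

section Lift

variable {B : Type*} [Ring B] [Algebra ℂ B]

namespace UniversalEnvelopingAlgebra

variable {L : Type*} [LieRing L] [LieAlgebra ℂ L]

attribute [local instance 100] LieRing.ofAssociativeRing in
theorem ι_lie (a b : L) : ι ℂ ⁅a, b⁆ = ι ℂ a * ι ℂ b - ι ℂ b * ι ℂ a := LieHom.map_lie (ι ℂ) a b

attribute [local instance 100] LieRing.ofAssociativeRing in
/-- The universal property of the enveloping algebra, for linear maps compatible with
commutators. -/
def liftLin (g : L →ₗ[ℂ] B) (hg : ∀ a b, g ⁅a, b⁆ = g a * g b - g b * g a) :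
    UniversalEnvelopingAlgebra ℂ L →ₐ[ℂ] B :=
  lift ℂ { g with map_lie' := fun {a b} => hg a b }

theorem liftLin_ι (g : L →ₗ[ℂ] B) (hg : ∀ a b, g ⁅a, b⁆ = g a * g b - g b * g a) (a : L) :
    liftLin g hg (ι ℂ a) = g a :=
  lift_ι_apply ℂ _ a

attribute [local instance 100] LieRing.ofAssociativeRing in
theorem algHom_ext {F G : UniversalEnvelopingAlgebra ℂ L →ₐ[ℂ] B}
    (h : ∀ a, F (ι ℂ a) = G (ι ℂ a)) : F = G :=
  hom_ext ℂ (LieHom.ext h)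

theorem eq_top_of_ι_mem {S : Subalgebra ℂ (UniversalEnvelopingAlgebra ℂ L)}
    (h : ∀ a, ι ℂ a ∈ S) : S = ⊤ := by
  let g : L →ₗ[ℂ] S :=
    { toFun a := ⟨ι ℂ a, h a⟩
      map_add' a b := Subtype.ext (map_add (ι ℂ) a b)
      map_smul' c a := Subtype.ext (map_smul (ι ℂ) c a) }
  have hg : S.val.comp (liftLin g fun a b => Subtype.ext (ι_lie a b)) = AlgHom.id ℂ _ :=
    algHom_ext fun a => by
      rw [AlgHom.comp_apply, liftLin_ι]
      rfl
  rw [eq_top_iff]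
  intro a _
  rw [← AlgHom.id_apply (R := ℂ) a, ← hg]
  exact Subtype.property _

end UniversalEnvelopingAlgebra

namespace HeckeAlg

variable (z : USL2)

theorem ofSL2_eq (a : SL2) : ofSL2 z a = mk z (smashMk (TensorAlgebra.ι ℂ (a, 0))) := by
  rw [ofSL2, ofU, AlgHom.comp_apply]
  exact congrArg (mk z) (UniversalEnvelopingAlgebra.lift_ι_apply ℂ _ a)

theorem ofV_eq (v : StdRep) : ofV z v = mk z (smashMk (TensorAlgebra.ι ℂ (0, v))) := rfl

/-- The map `𝔰𝔩₂ → H_z` as a linear map. -/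
def ofSL2Lin : SL2 →ₗ[ℂ] HeckeAlg z :=
  (mk z).toLinearMap ∘ₗ smashGen ∘ₗ LinearMap.inl ℂ SL2 StdRep

theorem ofSL2Lin_apply (a : SL2) : ofSL2Lin z a = ofSL2 z a := (ofSL2_eq z a).symm

theorem ofSL2_lie (a b : SL2) : ofSL2 z ⁅a, b⁆ = ofSL2 z a * ofSL2 z b - ofSL2 z b * ofSL2 z a := by
  rw [ofSL2, UniversalEnvelopingAlgebra.ι_lie, map_sub, map_mul, map_mul]
  rfl

theorem ofSL2_mul_ofV (a : SL2) (v : StdRep) :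
    ofSL2 z a * ofV z v = ofV z v * ofSL2 z a + ofV z (StdRep.act a v) := by
  have h : smashMk _ = smashMk _ := RingQuot.mkAlgHom_rel ℂ (SmashRel.act a v)
  rw [map_add, map_mul, map_mul] at h
  rw [ofSL2_eq, ofV_eq, ofV_eq, ← map_mul, h, map_add, map_mul]

theorem ofV_x_mul_ofV_y : ofV z StdRep.x * ofV z StdRep.y =
    ofV z StdRep.y * ofV z StdRep.x + ofU z z := by
  have h : mk z _ = mk z _ := RingQuot.mkAlgHom_rel ℂ (Rel.comm (z := z))
  rwa [map_add, map_mul, map_mul] at h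

theorem adjoin_eq_top {S : Subalgebra ℂ (HeckeAlg z)} (h1 : ∀ a, ofSL2 z a ∈ S)
    (h2 : ∀ v, ofV z v ∈ S) : S = ⊤ := by
  have hsurj : Function.Surjective ((mk z).comp smashMk) := by
    rw [AlgHom.coe_comp]
    exact (RingQuot.mkAlgHom_surjective ℂ _).comp (RingQuot.mkAlgHom_surjective ℂ _)
  have h3 : Algebra.adjoin ℂ (Set.range (TensorAlgebra.ι ℂ (M := SL2 × StdRep))) ≤
      S.comap ((mk z).comp smashMk) := by
    rw [Algebra.adjoin_le_iff]
    rintro _ ⟨⟨a, v⟩, rfl⟩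
    have : ((mk z).comp smashMk) (TensorAlgebra.ι ℂ (a, v)) = ofSL2 z a + ofV z v := by
      rw [ofSL2_eq, ofV_eq, ← map_add, ← map_add, ← map_add, Prod.mk_add_mk, add_zero, zero_add]
      rfl
    change ((mk z).comp smashMk) (TensorAlgebra.ι ℂ (a, v)) ∈ S
    rw [this]
    exact S.add_mem (h1 a) (h2 v)
  rw [TensorAlgebra.adjoin_range_ι] at h3
  rw [eq_top_iff]
  intro b _
  obtain ⟨b, rfl⟩ := hsurj b
  exact h3 Algebra.mem_top

theorem algHom_ext {F G : HeckeAlg z →ₐ[ℂ] B} (h1 : ∀ a, F (ofSL2 z a) = G (ofSL2 z a))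
    (h2 : ∀ v, F (ofV z v) = G (ofV z v)) : F = G := by
  have := adjoin_eq_top z (S := AlgHom.equalizer F G) h1 h2
  exact AlgHom.ext fun a => (this ▸ Algebra.mem_top : a ∈ AlgHom.equalizer F G)

section

variable {z} (g : SL2 →ₗ[ℂ] B) (v : StdRep →ₗ[ℂ] B)
  (hg : ∀ a b, g ⁅a, b⁆ = g a * g b - g b * g a)
  (hv : ∀ a w, g a * v w = v w * g a + v (StdRep.act a w))

/-- The universal property of `U(𝔰𝔩₂) ⋉ T(V)`. -/
def smashLift : Smash →ₐ[ℂ] B :=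
  RingQuot.liftAlgHom ℂ ⟨TensorAlgebra.lift ℂ (g.coprod v), by
    rintro _ _ (⟨a, b⟩ | ⟨a, w⟩)
    · simp [hg]
    · simp [hv]⟩

theorem smashLift_smashGen (p : SL2 × StdRep) :
    smashLift g v hg hv (smashGen p) = g p.1 + v p.2 := by
  have : smashLift g v hg hv (smashMk (TensorAlgebra.ι ℂ p)) =
      TensorAlgebra.lift ℂ (g.coprod v) (TensorAlgebra.ι ℂ p) :=
    RingQuot.liftAlgHom_mkAlgHom_apply ℂ _ _ _
  rw [TensorAlgebra.lift_ι_apply] at this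
  exact this

theorem smashLift_comp_smashU : (smashLift g v hg hv).comp smashU =
    UniversalEnvelopingAlgebra.liftLin g hg :=
  UniversalEnvelopingAlgebra.algHom_ext fun a => by
    rw [UniversalEnvelopingAlgebra.liftLin_ι, AlgHom.comp_apply]
    refine (congrArg (smashLift g v hg hv)
      (UniversalEnvelopingAlgebra.lift_ι_apply ℂ _ a)).trans ?_
    refine (smashLift_smashGen g v hg hv (a, 0)).trans ?_
    rw [map_zero, add_zero]

variable (hz : v StdRep.x * v StdRep.y = v StdRep.y * v StdRep.x +
    UniversalEnvelopingAlgebra.liftLin g hg z)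

/-- The universal property of `H_z`. -/
def lift : HeckeAlg z →ₐ[ℂ] B :=
  RingQuot.liftAlgHom ℂ ⟨smashLift g v hg hv, by
    rintro _ _ ⟨⟩
    have h1 : ∀ w, smashLift g v hg hv (smashV w) = v w := fun w =>
      (smashLift_smashGen g v hg hv (0, w)).trans (by rw [map_zero, zero_add])
    rw [map_add, map_mul, map_mul, h1, h1, hz, ← smashLift_comp_smashU g v hg hv]
    rfl⟩

theorem lift_mk (a : Smash) : lift g v hg hv hz (mk z a) = smashLift g v hg hv a :=
  RingQuot.liftAlgHom_mkAlgHom_apply ℂ _ _ _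

theorem lift_ofSL2 (a : SL2) : lift g v hg hv hz (ofSL2 z a) = g a := by
  rw [ofSL2_eq, lift_mk]
  exact (smashLift_smashGen g v hg hv (a, 0)).trans (by rw [map_zero, add_zero])

theorem lift_ofV (w : StdRep) : lift g v hg hv hz (ofV z w) = v w := by
  rw [ofV_eq, lift_mk]
  exact (smashLift_smashGen g v hg hv (0, w)).trans (by rw [map_zero, zero_add])

end

end HeckeAlg

end Lift

end

noncomputable section

open Polynomial Gen Sl2Plane

/-! ### Hecke algebras have lattice models -/

namespace SL2

theorem lie_e_h : ⁅SL2.e, SL2.h⁆ = (-2 : ℂ) • SL2.e := by rw [← lie_skew, lie_h_e, neg_smul]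
theorem lie_f_h : ⁅SL2.f, SL2.h⁆ = (2 : ℂ) • SL2.f := by rw [← lie_skew, lie_h_f, neg_smul, neg_neg]
theorem lie_f_e : ⁅SL2.f, SL2.e⁆ = (-1 : ℂ) • SL2.h := by rw [← lie_skew, lie_e_f, neg_one_smul]

theorem act_e_x : StdRep.act SL2.e StdRep.x = 0 := by simp [StdRep.act_x_eq, SL2.e]
theorem act_e_y : StdRep.act SL2.e StdRep.y = StdRep.x := by simp [StdRep.act_y_eq, SL2.e]
theorem act_f_x : StdRep.act SL2.f StdRep.x = StdRep.y := by simp [StdRep.act_x_eq, SL2.f]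
theorem act_f_y : StdRep.act SL2.f StdRep.y = 0 := by simp [StdRep.act_y_eq, SL2.f]
theorem act_h_x : StdRep.act SL2.h StdRep.x = StdRep.x := by simp [StdRep.act_x_eq, SL2.h]
theorem act_h_y : StdRep.act SL2.h StdRep.y = -StdRep.y := by simp [StdRep.act_y_eq, SL2.h]

end SL2

/-- The generators attached to compatible images of `𝔰𝔩₂` and of `V`. -/
def Sl2Plane.ofLin {A : Type*} [Ring A] [Algebra ℂ A] (g : SL2 →ₗ[ℂ] A) (v : StdRep →ₗ[ℂ] A)
    (hg : ∀ a b, g ⁅a, b⁆ = g a * g b - g b * g a)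
    (hv : ∀ a w, g a * v w = v w * g a + v (StdRep.act a w))
    (htop : ∀ S : Subalgebra ℂ A, (∀ a, g a ∈ S) → (∀ w, v w ∈ S) → S = ⊤) : Sl2Plane A where
  gen
    | .e => g SL2.e
    | .f => g SL2.f
    | .h => g SL2.h
    | .x => v StdRep.x
    | .y => v StdRep.y
  lie_e i := by
    cases i <;> simp only [← hg, hv, Gen.coefE, Gen.tgtE, add_sub_cancel_left, SL2.lie_e_f,
      SL2.lie_e_h, SL2.act_e_x, SL2.act_e_y, lie_self, map_zero, zero_smul, one_smul, map_smul]
  lie_f i := by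
    cases i <;> simp only [← hg, hv, Gen.coefF, Gen.tgtF, add_sub_cancel_left, SL2.lie_f_e,
      SL2.lie_f_h, SL2.act_f_x, SL2.act_f_y, lie_self, map_zero, zero_smul, one_smul, map_smul]
  lie_h i := by
    cases i <;> simp only [← hg, hv, Gen.wt, add_sub_cancel_left, SL2.lie_h_e,
      SL2.lie_h_f, SL2.act_h_x, SL2.act_h_y, lie_self, map_zero, map_smul, map_neg, Int.cast_neg,
      Int.cast_ofNat, Int.cast_zero, Int.cast_one, zero_smul, one_smul, neg_smul]
  adjoin_eq_top := by
    refine htop _ (fun a => ?_) fun w => ?_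
    · rw [SL2.eq_sum a]
      simp only [map_add, map_smul]
      exact add_mem (add_mem
        (Subalgebra.smul_mem _ (Algebra.subset_adjoin (Set.mem_range_self Gen.e)) _)
        (Subalgebra.smul_mem _ (Algebra.subset_adjoin (Set.mem_range_self Gen.f)) _))
        (Subalgebra.smul_mem _ (Algebra.subset_adjoin (Set.mem_range_self Gen.h)) _)
    · rw [StdRep.eq_sum w]
      simp only [map_add, map_smul]
      exact add_mem (Subalgebra.smul_mem _ (Algebra.subset_adjoin (Set.mem_range_self Gen.x)) _)
        (Subalgebra.smul_mem _ (Algebra.subset_adjoin (Set.mem_range_self Gen.y)) _)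

namespace USL2

/-- The map `𝔰𝔩₂ → U(𝔰𝔩₂)` as a linear map. -/
def ofSL2Lin : SL2 →ₗ[ℂ] USL2 where
  toFun a := UniversalEnvelopingAlgebra.ι ℂ a
  map_add' := map_add _
  map_smul' := map_smul _

/-- The generators `e`, `f`, `h` of `U(𝔰𝔩₂)`, complemented by `x = y = 0`. -/
def plane : Sl2Plane USL2 :=
  Sl2Plane.ofLin ofSL2Lin 0 UniversalEnvelopingAlgebra.ι_lie (by simp)
    fun _ h _ => UniversalEnvelopingAlgebra.eq_top_of_ι_mem h

theorem plane_e : plane.gen .e = UniversalEnvelopingAlgebra.ι ℂ SL2.e := rfl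
theorem plane_f : plane.gen .f = UniversalEnvelopingAlgebra.ι ℂ SL2.f := rfl
theorem plane_h : plane.gen .h = UniversalEnvelopingAlgebra.ι ℂ SL2.h := rfl
theorem plane_x : plane.gen .x = 0 := rfl
theorem plane_y : plane.gen .y = 0 := rfl

/-- The action of `U(𝔰𝔩₂)` on functions on the lattice. -/
def latRep : USL2 →ₐ[ℂ] Module.End ℂ LatFun :=
  UniversalEnvelopingAlgebra.liftLin (SL2.toLin latE latF latH)
    (SL2.toLin_lie latH_latE latH_latF latE_latF)

theorem latRep_ι (a : SL2) :
    latRep (UniversalEnvelopingAlgebra.ι ℂ a) = SL2.toLin latE latF latH a :=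
  UniversalEnvelopingAlgebra.liftLin_ι _ _ a

theorem latRep_cas : latRep plane.cas = latInv X := by
  refine LatModel.ρ_cas_of ?_ ?_ ?_
  · rw [plane_e, latRep_ι, SL2.toLin_e]
  · rw [plane_f, latRep_ι, SL2.toLin_f]
  · rw [plane_h, latRep_ι, SL2.toLin_h]

/-- The center of `U(𝔰𝔩₂)` consists of the polynomials in the Casimir element. -/
theorem exists_aeval_cas {z : USL2} (hz : z ∈ Subalgebra.center ℂ USL2) :
    ∃ ζ : ℂ[X], z = aeval plane.cas ζ := by
  have hc : ∀ a, Commute a z := fun a => Subalgebra.mem_center_iff.1 hz a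
  have hs : plane.IsFiltered 1 := ⟨le_rfl, by
    rw [plane_x, zero_mul, mul_zero, sub_zero]
    exact Submodule.zero_mem _⟩
  obtain ⟨n, hn⟩ := exists_mem_fil (s := plane) 1 (a := z) (μ := 0) (by
    rw [adOp_eq_zero_iff.2 (hc _)]; simp)
  have key := (highest_le_span (ν := 0) hs ((Finset.range n).filter fun c => 2 * c < n)
    (fun c => plane.cas ^ c) (fun c => plane.cas ^ c) ?_ ?_ ?_ latRep.toLinearMap ?_
    (by simpa using hn) (adOp_eq_zero_iff.2 (hc _))).1
  · have : Submodule.span ℂ ((fun c : ℕ => plane.cas ^ c) ''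
        ((Finset.range n).filter fun c => 2 * c < n)) ≤
        LinearMap.range (aeval (R := ℂ) plane.cas).toLinearMap := by
      rw [Submodule.span_le]
      rintro _ ⟨c, -, rfl⟩
      exact ⟨X ^ c, by simp⟩
    obtain ⟨ζ, hζ⟩ := this key
    exact ⟨ζ, hζ.symm⟩
  · rintro _ ⟨c, k, p, q, h1, h2, h3, rfl⟩
    obtain rfl : p = 0 := by omega
    obtain rfl : q = 2 * k := by rw [wtW_mon] at h3; push_cast at h3; omega
    rcases k with _ | k
    · refine Submodule.subset_span ⟨c, ?_, ?_⟩
      · rw [degW_mon] at h2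
        simp only [Finset.coe_filter, Finset.mem_range, Set.mem_ofPred_eq]
        omega
      · simp [mon]
    · have : plane.word (mon (k + 1) 0 0 0 (2 * (k + 1))) = 0 := by
        refine List.prod_eq_zero (List.mem_map.2 ⟨y, ?_, plane_y⟩)
        rw [← List.count_pos_iff, count_mon]
        simp
      rw [this, mul_zero]
      exact Submodule.zero_mem _
  · intro c hc
    have := cas_pow_mul_mem (one_mem_fil (s := plane) (d := 1)) c
    rw [mul_one] at this
    rw [Finset.mem_filter] at hc
    exact fil_mono (by omega) _ this
  · intro c _
    exact adOp_eq_zero_iff.2 (commute_e_cas.pow_right c)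
  · have : (fun c : {c // c ∈ (Finset.range n).filter fun c => 2 * c < n} =>
        latRep.toLinearMap (plane.cas ^ c.1)) = fun c => latInv (biMonomial (c.1, 0)) := by
      funext c
      rw [AlgHom.toLinearMap_apply, map_pow, latRep_cas, ← latInv_pow]
      congr 1
      simp [biMonomial]
    rw [this]
    exact (linearIndependent_biMonomial.map' latInv
      (LinearMap.ker_eq_bot.2 latInv_injective)).comp
        (fun c : {c // c ∈ (Finset.range n).filter fun c => 2 * c < n} => (c.1, 0))
        fun c c' h => Subtype.ext (congrArg Prod.fst h)

end USL2

namespace HeckeAlg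

variable (z : USL2)

/-- The generators `e`, `f`, `h`, `x`, `y` of `H_z`. -/
def plane : Sl2Plane (HeckeAlg z) :=
  Sl2Plane.ofLin (ofSL2Lin z) (ofV z)
    (fun a b => by simp only [ofSL2Lin_apply, ofSL2_lie])
    (fun a w => by simp only [ofSL2Lin_apply, ofSL2_mul_ofV])
    fun _ h1 h2 => adjoin_eq_top z (fun a => ofSL2Lin_apply z a ▸ h1 a) h2

theorem plane_e : (plane z).gen .e = ofSL2 z SL2.e := ofSL2Lin_apply z _
theorem plane_f : (plane z).gen .f = ofSL2 z SL2.f := ofSL2Lin_apply z _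
theorem plane_h : (plane z).gen .h = ofSL2 z SL2.h := ofSL2Lin_apply z _
theorem plane_x : (plane z).gen .x = ofV z StdRep.x := rfl
theorem plane_y : (plane z).gen .y = ofV z StdRep.y := rfl

theorem ofU_cas : ofU z USL2.plane.cas = (plane z).cas := by
  simp only [cas, map_add, map_smul, map_mul, map_one, USL2.plane_e, USL2.plane_f, USL2.plane_h,
    plane_e, plane_f, plane_h, ofSL2]

theorem bracket_x_y {ζ : ℂ[X]} (hz : z = aeval USL2.plane.cas ζ) :
    (plane z).gen .x * (plane z).gen .y - (plane z).gen .y * (plane z).gen .x =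
      aeval (plane z).cas ζ := by
  rw [plane_x, plane_y, ofV_x_mul_ofV_y, add_sub_cancel_left, ← ofU_cas, aeval_algHom_apply, ← hz]

/-- The operators on the lattice define a representation of `H_z` as soon as the commutator of the
operators of `x` and `y` is the image of `z`. -/
theorem exists_latRep {ζ : ℂ[X]} (hz : z = aeval USL2.plane.cas ζ) (ψ : ℤ → ℂ[X])
    (hψ : latX ψ 1 * latY ψ 1 - latY ψ 1 * latX ψ 1 = aeval (latInv X) ζ) :
    ∃ ρ : HeckeAlg z →ₐ[ℂ] Module.End ℂ LatFun, ρ ((plane z).gen .e) = latE ∧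
      ρ ((plane z).gen .f) = latF ∧ ρ ((plane z).gen .h) = latH ∧
      ρ ((plane z).gen .x) = latX ψ 1 ∧ ρ ((plane z).gen .y) = latY ψ 1 := by
  have hlie := SL2.toLin_lie latH_latE latH_latF latE_latF
  have hact := act_relation_of_basis (SL2.toLin latE latF latH)
    (StdRep.toLin (latX ψ 1) (latY ψ 1))
    (by rw [SL2.toLin_e, StdRep.toLin_x, latE_latX])
    (by rw [SL2.toLin_e, StdRep.toLin_x, StdRep.toLin_y, latE_latY])
    (by rw [SL2.toLin_f, StdRep.toLin_x, StdRep.toLin_y, latF_latX])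
    (by rw [SL2.toLin_f, StdRep.toLin_y, latF_latY])
    (by rw [SL2.toLin_h, StdRep.toLin_x, latH_latX])
    (by rw [SL2.toLin_h, StdRep.toLin_y, latH_latY])
  have hcomm : StdRep.toLin (latX ψ 1) (latY ψ 1) StdRep.x *
      StdRep.toLin (latX ψ 1) (latY ψ 1) StdRep.y =
      StdRep.toLin (latX ψ 1) (latY ψ 1) StdRep.y * StdRep.toLin (latX ψ 1) (latY ψ 1) StdRep.x +
        UniversalEnvelopingAlgebra.liftLin (SL2.toLin latE latF latH) hlie z := by
    have h1 : UniversalEnvelopingAlgebra.liftLin (SL2.toLin latE latF latH) hlie z =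
        aeval (latInv X) ζ := by
      rw [← USL2.latRep_cas, aeval_algHom_apply, ← hz]
      rfl
    rw [h1, StdRep.toLin_x, StdRep.toLin_y, ← hψ, add_sub_cancel]
  refine ⟨lift _ _ hlie hact hcomm, ?_, ?_, ?_, ?_, ?_⟩
  · rw [plane_e, lift_ofSL2, SL2.toLin_e]
  · rw [plane_f, lift_ofSL2, SL2.toLin_f]
  · rw [plane_h, lift_ofSL2, SL2.toLin_h]
  · rw [plane_x, lift_ofV, StdRep.toLin_x]
  · rw [plane_y, lift_ofV, StdRep.toLin_y]

/-- Derivations of `H_z`, where `z = ζ(Δ)`, modulo inner ones; see `LatModel.exists_inner_add`. -/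
theorem exists_inner_add {ζ : ℂ[X]} (hz : z = aeval USL2.plane.cas ζ)
    {D : HeckeAlg z →ₗ[ℂ] HeckeAlg z} (hD : IsDerivationMap D) :
    ∃ g k, (∀ a, Commute k a) ∧ (ζ ≠ 0 → k = 0) ∧
      (∀ i, i ≠ .x → i ≠ .y → D ((plane z).gen i) = adOp g ((plane z).gen i)) ∧
      (∀ i, i = .x ∨ i = .y →
        D ((plane z).gen i) = adOp g ((plane z).gen i) + k * (plane z).gen i) := by
  obtain ⟨W, hW⟩ := exists_sub_comp (X * ζ.comp (X ^ 2))
  obtain ⟨d, M, hM⟩ := exists_latModel ζ W hW (bracket_x_y z hz) (exists_latRep z hz)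
  exact LatModel.exists_inner_add hM hW (bracket_x_y z hz) hD

theorem isInnerMap_of_ne_zero (hz : z ∈ Subalgebra.center ℂ USL2) (h0 : z ≠ 0)
    {D : HeckeAlg z →ₗ[ℂ] HeckeAlg z} (hD : IsDerivationMap D) : IsInnerMap D := by
  obtain ⟨ζ, hζ⟩ := USL2.exists_aeval_cas hz
  obtain ⟨g, k, -, hk, h1, h2⟩ := exists_inner_add z hζ hD
  have hk0 : k = 0 := hk fun h => h0 (by rw [hζ, h, map_zero])
  have : D = adOp g := derivation_ext (s := plane z) hD (isDerivationMap_adOp g) fun i => by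
    by_cases hi : i = .x ∨ i = .y
    · rw [h2 i hi, hk0, zero_mul, add_zero]
    · rw [not_or] at hi
      exact h1 i hi.1 hi.2
  exact ⟨g, fun b => by rw [this, adOp_apply]⟩

theorem subsingleton_HH1 {A : Type*} [Ring A] [Algebra ℂ A]
    (h : ∀ D : A →ₗ[ℂ] A, IsDerivationMap D → IsInnerMap D) : Subsingleton (HH1 ℂ A) := by
  refine subsingleton_of_forall_eq 0 fun c => ?_
  obtain ⟨D, rfl⟩ := HH1.mk_surjective c
  exact (HH1.mk_eq_zero_iff D).2 (h _ ((mem_hochschildZ1_iff _).1 D.2))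

/-! ### The Euler derivation -/

section Euler

open TrivSqZeroExt

/-- The algebra map `a ↦ a + ε E(a)` to the dual numbers. -/
def eulerHom : HeckeAlg 0 →ₐ[ℂ] TrivSqZeroExt (HeckeAlg 0) (HeckeAlg 0) :=
  lift ((inlAlgHom ℂ (HeckeAlg 0) (HeckeAlg 0)).toLinearMap ∘ₗ ofSL2Lin 0)
    ((inlAlgHom ℂ (HeckeAlg 0) (HeckeAlg 0)).toLinearMap ∘ₗ ofV 0 +
      (inrHom (HeckeAlg 0) (HeckeAlg 0)).restrictScalars ℂ ∘ₗ ofV 0)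
    (fun a b => by
      simp only [LinearMap.comp_apply, ofSL2Lin_apply, ofSL2_lie, map_sub, map_mul,
        AlgHom.toLinearMap_apply])
    (fun a w => by
      have h := ofSL2_mul_ofV 0 a w
      refine TrivSqZeroExt.ext ?_ ?_ <;>
      simp [ofSL2Lin_apply, h])
    (by
      have h := ofV_x_mul_ofV_y 0
      rw [map_zero, add_zero] at h
      rw [map_zero, add_zero]
      refine TrivSqZeroExt.ext ?_ ?_ <;> simp [h])

theorem eulerHom_ofSL2 (a : SL2) : eulerHom (ofSL2 0 a) = inl (ofSL2 0 a) := by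
  rw [eulerHom, lift_ofSL2, ← ofSL2Lin_apply]
  rfl

theorem eulerHom_ofV (v : StdRep) : eulerHom (ofV 0 v) = inl (ofV 0 v) + inr (ofV 0 v) := by
  rw [eulerHom, lift_ofV]
  rfl

theorem fst_eulerHom (a : HeckeAlg 0) : (eulerHom a).fst = a := by
  have : (fstHom ℂ (HeckeAlg 0) (HeckeAlg 0)).comp eulerHom = AlgHom.id ℂ _ :=
    algHom_ext 0 (fun a => by simp [eulerHom_ofSL2]) (fun v => by simp [eulerHom_ofV])
  exact AlgHom.congr_fun this a

/-- The Euler derivation. -/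
def euler : HeckeAlg 0 →ₗ[ℂ] HeckeAlg 0 :=
  (sndHom (HeckeAlg 0) (HeckeAlg 0)).restrictScalars ℂ ∘ₗ eulerHom.toLinearMap

theorem euler_apply (a : HeckeAlg 0) : euler a = (eulerHom a).snd := rfl

theorem isDerivationMap_euler : IsDerivationMap euler := by
  intro a b
  simp only [euler_apply, map_mul, snd_mul, fst_eulerHom, smul_eq_mul, MulOpposite.smul_eq_mul_unop,
    MulOpposite.unop_op]
  rw [add_comm]

theorem euler_ofSL2 (a : SL2) : euler (ofSL2 0 a) = 0 := by
  simp [euler_apply, eulerHom_ofSL2]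

theorem euler_ofV (v : StdRep) : euler (ofV 0 v) = ofV 0 v := by
  simp [euler_apply, eulerHom_ofV]

end Euler

end HeckeAlg

end

noncomputable section

open Polynomial Gen Sl2Plane

namespace HeckeAlg

/-! ### The algebra `H_0` as an enveloping algebra -/

section Iso

open LieAlgebra.SemiDirectSum

/-- The algebra map `H_0 → U(𝔰𝔩₂ ⋉ V)`. -/
def toSemidirect : HeckeAlg 0 →ₐ[ℂ] UniversalEnvelopingAlgebra ℂ SL2V :=
  lift
    { toFun a := UniversalEnvelopingAlgebra.ι ℂ (inr StdRep.actDer a)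
      map_add' a b := by rw [map_add, map_add]
      map_smul' c a := by rw [map_smul, map_smul, RingHom.id_apply] }
    { toFun v := UniversalEnvelopingAlgebra.ι ℂ (inl StdRep.actDer v)
      map_add' a b := by rw [map_add, map_add]
      map_smul' c a := by rw [map_smul, map_smul, RingHom.id_apply] }
    (fun a b => by
      change UniversalEnvelopingAlgebra.ι ℂ (inr StdRep.actDer ⁅a, b⁆) = _
      rw [LieHom.map_lie, UniversalEnvelopingAlgebra.ι_lie]
      rfl)
    (fun a w => by
      have h : ⁅inr StdRep.actDer a, inl StdRep.actDer w⁆ =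
          inl StdRep.actDer (StdRep.act a w) := by
        refine LieAlgebra.SemiDirectSum.ext ?_ ?_
        · change ⁅(0 : StdRep), w⁆ + StdRep.actDer a w - StdRep.actDer 0 0 = _
          rw [StdRep.lie_eq_zero, map_zero, zero_add, sub_zero]
          rfl
        · exact lie_zero a
      have h2 := congrArg (UniversalEnvelopingAlgebra.ι ℂ) h
      rw [UniversalEnvelopingAlgebra.ι_lie] at h2
      exact (eq_add_of_sub_eq' h2))
    (by
      have h : ⁅inl StdRep.actDer StdRep.x, inl StdRep.actDer StdRep.y⁆ = 0 := by
        rw [← LieHom.map_lie, StdRep.lie_eq_zero, map_zero]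
      have h2 := congrArg (UniversalEnvelopingAlgebra.ι ℂ) h
      rw [UniversalEnvelopingAlgebra.ι_lie, map_zero] at h2
      rw [map_zero]
      exact eq_add_of_sub_eq' h2)

theorem toSemidirect_ofSL2 (a : SL2) : toSemidirect (ofSL2 0 a) =
    UniversalEnvelopingAlgebra.ι ℂ (inr StdRep.actDer a) := lift_ofSL2 _ _ _ _ _ a

theorem toSemidirect_ofV (v : StdRep) : toSemidirect (ofV 0 v) =
    UniversalEnvelopingAlgebra.ι ℂ (inl StdRep.actDer v) := lift_ofV _ _ _ _ _ v

/-- Elements of `V` commute in `H_0`. -/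
theorem commute_ofV (v w : StdRep) : Commute (ofV 0 v) (ofV 0 w) := by
  have h : Commute (ofV 0 StdRep.x) (ofV 0 StdRep.y) := by
    have := ofV_x_mul_ofV_y 0
    rwa [map_zero, add_zero] at this
  rw [StdRep.eq_sum v, StdRep.eq_sum w]
  simp only [map_add, map_smul]
  refine Commute.add_left (Commute.add_right ?_ ?_) (Commute.add_right ?_ ?_)
  · exact ((Commute.refl _).smul_left _).smul_right _
  · exact (h.smul_left _).smul_right _
  · exact (h.symm.smul_left _).smul_right _
  · exact ((Commute.refl _).smul_left _).smul_right _

/-- The algebra map `U(𝔰𝔩₂ ⋉ V) → H_0`. -/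
def ofSemidirect : UniversalEnvelopingAlgebra ℂ SL2V →ₐ[ℂ] HeckeAlg 0 :=
  UniversalEnvelopingAlgebra.liftLin
    { toFun p := ofSL2Lin 0 p.right + ofV 0 p.left
      map_add' p q := by
        change ofSL2Lin 0 (p.right + q.right) + ofV 0 (p.left + q.left) = _
        rw [map_add, map_add]
        abel
      map_smul' c p := by
        change ofSL2Lin 0 (c • p.right) + ofV 0 (c • p.left) = _
        rw [map_smul, map_smul, RingHom.id_apply, smul_add] }
    (fun p q => by
      change ofSL2Lin 0 ⁅p.right, q.right⁆ + ofV 0 (⁅p.left, q.left⁆ +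
        StdRep.act p.right q.left - StdRep.act q.right p.left) =
        (ofSL2Lin 0 p.right + ofV 0 p.left) * (ofSL2Lin 0 q.right + ofV 0 q.left) -
        (ofSL2Lin 0 q.right + ofV 0 q.left) * (ofSL2Lin 0 p.right + ofV 0 p.left)
      simp only [ofSL2Lin_apply, ofSL2_lie, StdRep.lie_eq_zero, zero_add, map_sub, mul_add,
        add_mul, ofSL2_mul_ofV, (commute_ofV p.left q.left).eq]
      abel)

theorem ofSemidirect_ι (p : SL2V) : ofSemidirect (UniversalEnvelopingAlgebra.ι ℂ p) =
    ofSL2 0 p.right + ofV 0 p.left :=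
  (UniversalEnvelopingAlgebra.liftLin_ι _ _ p).trans
    (congrArg (· + ofV 0 p.left) (ofSL2Lin_apply 0 p.right))

/-- The isomorphism of `H_0` with `U(𝔰𝔩₂ ⋉ V)`. -/
def equivSemidirect : HeckeAlg 0 ≃ₐ[ℂ] UniversalEnvelopingAlgebra ℂ SL2V :=
  AlgEquiv.ofAlgHom toSemidirect ofSemidirect
    (UniversalEnvelopingAlgebra.algHom_ext fun p => by
      rw [AlgHom.comp_apply, ofSemidirect_ι, map_add, toSemidirect_ofSL2, toSemidirect_ofV,
        ← map_add]
      refine congrArg (UniversalEnvelopingAlgebra.ι ℂ) (LieAlgebra.SemiDirectSum.ext ?_ ?_)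
      · exact zero_add p.left
      · exact add_zero p.right)
    (algHom_ext 0
      (fun a => by
        rw [AlgHom.comp_apply, toSemidirect_ofSL2, ofSemidirect_ι]
        change ofSL2 0 a + ofV 0 0 = ofSL2 0 a
        rw [map_zero, add_zero])
      fun v => by
        rw [AlgHom.comp_apply, toSemidirect_ofV, ofSemidirect_ι]
        change ofSL2 0 0 + ofV 0 v = ofV 0 v
        rw [← ofSL2Lin_apply, map_zero, zero_add])

end Iso

/-! ### The Euler class is a basis -/

/-- The Euler derivation as a cocycle. -/
def eulerCocycle : hochschildZ1 ℂ (HeckeAlg 0) :=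
  ⟨euler, (mem_hochschildZ1_iff _).2 isDerivationMap_euler⟩

theorem euler_plane_of_ne {i : Gen} (hx : i ≠ .x) (hy : i ≠ .y) : euler ((plane 0).gen i) = 0 := by
  cases i
  · rw [plane_e, euler_ofSL2]
  · rw [plane_f, euler_ofSL2]
  · rw [plane_h, euler_ofSL2]
  · exact absurd rfl hx
  · exact absurd rfl hy

theorem euler_plane_of_eq {i : Gen} (hi : i = .x ∨ i = .y) :
    euler ((plane 0).gen i) = (plane 0).gen i := by
  rcases hi with rfl | rfl
  · exact euler_ofV _
  · exact euler_ofV _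

theorem smul_euler_apply (c : Subalgebra.center ℂ (HeckeAlg 0)) (a : HeckeAlg 0) :
    (c • eulerCocycle).1 a = (c : HeckeAlg 0) * euler a := rfl

theorem eq_zero_of_smul_euler (c : Subalgebra.center ℂ (HeckeAlg 0))
    (h : IsInnerMap (c • eulerCocycle).1) : c = 0 := by
  obtain ⟨g, hg⟩ := h
  obtain ⟨d, M, -⟩ := exists_latModel (s := plane 0) 0 0 (by simp)
    (bracket_x_y 0 (map_zero _).symm) (exists_latRep 0 (map_zero _).symm)
  have hcomm : ∀ i : Gen, i ≠ .x → i ≠ .y → Commute ((plane 0).gen i) g := fun i hx hy => by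
    have := hg ((plane 0).gen i)
    rw [smul_euler_apply, euler_plane_of_ne hx hy, mul_zero, eq_comm, sub_eq_zero] at this
    exact this.symm
  refine Subtype.ext (M.eq_zero_of_inner (g := g) (fun a => ?_) (hcomm _ ?_ ?_)
    (hcomm _ ?_ ?_) ?_)
  · exact (Subalgebra.mem_center_iff.1 c.2 a).symm
  any_goals decide
  · have := hg ((plane 0).gen .x)
    rw [smul_euler_apply, euler_plane_of_eq (Or.inl rfl)] at this
    rw [adOp_apply, this]

theorem exists_smul_euler (D : hochschildZ1 ℂ (HeckeAlg 0)) :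
    ∃ c : Subalgebra.center ℂ (HeckeAlg 0), IsInnerMap (D - c • eulerCocycle).1 := by
  have hD := (mem_hochschildZ1_iff _).1 D.2
  obtain ⟨g, k, hk, -, h1, h2⟩ := exists_inner_add 0 (ζ := 0) (map_zero _).symm hD
  let c : Subalgebra.center ℂ (HeckeAlg 0) :=
    ⟨k, Subalgebra.mem_center_iff.2 fun a => (hk a).eq.symm⟩
  refine ⟨c, g, fun b => ?_⟩
  have : (D - c • eulerCocycle).1 = adOp g := by
    refine derivation_ext (s := plane 0) ((mem_hochschildZ1_iff _).1 (D - c • eulerCocycle).2)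
      (isDerivationMap_adOp g) fun i => ?_
    change D.1 ((plane 0).gen i) - k * euler ((plane 0).gen i) = _
    by_cases hi : i = .x ∨ i = .y
    · rw [h2 i hi, euler_plane_of_eq hi, add_sub_cancel_right]
    · rw [not_or] at hi
      rw [h1 i hi.1 hi.2, euler_plane_of_ne hi.1 hi.2, mul_zero, sub_zero]
  rw [this, adOp_apply]

/-- The class of the Euler derivation, as a basis of `HH¹(H_0, H_0)`. -/
def eulerBasis : Module.Basis Unit (Subalgebra.center ℂ (HeckeAlg 0)) (HH1 ℂ (HeckeAlg 0)) :=
  Module.Basis.mk (v := fun _ => HH1.mk ℂ (HeckeAlg 0) eulerCocycle)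
    (by
      rw [Fintype.linearIndependent_iff]
      intro c hc i
      rw [Fintype.sum_unique, ← map_smul, HH1.mk_eq_zero_iff] at hc
      exact eq_zero_of_smul_euler _ hc)
    (by
      intro D _
      obtain ⟨D, rfl⟩ := HH1.mk_surjective D
      obtain ⟨c, hc⟩ := exists_smul_euler D
      have h := (map_sub (HH1.mk ℂ (HeckeAlg 0)) D (c • eulerCocycle)).symm.trans
        ((HH1.mk_eq_zero_iff _).2 hc)
      rw [sub_eq_zero.1 h, map_smul]
      exact Submodule.smul_mem _ _ (Submodule.subset_span ⟨(), rfl⟩))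

end HeckeAlg

end

theorem theorem2 :
    -- for `z ≠ 0` every derivation is inner, that is, `HH¹(H_z, H_z) = 0`
    (∀ z : USL2, z ∈ Subalgebra.center ℂ USL2 → z ≠ 0 →
      (∀ D : HeckeAlg z →ₗ[ℂ] HeckeAlg z, IsDerivationMap D → IsInnerMap D) ∧
      Subsingleton (HH1 ℂ (HeckeAlg z))) ∧
    -- `H_0` is the enveloping algebra of `𝔰𝔩₂ ⋉ V`
    (∃ φ : HeckeAlg 0 ≃ₐ[ℂ] UniversalEnvelopingAlgebra ℂ SL2V,
      (∀ a : SL2, φ (HeckeAlg.ofSL2 0 a) =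
        UniversalEnvelopingAlgebra.ι ℂ (LieAlgebra.SemiDirectSum.inr StdRep.actDer a)) ∧
      (∀ v : StdRep, φ (HeckeAlg.ofV 0 v) =
        UniversalEnvelopingAlgebra.ι ℂ (LieAlgebra.SemiDirectSum.inl StdRep.actDer v))) ∧
    -- the Euler derivation `E` of `H_0` exists, is `𝔰𝔩₂`-invariant, and its class is a basis of
    -- `HH¹(H_0, H_0)` over the center of `H_0`
    (∃ E : hochschildZ1 ℂ (HeckeAlg 0),
      (∀ a : SL2, E.1 (HeckeAlg.ofSL2 0 a) = 0) ∧
      E.1 (HeckeAlg.ofV 0 StdRep.x) = HeckeAlg.ofV 0 StdRep.x ∧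
      E.1 (HeckeAlg.ofV 0 StdRep.y) = HeckeAlg.ofV 0 StdRep.y ∧
      (∀ (a : SL2) (m : HeckeAlg 0),
        E.1 (HeckeAlg.ofSL2 0 a * m - m * HeckeAlg.ofSL2 0 a) =
          HeckeAlg.ofSL2 0 a * E.1 m - E.1 m * HeckeAlg.ofSL2 0 a) ∧
      ∃ b : Module.Basis Unit (Subalgebra.center ℂ (HeckeAlg 0)) (HH1 ℂ (HeckeAlg 0)),
        b () = HH1.mk ℂ (HeckeAlg 0) E) := by
  refine ⟨fun z hz h0 => ?_, ⟨HeckeAlg.equivSemidirect, HeckeAlg.toSemidirect_ofSL2,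
    HeckeAlg.toSemidirect_ofV⟩, HeckeAlg.eulerCocycle, HeckeAlg.euler_ofSL2,
    HeckeAlg.euler_ofV _, HeckeAlg.euler_ofV _, fun a m => ?_, HeckeAlg.eulerBasis, ?_⟩
  · have h : ∀ D : HeckeAlg z →ₗ[ℂ] HeckeAlg z, IsDerivationMap D → IsInnerMap D :=
      fun D => HeckeAlg.isInnerMap_of_ne_zero z hz h0
    exact ⟨h, HeckeAlg.subsingleton_HH1 h⟩
  · exact HeckeAlg.isDerivationMap_euler.map_adOp (HeckeAlg.euler_ofSL2 a) m
  · exact Module.Basis.mk_apply _ _ _
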